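/- Let $B$ be a commutative complex Banach algebra (not necessarily unital), and let $B^{\#}$ denote its conditional unitization: $B^{\#}=B$ if $B$ has an identity element, and $B^{\#}=\mathbb C\oplus B$ (the forced unitization) otherwise. For a symmetric Banach $B$-bimodule $X$ (i.e. $bx=xb$), let $C_n(B,X)=X\widehat\otimes B^{\widehat\otimes n}$ be the Hochschild chains with boundary maps $\mathsf d_n:C_{n+1}(B,X)\to C_n(B,X)$, and $C^n(B,X)$ the bounded $n$-linear maps $B^n\to X$ with the Hochschild coboundary. For $n\ge1$ let $e_n\in\mathbb Q S_n$ be the first Barr–Gerstenhaber–Schack (Eulerian) idempotent $$e_n=\prod_{j=2}^{n}\Bigl(1-\frac{s_n}{2^j-2}\Bigr),\qquad s_n=\sum_{0<p<n}\ \sum_{\sigma\ (p,n-p)\text{-shuffle}}\operatorname{sgn}(\sigma)\,\sigma ,$$ where $\sigma$ acts by moving the $i$-th tensor factor to position $\sigma(i)$. The Harrison complexes are the summands $C^{\rm Harr}_n(B,X)=(\mathrm{id}\otimes e_n)C_n(B,X)$ and $C_{\rm Harr}^n(B,X)=\{\psi\circ e_n:\psi\in C^n(B,X)\}$, $n\ge1$;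 their homology and cohomology, with the quotient seminorms, are $H^{\rm Harr}_n(B,X)$ and $H_{\rm Harr}^n(B,X)$. Suppose that the complex of Banach spaces $$C_1(B,B^{\#})\xleftarrow{\ \mathsf d_1\ }C^{\rm Harr}_2(B,B^{\#})\xleftarrow{\ \mathsf d_2\ }C^{\rm Harr}_3(B,B^{\#})\xleftarrow{\ \mathsf d_3\ }\cdots$$ is split exact, i.e. there are bounded linear maps $s_n:C^{\rm Harr}_n(B,B^{\#})\to C^{\rm Harr}_{n+1}(B,B^{\#})$ ($n\ge 1$) with $s_n\mathsf d_n+\mathsf d_{n+1}s_{n+1}=\mathrm{id}$ for all $n\ge1$. Then the Hochschild homology group $H_1=H_1(B,B^{\#})$, with its quotient seminorm and the induced $B$-action, is a left Banach $B$-module (in particular it is Hausdorff), and it is unit-linked if $B$ is unital. Moreover $H_1$ has an admissible projective resolution, and for every symmetric Banach $B$-bimodule $X$ and every $n\ge1$ there are isomorphisms of seminormed spaces (bounded linear bijections with bounded inverse) $$H^n_{\rm Harr}(B,X)\cong \operatorname{Ext}_B^{\,n-1}(H_1,X_L),\qquad H_n^{\rm Harr}(B,X)\cong\operatorname{Tor}^B_{n-1}(X_R,H_1),$$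 where $X_L$, $X_R$ are the left and right $B$-modules underlying $X$. Here $\operatorname{Ext}$ and $\operatorname{Tor}$ are the seminormed spaces $H^{n-1}\bigl({}_B\mathrm{Hom}(P_\bullet,X_L)\bigr)$ and $H_{n-1}\bigl(X_R\widehat\otimes_BP_\bullet\bigr)$ computed from an arbitrary admissible projective resolution $0\leftarrow H_1\leftarrow P_0\leftarrow P_1\leftarrow\cdots$ in the category of left Banach $B$-modules: the $P_i$ are projective relative to module surjections that have a bounded linear right inverse, and the resolution is split exact as a complex of Banach spaces. -/

import Mathlib

open scoped TensorProduct

set_option linter.unusedSectionVars false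

universe u v w

noncomputable section

namespace BanachHarrison

/-! ### The projective tensor product of two (semi)normed spaces -/

section ProjectiveTensor

variable (E : Type u) (F : Type v)
  [SeminormedAddCommGroup E] [NormedSpace ℂ E] [SeminormedAddCommGroup F] [NormedSpace ℂ F]

/-- The algebraic tensor product `E ⊗ F`, as a type that will carry the projective seminorm. -/
def AlgTensor : Type (max u v) := E ⊗[ℂ] F

instance : AddCommGroup (AlgTensor E F) := inferInstanceAs (AddCommGroup (E ⊗[ℂ] F))
instance : Module ℂ (AlgTensor E F) := inferInstanceAs (Module ℂ (E ⊗[ℂ] F))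

variable {E F}

/-- The finite representations `z = ∑ xᵢ ⊗ yᵢ` of an element of the algebraic tensor product. -/
def reps (z : E ⊗[ℂ] F) : Set (List (E × F)) :=
  {l | (l.map fun p => p.1 ⊗ₜ[ℂ] p.2).sum = z}

/-- The weight `∑ ‖xᵢ‖ ‖yᵢ‖` of a representation. -/
def weight (l : List (E × F)) : ℝ := (l.map fun p => ‖p.1‖ * ‖p.2‖).sum

lemma weight_nonneg (l : List (E × F)) : 0 ≤ weight l := by
  refine List.sum_nonneg fun a h => ?_
  obtain ⟨p, -, rfl⟩ := List.mem_map.1 h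
  positivity

lemma reps_nonempty (z : E ⊗[ℂ] F) : (reps z).Nonempty := by
  induction z with
  | zero => exact ⟨[], by simp [reps]⟩
  | tmul x y => exact ⟨[(x, y)], by simp [reps]⟩
  | add z₁ z₂ h₁ h₂ =>
    obtain ⟨l₁, h₁⟩ := h₁
    obtain ⟨l₂, h₂⟩ := h₂
    simp only [reps, Set.mem_ofPred_eq] at h₁ h₂
    exact ⟨l₁ ++ l₂, by simp [reps, h₁, h₂]⟩

/-- The projective seminorm: the infimum of `∑ ‖xᵢ‖ ‖yᵢ‖` over all representations
`z = ∑ xᵢ ⊗ yᵢ`. -/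
def projNorm (z : E ⊗[ℂ] F) : ℝ := sInf (weight '' reps z)

lemma projNorm_le {z : E ⊗[ℂ] F} {l : List (E × F)} (h : l ∈ reps z) : projNorm z ≤ weight l :=
  csInf_le ⟨0, by rintro _ ⟨l, -, rfl⟩; exact weight_nonneg l⟩ ⟨l, h, rfl⟩

lemma le_projNorm {z : E ⊗[ℂ] F} {c : ℝ} (h : ∀ l ∈ reps z, c ≤ weight l) : c ≤ projNorm z :=
  le_csInf ((reps_nonempty z).image _) (by rintro _ ⟨l, hl, rfl⟩; exact h l hl)

lemma projNorm_zero : projNorm (0 : E ⊗[ℂ] F) = 0 :=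
  le_antisymm ((projNorm_le (l := []) (by simp [reps])).trans (by simp [weight]))
    (le_projNorm fun l _ => weight_nonneg l)

lemma projNorm_add_le (z₁ z₂ : E ⊗[ℂ] F) : projNorm (z₁ + z₂) ≤ projNorm z₁ + projNorm z₂ := by
  rw [← sub_le_iff_le_add]
  refine le_projNorm fun l₁ h₁ => ?_
  rw [sub_le_iff_le_add', ← sub_le_iff_le_add]
  refine le_projNorm fun l₂ h₂ => ?_
  rw [sub_le_iff_le_add']
  simp only [reps, Set.mem_ofPred_eq] at h₁ h₂
  refine (projNorm_le (l := l₁ ++ l₂) (by simp [reps, h₁, h₂])).trans ?_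
  simp [weight]

lemma projNorm_smul_le (c : ℂ) (z : E ⊗[ℂ] F) : projNorm (c • z) ≤ ‖c‖ * projNorm z := by
  rcases eq_or_ne c 0 with rfl | hc
  · simp [projNorm_zero]
  have hc' : 0 < ‖c‖ := norm_pos_iff.2 hc
  rw [← div_le_iff₀' hc']
  refine le_projNorm fun l h => ?_
  rw [div_le_iff₀' hc']
  simp only [reps, Set.mem_ofPred_eq] at h
  refine (projNorm_le (l := l.map fun p => (c • p.1, p.2)) ?_).trans (le_of_eq ?_)
  · simp only [reps, Set.mem_ofPred_eq, List.map_map, ← h, List.smul_sum]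
    simp [Function.comp_def, TensorProduct.smul_tmul']
  · simp [weight, Function.comp_def, norm_smul, mul_assoc, List.sum_map_mul_left]

variable (E F)

/-- The projective seminorm, bundled. -/
def projSeminorm : Seminorm ℂ (AlgTensor E F) :=
  Seminorm.ofSMulLE (E := AlgTensor E F) (projNorm (E := E) (F := F)) projNorm_zero projNorm_add_le
    projNorm_smul_le

instance : SeminormedAddCommGroup (AlgTensor E F) :=
  (projSeminorm E F).toAddGroupSeminorm.toSeminormedAddCommGroup

instance : NormedSpace ℂ (AlgTensor E F) := ⟨projNorm_smul_le (E := E) (F := F)⟩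

/-- The projective tensor product `E ⊗̂ F`: the (separated) completion of the algebraic tensor
product for the projective seminorm. -/
abbrev ProjTensor : Type (max u v) := UniformSpace.Completion (AlgTensor E F)

variable {E F}

lemma norm_tmul_le (x : E) (y : F) : projNorm (x ⊗ₜ[ℂ] y) ≤ ‖x‖ * ‖y‖ :=
  (projNorm_le (l := [(x, y)]) (by simp [reps])).trans (by simp [weight])

variable (E F)

/-- The canonical bounded bilinear map `(x, y) ↦ x ⊗ y`. -/
def ptmul : E →L[ℂ] F →L[ℂ] ProjTensor E F :=
  LinearMap.mkContinuous₂
    ((TensorProduct.mk ℂ E F).compr₂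
      (UniformSpace.Completion.toComplL (𝕜 := ℂ) (E := AlgTensor E F)).toLinearMap) 1
    (fun x y => by
      rw [one_mul]
      refine le_trans (le_of_eq ?_) (norm_tmul_le x y)
      exact UniformSpace.Completion.norm_coe (E := AlgTensor E F) _)

variable {E F} {G : Type w} [NormedAddCommGroup G] [NormedSpace ℂ G] [CompleteSpace G]

lemma norm_lift_le (f : E →L[ℂ] F →L[ℂ] G) (z : E ⊗[ℂ] F) :
    ‖TensorProduct.lift (f.toLinearMap₁₂) z‖ ≤ ‖f‖ * projNorm z := by
  rcases (norm_nonneg f).eq_or_lt with hf | hf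
  · have : ∀ z : E ⊗[ℂ] F, TensorProduct.lift (f.toLinearMap₁₂) z = 0 := by
      intro z
      induction z with
      | zero => simp
      | tmul x y =>
        have := f.le_opNorm₂ x y
        rw [← hf, zero_mul, zero_mul] at this
        simpa using this
      | add a b ha hb => simp [ha, hb]
    simp [this, ← hf]
  rw [← div_le_iff₀' hf]
  refine le_projNorm fun l hl => ?_
  rw [div_le_iff₀' hf]
  simp only [reps, Set.mem_ofPred_eq] at hl
  rw [← hl]
  clear hl
  induction l with
  | nil => simp [weight]
  | cons p l ih =>
    simp only [weight, List.map_cons, List.sum_cons, map_add] at ih ⊢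
    refine (norm_add_le _ _).trans ?_
    rw [mul_add]
    refine add_le_add ?_ ih
    simpa [mul_assoc] using f.le_opNorm₂ p.1 p.2

/-- The map on the algebraic tensor product induced by a bounded bilinear map. -/
def algLift (f : E →L[ℂ] F →L[ℂ] G) : AlgTensor E F →L[ℂ] G :=
  LinearMap.mkContinuous (E := AlgTensor E F) (TensorProduct.lift (f.toLinearMap₁₂)) ‖f‖
    (norm_lift_le f)

/-- The universal property: the bounded linear map `E ⊗̂ F → G` with `x ⊗ y ↦ f x y`. -/
def plift (f : E →L[ℂ] F →L[ℂ] G) : ProjTensor E F →L[ℂ] G :=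
  (algLift f).extend UniformSpace.Completion.toComplL

lemma plift_coe (f : E →L[ℂ] F →L[ℂ] G) (z : AlgTensor E F) :
    plift f (z : ProjTensor E F) = algLift f z :=
  ContinuousLinearMap.extend_eq (algLift f) (e := UniformSpace.Completion.toComplL (𝕜 := ℂ))
    UniformSpace.Completion.denseRange_coe
    (UniformSpace.Completion.isUniformInducing_coe _) z

@[simp] lemma plift_ptmul (f : E →L[ℂ] F →L[ℂ] G) (x : E) (y : F) :
    plift f (ptmul E F x y) = f x y := by
  exact (plift_coe f (x ⊗ₜ[ℂ] y)).trans (TensorProduct.lift.tmul (f' := f.toLinearMap₁₂) x y)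

lemma norm_plift_le (f : E →L[ℂ] F →L[ℂ] G) (z : ProjTensor E F) :
    ‖plift f z‖ ≤ ‖f‖ * ‖z‖ := by
  induction z using UniformSpace.Completion.induction_on with
  | hp => exact isClosed_le (by fun_prop) (by fun_prop)
  | ih z =>
    rw [plift_coe, UniformSpace.Completion.norm_coe]
    exact norm_lift_le f z

lemma ptensor_ext {f g : ProjTensor E F →L[ℂ] G}
    (h : ∀ x y, f (ptmul E F x y) = g (ptmul E F x y)) : f = g := by
  ext z
  induction z using UniformSpace.Completion.induction_on with
  | hp => exact isClosed_eq (by fun_prop) (by fun_prop)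
  | ih z =>
    suffices H : (f.comp UniformSpace.Completion.toComplL).toLinearMap =
        (g.comp UniformSpace.Completion.toComplL).toLinearMap from DFunLike.congr_fun H z
    exact TensorProduct.ext' (R := ℂ) (M := E) (N := F) h

variable (E F G)

/-- `plift` as a bounded linear map. -/
def pliftL : (E →L[ℂ] F →L[ℂ] G) →L[ℂ] (ProjTensor E F →L[ℂ] G) :=
  LinearMap.mkContinuous
    { toFun := fun f : E →L[ℂ] F →L[ℂ] G => plift f
      map_add' := fun f g => ptensor_ext fun x y => by simp
      map_smul' := fun c f => ptensor_ext fun x y => by simp } 1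
    (fun f => by
      rw [one_mul]
      exact ContinuousLinearMap.opNorm_le_bound _ (norm_nonneg f) (norm_plift_le f))

@[simp] lemma pliftL_apply (f : E →L[ℂ] F →L[ℂ] G) : pliftL E F G f = plift f := rfl

variable {E F}

/-- `id ⊗̂ g : E ⊗̂ F → E ⊗̂ F'`. -/
def pmapRight (E : Type u) [SeminormedAddCommGroup E] [NormedSpace ℂ E] {F' : Type w}
    [SeminormedAddCommGroup F'] [NormedSpace ℂ F'] (g : F →L[ℂ] F') :
    ProjTensor E F →L[ℂ] ProjTensor E F' :=
  plift ((ContinuousLinearMap.compL ℂ F F' (ProjTensor E F')).flip g ∘L ptmul E F')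

@[simp] lemma pmapRight_ptmul (E : Type u) [SeminormedAddCommGroup E] [NormedSpace ℂ E]
    {F' : Type w} [SeminormedAddCommGroup F'] [NormedSpace ℂ F'] (g : F →L[ℂ] F') (x : E) (y : F) :
    pmapRight E g (ptmul E F x y) = ptmul E F' x (g y) := by
  simp [pmapRight]

end ProjectiveTensor

/-! ### Subquotients -/

/-- The subquotient `Z / B` of a seminormed space, with the quotient seminorm (`B ⊆ Z` are the
boundaries and the cycles of some complex). -/
abbrev SubQuot {V : Type u} [SeminormedAddCommGroup V] [NormedSpace ℂ V]
    (Z B : Submodule ℂ V) : Type u := ↥Z ⧸ B.submoduleOf Z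

/-! ### Modules over a commutative Banach algebra -/

section Modules

variable (B : Type u) [NonUnitalNormedCommRing B] [NormedSpace ℂ B]

/-- A left module structure on the (semi)normed space `E`, with jointly continuous (not
necessarily contractive) action. If `E` is a Banach space this is a left Banach `B`-module. -/
class LeftBMod (E : Type v) [SeminormedAddCommGroup E] [NormedSpace ℂ E] where
  lact : B →L[ℂ] E →L[ℂ] E
  lact_mul : ∀ a b x, lact (a * b) x = lact a (lact b x)

/-- A right module structure with jointly continuous action; `ract b x` is `x · b`. -/
class RightBMod (E : Type v) [SeminormedAddCommGroup E] [NormedSpace ℂ E] where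
  ract : B →L[ℂ] E →L[ℂ] E
  ract_mul : ∀ a b x, ract (a * b) x = ract b (ract a x)


/-- A bimodule structure with jointly continuous actions. -/
class BiBMod (E : Type v) [SeminormedAddCommGroup E] [NormedSpace ℂ E]
    extends LeftBMod B E, RightBMod B E where
  act_assoc : ∀ a b x, ract b (lact a x) = lact a (ract b x)

/-- A bimodule is symmetric if `b · x = x · b`. -/
def IsSymmBMod (E : Type v) [SeminormedAddCommGroup E] [NormedSpace ℂ E] [BiBMod B E] : Prop :=
  ∀ (b : B) (x : E), LeftBMod.lact b x = RightBMod.ract b x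

end Modules

/-! ### The conditional unitization -/

section Unitization

variable (B : Type u) [NonUnitalNormedCommRing B] [NormedSpace ℂ B]

/-- The forced unitization `ℂ ⊕ B`, with the norm `‖(c, b)‖ = ‖c‖ + ‖b‖`. -/
abbrev ForcedUnitization : Type u := WithLp 1 (Unitization ℂ B)

/-- The isometric embedding `b ↦ (0, b)` of `B` in its forced unitization. -/
def inU : B →ₗ[ℂ] ForcedUnitization B :=
  (WithLp.linearEquiv 1 ℂ (Unitization ℂ B)).symm.toLinearMap ∘ₗ Unitization.inrHom ℂ ℂ B

lemma norm_inU (b : B) : ‖inU B b‖ = ‖b‖ := WithLp.unitization_norm_inr b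

open Classical in
/-- The underlying Banach space of the conditional unitization: `B` itself (isometrically embedded
in the forced unitization) if `B` has an identity element, and the forced unitization otherwise. -/
def condUnitization : Submodule ℂ (ForcedUnitization B) :=
  if ∃ e : B, ∀ b : B, e * b = b then LinearMap.range (inU B) else ⊤

variable [IsScalarTower ℂ B B] [SMulCommClass ℂ B B]

lemma inU_mul_mem (b : B) {x : ForcedUnitization B} (hx : x ∈ condUnitization B) :
    inU B b * x ∈ condUnitization B := by
  unfold condUnitization at *
  split_ifs with h
  · rw [if_pos h] at hx
    obtain ⟨c, rfl⟩ := hx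
    exact ⟨b * c, WithLp.ofLp_injective 1 (Unitization.inr_mul ℂ b c)⟩
  · trivial

lemma inU_mul (a b : B) : inU B (a * b) = inU B a * inU B b :=
  WithLp.ofLp_injective 1 (Unitization.inr_mul ℂ a b)

lemma inU_mul_comm (b : B) (x : ForcedUnitization B) : inU B b * x = x * inU B b :=
  WithLp.ofLp_injective 1 (mul_comm _ _)

/-- Multiplication `B × B^# → B^#`. -/
def actCU : B →L[ℂ] condUnitization B →L[ℂ] condUnitization B :=
  LinearMap.mkContinuous₂
    (LinearMap.mk₂ ℂ (fun b x => ⟨inU B b * x.1, inU_mul_mem B b x.2⟩)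
      (fun a b x => Subtype.ext (by simp [add_mul]))
      (fun c b x => Subtype.ext (by simp))
      (fun b x y => Subtype.ext (by simp [mul_add]))
      (fun c b x => Subtype.ext (by simp))) 1
    (fun b x => by
      rw [one_mul, ← norm_inU B b]
      exact norm_mul_le (inU B b) x.1)

lemma coe_actCU (b : B) (x : condUnitization B) : (actCU B b x).1 = inU B b * x.1 := rfl

/-- The conditional unitization as a `B`-bimodule: both actions are multiplication in the
(commutative) unitization. -/
instance : BiBMod B (condUnitization B) where
  lact := actCU B
  ract := actCU B
  lact_mul a b x := Subtype.ext (by simp [coe_actCU, inU_mul, mul_assoc])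
  ract_mul a b x := Subtype.ext (by
    simp only [coe_actCU]
    rw [mul_comm, inU_mul, mul_assoc])
  act_assoc a b x := Subtype.ext (by
    simp only [coe_actCU]
    rw [← mul_assoc, ← mul_assoc, ← inU_mul, ← inU_mul, mul_comm])

end Unitization

/-! ### Hochschild chains and cochains -/

section Merge

variable {A : Type u} [NonUnitalNormedCommRing A] [NormedSpace ℂ A]
  [IsScalarTower ℂ A A] [SMulCommClass ℂ A A]

/-- `(a₀, …, aₙ) ↦ (a₀, …, aⱼ aⱼ₊₁, …, aₙ)`. -/
def merge {n : ℕ} (j : Fin n) (a : Fin (n + 1) → A) : Fin n → A := fun k =>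
  if k < j then a k.castSucc else if k = j then a j.castSucc * a j.succ else a k.succ

lemma merge_update {n : ℕ} (j : Fin n) (a : Fin (n + 1) → A) (i : Fin (n + 1)) :
    ∃ (k : Fin n) (L : A →ₗ[ℂ] A), ∀ x,
      merge j (Function.update a i x) = Function.update (merge j a) k (L x) := by
  rcases lt_trichotomy i j.castSucc with h | h | h
  · refine ⟨⟨i, by have := j.2; simp [Fin.lt_def] at h; omega⟩, LinearMap.id, fun x => ?_⟩
    ext k
    simp only [merge, Function.update_apply, Fin.ext_iff, Fin.lt_def, Fin.val_castSucc,
      Fin.val_succ, LinearMap.id_apply] at h ⊢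
    split_ifs <;> first | rfl | omega
  · refine ⟨j, LinearMap.mulRight ℂ (a j.succ), fun x => ?_⟩
    ext k
    simp only [merge, Function.update_apply, Fin.ext_iff, Fin.lt_def, Fin.val_castSucc,
      Fin.val_succ, LinearMap.mulRight_apply] at h ⊢
    split_ifs <;> first | rfl | omega
  rcases eq_or_ne i j.succ with h' | h'
  · refine ⟨j, LinearMap.mulLeft ℂ (a j.castSucc), fun x => ?_⟩
    ext k
    simp only [merge, Function.update_apply, Fin.ext_iff, Fin.lt_def, Fin.val_castSucc,
      Fin.val_succ, LinearMap.mulLeft_apply] at h h' ⊢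
    split_ifs <;> first | rfl | omega
  · refine ⟨⟨i - 1, by have := i.2; have := j.2; simp [Fin.lt_def] at h; omega⟩,
      LinearMap.id, fun x => ?_⟩
    ext k
    simp only [merge, Function.update_apply, Fin.ext_iff, Fin.lt_def, Fin.val_castSucc, ne_eq,
      Fin.val_succ, LinearMap.id_apply] at h h' ⊢
    split_ifs <;> first | rfl | omega

lemma prod_norm_merge_le {n : ℕ} (j : Fin n) (a : Fin (n + 1) → A) :
    ∏ k, ‖merge j a k‖ ≤ ∏ i, ‖a i‖ := by
  have h : ∀ k, ‖merge j a k‖ ≤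
      (if k = j then ‖a j.castSucc‖ else 1) * ‖a (j.castSucc.succAbove k)‖ := by
    intro k
    rcases lt_trichotomy k j with hk | rfl | hk
    · simp [merge, hk, hk.ne, Fin.succAbove_of_castSucc_lt]
    · simpa [merge] using norm_mul_le _ _
    · simp [merge, hk.not_gt, hk.ne', Fin.succAbove_of_le_castSucc, hk.le]
  refine (Finset.prod_le_prod (fun _ _ => norm_nonneg _) fun k _ => h k).trans (le_of_eq ?_)
  rw [Finset.prod_mul_distrib, Fin.prod_univ_succAbove _ j.castSucc]
  simp

variable {G : Type v} [SeminormedAddCommGroup G] [NormedSpace ℂ G]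

variable (A G) in
/-- Precomposition of bounded multilinear maps with `merge j`. -/
def mergeL {n : ℕ} (j : Fin n) :
    ContinuousMultilinearMap ℂ (fun _ : Fin n => A) G →L[ℂ]
      ContinuousMultilinearMap ℂ (fun _ : Fin (n + 1) => A) G :=
  MultilinearMap.mkContinuousLinear
    { toFun := fun ψ =>
        { toFun := fun a => ψ (merge j a)
          map_update_add' := fun {inst} a i x y => by
            obtain rfl : inst = instDecidableEqFin _ := Subsingleton.elim _ _
            obtain ⟨k, L, h⟩ := merge_update j a i
            simp only [h, map_add]
            exact ψ.map_update_add (merge j a) k (L x) (L y)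
          map_update_smul' := fun {inst} a i c x => by
            obtain rfl : inst = instDecidableEqFin _ := Subsingleton.elim _ _
            obtain ⟨k, L, h⟩ := merge_update j a i
            simp only [h, map_smul]
            exact ψ.map_update_smul (merge j a) k c (L x) }
      map_add' := fun ψ φ => rfl
      map_smul' := fun c ψ => rfl } 1
    (fun ψ a => by
      rw [one_mul]
      exact (ψ.le_opNorm _).trans
        (mul_le_mul_of_nonneg_left (prod_norm_merge_le j a) (norm_nonneg _)))

end Merge

section Hochschild

variable (A : Type u) [NonUnitalNormedCommRing A] [NormedSpace ℂ A]
  [IsScalarTower ℂ A A] [SMulCommClass ℂ A A]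
variable (M : Type v) [NormedAddCommGroup M] [NormedSpace ℂ M]

/-- The Banach space `C_n(A, M) = M ⊗̂ A^{⊗̂ n}` of Hochschild chains. (The inner `n`-fold tensor
power carries the projective seminorm; completing it first would not change the result.) -/
abbrev Chain (n : ℕ) : Type (max u v) := ProjTensor M (⨂[ℂ] _ : Fin n, A)

/-- The space `C^n(A, M)` of bounded `n`-linear maps from `A` to `M`. -/
abbrev Cochain (n : ℕ) : Type (max u v) := ContinuousMultilinearMap ℂ (fun _ : Fin n => A) M

/-- The map `(x, (a₁, …, aₙ)) ↦ x ⊗ a₁ ⊗ ⋯ ⊗ aₙ`. -/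
def elem (n : ℕ) : M →L[ℂ] Cochain A (Chain A M n) n :=
  (ContinuousLinearMap.compContinuousMultilinearMapL ℂ (fun _ : Fin n => A)
    (⨂[ℂ] _ : Fin n, A) (Chain A M n)).flip (PiTensorProduct.tprodL ℂ) ∘L ptmul M _

variable {A M}

lemma elem_apply {n : ℕ} (x : M) (a : Fin n → A) :
    elem A M n x a = ptmul M _ x (PiTensorProduct.tprod ℂ a) := rfl

/-- The bounded linear map on chains determined by its values on elementary tensors. -/
def clift {G : Type w} [NormedAddCommGroup G] [NormedSpace ℂ G] [CompleteSpace G] {n : ℕ}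
    (f : M →L[ℂ] Cochain A G n) : Chain A M n →L[ℂ] G :=
  plift ((PiTensorProduct.liftIsometry ℂ (fun _ : Fin n => A)
    G).toContinuousLinearEquiv.toContinuousLinearMap ∘L f)

@[simp] lemma clift_elem {G : Type w} [NormedAddCommGroup G] [NormedSpace ℂ G] [CompleteSpace G]
    {n : ℕ} (f : M →L[ℂ] Cochain A G n) (x : M) (a : Fin n → A) :
    clift f (elem A M n x a) = f x a := by
  simp [clift, elem_apply]

lemma chain_ext {G : Type w} [NormedAddCommGroup G] [NormedSpace ℂ G] [CompleteSpace G]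
    {n : ℕ} {f g : Chain A M n →L[ℂ] G}
    (h : ∀ x a, f (elem A M n x a) = g (elem A M n x a)) : f = g := by
  refine ptensor_ext fun x y => ?_
  suffices H : (f ∘L ptmul M _ x).toLinearMap = (g ∘L ptmul M _ x).toLinearMap from
    DFunLike.congr_fun H y
  exact PiTensorProduct.ext (MultilinearMap.ext fun a => h x a)

section Boundary

variable (A M) [BiBMod A M]

/-- The first face `x ⊗ a₁ ⊗ ⋯ ⊗ aₙ₊₁ ↦ x a₁ ⊗ a₂ ⊗ ⋯ ⊗ aₙ₊₁`. -/
def faceFirst (n : ℕ) : Chain A M (n + 1) →L[ℂ] Chain A M n :=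
  clift <|
    (continuousMultilinearCurryLeftEquiv ℂ (fun _ : Fin (n + 1) => A)
      (Chain A M n)).symm.toContinuousLinearEquiv.toContinuousLinearMap ∘L
    ContinuousLinearMap.compL ℂ A M _ (elem A M n) ∘L (RightBMod.ract (B := A) (E := M)).flip

/-- The middle faces, multiplying two neighbouring entries. -/
def faceMid (n : ℕ) (j : Fin n) : Chain A M (n + 1) →L[ℂ] Chain A M n :=
  clift (mergeL A (Chain A M n) j ∘L elem A M n)

/-- The last face `x ⊗ a₁ ⊗ ⋯ ⊗ aₙ₊₁ ↦ aₙ₊₁ x ⊗ a₁ ⊗ ⋯ ⊗ aₙ`. -/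
def faceLast (n : ℕ) : Chain A M (n + 1) →L[ℂ] Chain A M n :=
  clift <|
    (continuousMultilinearCurryRightEquiv ℂ (fun _ : Fin (n + 1) => A)
      (Chain A M n)).symm.toContinuousLinearEquiv.toContinuousLinearMap ∘L
    (ContinuousLinearMap.flipMultilinearEquiv ℂ (fun _ : Fin n => A) A
      (Chain A M n)).toContinuousLinearMap ∘L
    ContinuousLinearMap.compL ℂ A M _ (elem A M n) ∘L (LeftBMod.lact (B := A) (E := M)).flip

variable {A M}

lemma faceFirst_elem {n : ℕ} (x : M) (a : Fin (n + 1) → A) :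
    faceFirst A M n (elem A M (n + 1) x a) =
      elem A M n (RightBMod.ract (a 0) x) (fun i => a i.succ) := by
  simp [faceFirst]
  rfl

lemma faceMid_elem {n : ℕ} (j : Fin n) (x : M) (a : Fin (n + 1) → A) :
    faceMid A M n j (elem A M (n + 1) x a) = elem A M n x (merge j a) := by
  simp [faceMid]
  rfl

lemma faceLast_elem {n : ℕ} (x : M) (a : Fin (n + 1) → A) :
    faceLast A M n (elem A M (n + 1) x a) =
      elem A M n (LeftBMod.lact (a (Fin.last n)) x) (fun i => a i.castSucc) := by
  simp [faceLast]
  rfl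

variable (A M)

/-- The Hochschild boundary operator `d_n : C_{n+1}(A, M) → C_n(A, M)`. -/
def bd (n : ℕ) : Chain A M (n + 1) →L[ℂ] Chain A M n :=
  faceFirst A M n + ∑ j : Fin n, (-1 : ℂ) ^ ((j : ℕ) + 1) • faceMid A M n j +
    (-1 : ℂ) ^ (n + 1) • faceLast A M n

/-- The Hochschild cycles `Z_n(A, M)`. -/
def cycles : (n : ℕ) → Submodule ℂ (Chain A M n)
  | 0 => ⊤
  | n + 1 => LinearMap.ker (bd A M n).toLinearMap

/-- The Hochschild boundaries `B_n(A, M)`. -/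
def boundaries (n : ℕ) : Submodule ℂ (Chain A M n) := LinearMap.range (bd A M n).toLinearMap

/-- The seminormed space `H_n(A, M)`, Hochschild homology. -/
abbrev HochschildHomology (n : ℕ) : Type (max u v) :=
  SubQuot (cycles A M n) (boundaries A M n)

/-- The Hochschild coboundary operator `δ^n : C^n(A, M) → C^{n+1}(A, M)`,
`(δψ)(a₁, …, aₙ₊₁) = a₁ ψ(a₂, …, aₙ₊₁) + ∑ⱼ (-1)^j ψ(a₁, …, aⱼ aⱼ₊₁, …, aₙ₊₁)
  + (-1)^{n+1} ψ(a₁, …, aₙ) aₙ₊₁`. -/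
def cobd (n : ℕ) : Cochain A M n →ₗ[ℂ] Cochain A M (n + 1) where
  toFun ψ :=
    ContinuousLinearMap.uncurryLeft
      ((ContinuousLinearMap.compContinuousMultilinearMapL ℂ (fun _ : Fin n => A) M M).flip ψ ∘L
        LeftBMod.lact (B := A) (E := M)) +
    ∑ j : Fin n, (-1 : ℂ) ^ ((j : ℕ) + 1) • mergeL A M j ψ +
    (-1 : ℂ) ^ (n + 1) • ContinuousMultilinearMap.uncurryRight
      ((RightBMod.ract (B := A) (E := M)).flip.compContinuousMultilinearMap ψ)
  map_add' ψ φ := by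
    ext a
    simp [Finset.sum_add_distrib]
    abel
  map_smul' c ψ := by
    ext a
    simp [Finset.smul_sum, smul_comm c]

lemma cobd_apply {n : ℕ} (ψ : Cochain A M n) (a : Fin (n + 1) → A) :
    cobd A M n ψ a = LeftBMod.lact (a 0) (ψ fun i => a i.succ) +
      ∑ j : Fin n, (-1 : ℂ) ^ ((j : ℕ) + 1) • ψ (merge j a) +
      (-1 : ℂ) ^ (n + 1) • RightBMod.ract (a (Fin.last n)) (ψ fun i => a i.castSucc) := by
  simp [cobd]
  rfl

end Boundary

end Hochschild

/-! ### The module structure on Hochschild homology -/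

section ModuleStructure

/-- A subquotient of a left module by submodules inherits a left module structure. -/
@[reducible] def subQuotMod {B : Type u} [NonUnitalNormedCommRing B] [NormedSpace ℂ B] {V : Type v}
    [SeminormedAddCommGroup V] [NormedSpace ℂ V] [LeftBMod B V] (Z Y : Submodule ℂ V)
    (hZ : ∀ (b : B), ∀ z ∈ Z, LeftBMod.lact b z ∈ Z)
    (hY : ∀ (b : B), ∀ y ∈ Y, LeftBMod.lact b y ∈ Y) : LeftBMod B (SubQuot Z Y) :=
  let act (b : B) : SubQuot Z Y →ₗ[ℂ] SubQuot Z Y :=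
    Submodule.mapQ _ _ ((LeftBMod.lact (E := V) b).toLinearMap.restrict (hZ b))
      (fun z hz => hY b z.1 hz)
  { lact := LinearMap.mkContinuous₂
      { toFun := act
        map_add' := fun a b => Submodule.linearMap_qext _ (LinearMap.ext fun z =>
          congrArg (Submodule.Quotient.mk (p := Y.submoduleOf Z)) (Subtype.ext (by simp)))
        map_smul' := fun c b => Submodule.linearMap_qext _ (LinearMap.ext fun z =>
          congrArg (Submodule.Quotient.mk (p := Y.submoduleOf Z)) (Subtype.ext (by simp))) }
      ‖LeftBMod.lact (B := B) (E := V)‖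
      (fun b q => by
        refine le_of_forall_pos_le_add fun ε hε => ?_
        set K := ‖LeftBMod.lact (B := B) (E := V)‖ * ‖b‖ with hK
        have hK0 : 0 ≤ K := by positivity
        obtain ⟨z, rfl, hz⟩ := Submodule.Quotient.norm_mk_lt q
          (show 0 < ε / (K + 1) by positivity)
        have h1 : ‖act b (Submodule.Quotient.mk z)‖ ≤ K * ‖z‖ :=
          (Submodule.Quotient.norm_mk_le _ _).trans
            ((LeftBMod.lact (B := B) (E := V)).le_opNorm₂ b z.1)
        refine h1.trans ((mul_le_mul_of_nonneg_left hz.le hK0).trans ?_)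
        rw [mul_add]
        refine add_le_add le_rfl ?_
        rw [mul_div_assoc', div_le_iff₀ (by positivity)]
        nlinarith)
    lact_mul := fun a b q => by
      obtain ⟨z, rfl⟩ := Submodule.Quotient.mk_surjective _ q
      exact congrArg (Submodule.Quotient.mk (p := Y.submoduleOf Z))
        (Subtype.ext (LeftBMod.lact_mul a b z.1)) }

variable {A : Type u} [NonUnitalNormedCommRing A] [NormedSpace ℂ A]
  [IsScalarTower ℂ A A] [SMulCommClass ℂ A A]
variable {M : Type v} [NormedAddCommGroup M] [NormedSpace ℂ M] [BiBMod A M]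

/-- The action `c · (x ⊗ a₁ ⊗ ⋯ ⊗ aₙ) = (c · x) ⊗ a₁ ⊗ ⋯ ⊗ aₙ` on chains. -/
def actChain (n : ℕ) : A →L[ℂ] Chain A M n →L[ℂ] Chain A M n :=
  pliftL M (⨂[ℂ] _ : Fin n, A) (Chain A M n) ∘L
    ContinuousLinearMap.compL ℂ M M _ (ptmul M (⨂[ℂ] _ : Fin n, A)) ∘L
      LeftBMod.lact (B := A) (E := M)

lemma actChain_elem {n : ℕ} (c : A) (x : M) (a : Fin n → A) :
    actChain n c (elem A M n x a) = elem A M n (LeftBMod.lact c x) a := by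
  simp [actChain, elem_apply]

instance (n : ℕ) : LeftBMod A (Chain A M n) where
  lact := actChain n
  lact_mul a b x := by
    suffices H : actChain n (a * b) = actChain n a ∘L actChain n b from
      DFunLike.congr_fun H x
    refine chain_ext fun x v => ?_
    simp [actChain_elem, LeftBMod.lact_mul]

lemma lact_elem {n : ℕ} (c : A) (x : M) (a : Fin n → A) :
    LeftBMod.lact c (elem A M n x a) = elem A M n (LeftBMod.lact c x) a := actChain_elem c x a

lemma bd_lact {n : ℕ} (c : A) (z : Chain A M (n + 1)) :
    bd A M n (LeftBMod.lact c z) = LeftBMod.lact c (bd A M n z) := by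
  suffices H : bd A M n ∘L LeftBMod.lact c = LeftBMod.lact c ∘L bd A M n from
    DFunLike.congr_fun H z
  refine chain_ext fun x a => ?_
  have h1 : LeftBMod.lact (a (Fin.last n)) (LeftBMod.lact c x) =
      LeftBMod.lact c (LeftBMod.lact (a (Fin.last n)) x) := by
    rw [← LeftBMod.lact_mul, ← LeftBMod.lact_mul, mul_comm]
  simp [bd, lact_elem, faceFirst_elem, faceMid_elem, faceLast_elem, BiBMod.act_assoc, h1]

variable (A M) in
/-- The left module structure induced on Hochschild homology. -/
instance (n : ℕ) : LeftBMod A (HochschildHomology A M n) :=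
  subQuotMod (cycles A M n) (boundaries A M n)
    (fun b z hz => by
      cases n with
      | zero => trivial
      | succ n =>
        have hz : bd A M n z = 0 := hz
        change bd A M n (LeftBMod.lact b z) = 0
        rw [bd_lact, hz, map_zero])
    (fun b y hy => by
      obtain ⟨z, rfl⟩ := hy
      exact ⟨LeftBMod.lact b z, bd_lact b z⟩)

end ModuleStructure

/-! ### The Harrison summand -/

section Harrison

/-- `σ` is a `(p, n - p)`-shuffle: it is increasing on the first `p` and on the last `n - p`
indices. -/
def IsShuffle {n : ℕ} (p : ℕ) (σ : Equiv.Perm (Fin n)) : Prop :=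
  ∀ i j : Fin n, i < j → ((j : ℕ) < p ∨ p ≤ (i : ℕ)) → σ i < σ j

open Classical in
/-- The total signed shuffle element `s_n = ∑_{0 < p < n} ∑_σ sgn(σ) σ` of `ℚ S_n`, the inner sum
being over the `(p, n - p)`-shuffles. -/
def shuffleElt (n : ℕ) : MonoidAlgebra ℚ (Equiv.Perm (Fin n)) :=
  ∑ p ∈ Finset.Ioo 0 n, ∑ σ : Equiv.Perm (Fin n) with IsShuffle p σ,
    MonoidAlgebra.single σ ((Equiv.Perm.sign σ : ℤ) : ℚ)

/-- The Barr-Gerstenhaber-Schack idempotent `e_n(i)` for `1 ≤ i ≤ n`: the spectral projection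
`∏_{j ≠ i} (s_n - λ_j) / (λ_i - λ_j)` (with `1 ≤ j ≤ n`) of `s_n` for its eigenvalue
`λ_i = 2^i - 2`. -/
def bgs (n i : ℕ) : MonoidAlgebra ℚ (Equiv.Perm (Fin n)) :=
  Polynomial.aeval (shuffleElt n) (Lagrange.basis (Finset.Icc 1 n) (fun j => (2 : ℚ) ^ j - 2) i)

variable (A : Type u) [NonUnitalNormedCommRing A] [NormedSpace ℂ A]
  [IsScalarTower ℂ A A] [SMulCommClass ℂ A A]
variable (M : Type v) [NormedAddCommGroup M] [NormedSpace ℂ M]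

/-- The action of a permutation on chains, moving the `i`-th tensor factor to position `σ i`:
`x ⊗ a₁ ⊗ ⋯ ⊗ aₙ ↦ x ⊗ a_{σ⁻¹(1)} ⊗ ⋯ ⊗ a_{σ⁻¹(n)}`. -/
def permChain {n : ℕ} (σ : Equiv.Perm (Fin n)) : Chain A M n →L[ℂ] Chain A M n :=
  clift <|
    (ContinuousMultilinearMap.domDomCongrₗᵢ ℂ A (Chain A M n)
      σ.symm).toContinuousLinearEquiv.toContinuousLinearMap ∘L elem A M n

lemma permChain_elem {n : ℕ} (σ : Equiv.Perm (Fin n)) (x : M) (a : Fin n → A) :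
    permChain A M σ (elem A M n x a) = elem A M n x (fun i => a (σ.symm i)) := by
  simp [permChain]
  rfl

/-- The action of `id ⊗ e` on chains, for an element `e` of `ℚ S_n`. -/
def groupAlgChain {n : ℕ} (e : MonoidAlgebra ℚ (Equiv.Perm (Fin n))) :
    Chain A M n →L[ℂ] Chain A M n :=
  ∑ σ : Equiv.Perm (Fin n), ((e.coeff σ : ℚ) : ℂ) • permChain A M σ

/-- Precomposition of cochains with an element `e` of `ℚ S_n`. -/
def groupAlgCochain {n : ℕ} (e : MonoidAlgebra ℚ (Equiv.Perm (Fin n))) :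
    Cochain A M n →ₗ[ℂ] Cochain A M n :=
  ∑ σ : Equiv.Perm (Fin n), ((e.coeff σ : ℚ) : ℂ) •
    (ContinuousMultilinearMap.domDomCongrₗᵢ ℂ A M σ.symm).toLinearEquiv.toLinearMap

lemma groupAlgCochain_apply {n : ℕ} (e : MonoidAlgebra ℚ (Equiv.Perm (Fin n)))
    (ψ : Cochain A M n) (a : Fin n → A) :
    groupAlgCochain A M e ψ a =
      ∑ σ : Equiv.Perm (Fin n), ((e.coeff σ : ℚ) : ℂ) • ψ (fun i => a (σ.symm i)) := by
  simp [groupAlgCochain]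
  rfl

/-- The Harrison summand of the space of `n`-chains. -/
def harrChain (n : ℕ) : Submodule ℂ (Chain A M n) :=
  LinearMap.range (groupAlgChain A M (bgs n 1)).toLinearMap

/-- The Harrison summand of the space of `n`-cochains. -/
def harrCochain (n : ℕ) : Submodule ℂ (Cochain A M n) :=
  LinearMap.range (groupAlgCochain A M (bgs n 1))

variable [BiBMod A M]

/-- Harrison homology `H_n^{Harr}(A, M)` with its seminorm, for `n ≥ 1`. -/
abbrev HarrisonHomology (n : ℕ) : Type (max u v) :=
  SubQuot (harrChain A M n ⊓ cycles A M n)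
    ((harrChain A M (n + 1)).map (bd A M n).toLinearMap)

/-- Harrison coboundaries; the Harrison complex starts in degree one. -/
def harrCoboundaries : (n : ℕ) → Submodule ℂ (Cochain A M n)
  | 0 => ⊥
  | 1 => ⊥
  | n + 2 => (harrCochain A M (n + 1)).map (cobd A M (n + 1))

/-- Harrison cohomology `H^n_{Harr}(A, M)` with its seminorm, for `n ≥ 1`. -/
abbrev HarrisonCohomology (n : ℕ) : Type (max u v) :=
  SubQuot (harrCochain A M n ⊓ LinearMap.ker (cobd A M n)) (harrCoboundaries A M n)

/-- The complex `C_1(A, M) ← C_2^{Harr}(A, M) ← C_3^{Harr}(A, M) ← ⋯` (note that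
`C_1^{Harr} = C_1`) is split exact: there are bounded linear maps
`s_n : C_n^{Harr} → C_{n+1}^{Harr}`, `n ≥ 1`, with `s_n d_n + d_{n+1} s_{n+1} = id` on
`C_{n+1}^{Harr}`. (The element `y` below is `d_n x`, regarded as an element of the summand.) -/
def HarrisonSplitExact : Prop :=
  ∃ s : ∀ n : ℕ, harrChain A M (n + 1) →L[ℂ] harrChain A M (n + 2),
    ∀ (n : ℕ) (x : harrChain A M (n + 2)) (y : harrChain A M (n + 1)),
      (y : Chain A M (n + 1)) = bd A M (n + 1) x →
        (s n y : Chain A M (n + 2)) + bd A M (n + 2) (s (n + 1) x) = x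

end Harrison

/-! ### Resolutions, `Ext` and `Tor` -/

section Derived

variable (B : Type u) [NonUnitalNormedCommRing B] [NormedSpace ℂ B]

/-- A left Banach `B`-module (not assumed unit-linked). -/
structure LeftBanachModule : Type (u + 1) where
  carrier : Type u
  [normedAddCommGroup : NormedAddCommGroup carrier]
  [normedSpace : NormedSpace ℂ carrier]
  [completeSpace : CompleteSpace carrier]
  [leftBMod : LeftBMod B carrier]

attribute [instance] LeftBanachModule.normedAddCommGroup LeftBanachModule.normedSpace
  LeftBanachModule.completeSpace LeftBanachModule.leftBMod

/-- A bounded linear map is a left module map. -/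
def IsModMap {E : Type v} {F : Type w} [SeminormedAddCommGroup E] [NormedSpace ℂ E]
    [SeminormedAddCommGroup F] [NormedSpace ℂ F] [LeftBMod B E] [LeftBMod B F]
    (f : E →L[ℂ] F) : Prop :=
  ∀ (b : B) (x : E), f (LeftBMod.lact b x) = LeftBMod.lact b (f x)

variable {B}

/-- `P` is projective: module maps out of `P` lift along every module map `σ : Y → Z` which has a
bounded linear right inverse. -/
def LeftBanachModule.IsProjective (P : LeftBanachModule.{u} B) : Prop :=
  ∀ (Y Z : LeftBanachModule.{u} B) (σ : Y.carrier →L[ℂ] Z.carrier)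
    (ρ : Z.carrier →L[ℂ] Y.carrier) (φ : P.carrier →L[ℂ] Z.carrier),
    IsModMap B σ → σ ∘L ρ = ContinuousLinearMap.id ℂ _ → IsModMap B φ →
      ∃ ψ : P.carrier →L[ℂ] Y.carrier, IsModMap B ψ ∧ σ ∘L ψ = φ

variable (B) in
/-- An admissible projective resolution `0 ← N ← P₀ ← P₁ ← ⋯` of the left module `N`: a complex of
module maps, with the `Pₙ` projective Banach modules, which is split exact as a complex of
(semi)normed spaces. -/
structure AdmissibleResolution (N : Type u) [SeminormedAddCommGroup N] [NormedSpace ℂ N]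
    [LeftBMod B N] : Type (u + 1) where
  obj : ℕ → LeftBanachModule.{u} B
  projective : ∀ n, (obj n).IsProjective
  d : ∀ n, (obj (n + 1)).carrier →L[ℂ] (obj n).carrier
  aug : (obj 0).carrier →L[ℂ] N
  d_mod : ∀ n, IsModMap B (d n)
  aug_mod : IsModMap B aug
  d_d : ∀ n, d n ∘L d (n + 1) = 0
  aug_d : aug ∘L d 0 = 0
  split : ∃ (s₀ : N →L[ℂ] (obj 0).carrier)
    (s : ∀ n, (obj n).carrier →L[ℂ] (obj (n + 1)).carrier),
    aug ∘L s₀ = ContinuousLinearMap.id ℂ _ ∧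
    s₀ ∘L aug + d 0 ∘L s 0 = ContinuousLinearMap.id ℂ _ ∧
    ∀ n, s n ∘L d n + d (n + 1) ∘L s (n + 1) = ContinuousLinearMap.id ℂ _

variable {N : Type u} [SeminormedAddCommGroup N] [NormedSpace ℂ N] [LeftBMod B N]
  (P : AdmissibleResolution B N)
variable (X : Type v) [NormedAddCommGroup X] [NormedSpace ℂ X]

section Ext

variable [LeftBMod B X]

/-- The space of bounded module maps `Pₙ → X`. -/
def homMod (n : ℕ) : Submodule ℂ ((P.obj n).carrier →L[ℂ] X) where
  carrier := {φ | IsModMap B φ}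
  add_mem' {f g} hf hg b x := by
    have h1 := hf b x
    have h2 := hg b x
    simp [h1, h2]
  zero_mem' b x := by simp
  smul_mem' c f hf b x := by
    have h1 := hf b x
    simp [h1]

/-- Precomposition with the differential of the resolution. -/
def codiff (n : ℕ) : ((P.obj n).carrier →L[ℂ] X) →ₗ[ℂ] ((P.obj (n + 1)).carrier →L[ℂ] X) :=
  ((ContinuousLinearMap.compL ℂ (P.obj (n + 1)).carrier (P.obj n).carrier X).flip
    (P.d n)).toLinearMap

/-- Coboundaries of the complex of bounded module maps `Pₙ → X`. -/
def extCoboundaries : (n : ℕ) → Submodule ℂ ((P.obj n).carrier →L[ℂ] X)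
  | 0 => ⊥
  | n + 1 => (homMod P X n).map (codiff P X n)

/-- The seminormed space `Ext^n_B(N, X)`, computed from the resolution `P` of `N`: the cohomology
of the complex of bounded module maps `Pₙ → X`. -/
abbrev ExtOf (n : ℕ) : Type (max u v) :=
  SubQuot (homMod P X n ⊓ LinearMap.ker (codiff P X n)) (extCoboundaries P X n)

end Ext

section Tor

variable [RightBMod B X]

variable (B) in
/-- The closed span of all `x b ⊗ y - x ⊗ b y`. -/
def balancing (Y : Type w) [NormedAddCommGroup Y] [NormedSpace ℂ Y] [LeftBMod B Y] :
    Submodule ℂ (ProjTensor X Y) :=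
  (Submodule.span ℂ {z | ∃ (x : X) (b : B) (y : Y),
    z = ptmul X Y (RightBMod.ract b x) y - ptmul X Y x (LeftBMod.lact b y)}).topologicalClosure

variable (B) in
/-- The projective tensor product `X ⊗̂_B Y` of a right module and a left module. -/
abbrev BalTensor (Y : Type w) [NormedAddCommGroup Y] [NormedSpace ℂ Y] [LeftBMod B Y] :
    Type (max v w) :=
  ProjTensor X Y ⧸ balancing B X Y

lemma balancing_le_comap {Y Y' : Type w} [NormedAddCommGroup Y] [NormedSpace ℂ Y] [LeftBMod B Y]
    [NormedAddCommGroup Y'] [NormedSpace ℂ Y'] [LeftBMod B Y'] (f : Y →L[ℂ] Y')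
    (hf : IsModMap B f) :
    balancing B X Y ≤ (balancing B X Y').comap (pmapRight X f).toLinearMap := by
  refine Submodule.topologicalClosure_minimal _ (Submodule.span_le.2 ?_)
    ((Submodule.isClosed_topologicalClosure _).preimage (pmapRight X f).continuous)
  rintro _ ⟨x, b, y, rfl⟩
  refine Submodule.le_topologicalClosure _ (Submodule.subset_span ⟨x, b, f y, ?_⟩)
  simp [hf b y]

/-- The differential `id ⊗̂_B d_n` of the complex `X ⊗̂_B P`. -/
def torDiff (n : ℕ) : BalTensor B X (P.obj (n + 1)).carrier →ₗ[ℂ] BalTensor B X (P.obj n).carrier :=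
  Submodule.mapQ _ _ (pmapRight X (P.d n)).toLinearMap (balancing_le_comap X (P.d n) (P.d_mod n))

/-- Cycles of the complex `X ⊗̂_B P`. -/
def torCycles : (n : ℕ) → Submodule ℂ (BalTensor B X (P.obj n).carrier)
  | 0 => ⊤
  | n + 1 => LinearMap.ker (torDiff P X n)

/-- The seminormed space `Tor_n^B(X, N)`, computed from the resolution `P` of `N`: the homology of
the complex `X ⊗̂_B P`. -/
abbrev TorOf (n : ℕ) : Type (max u v) :=
  SubQuot (torCycles P X n) (LinearMap.range (torDiff P X n))

end Tor

end Derived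

end BanachHarrison

end

open BanachHarrison

/-! Let `U` be the conditional unitization. The chains `C_n(B, U)` are relatively free: a module map
out of them is determined by its values on `gen ⊗ a₁ ⊗ ⋯ ⊗ aₙ`, and such values can be lifted along
any bounded linear section. The Harrison summand is cut out by an idempotent that commutes with the
action and with the boundary, so the Harrison chains form a complex of projective modules. Since the
coefficients are symmetric, `d_0 = 0`, and since `e_1 = 1`, the Harrison and Hochschild boundaries
in degree one agree. Hence the cokernel of the complex is `H_1`, and the given splitting turns the
complex into an admissible resolution (`harrResolution`). The splitting also yields a bounded
section of the augmentation, which embeds `H_1` in a normed space and makes it Hausdorff. Module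
maps into `X` from this resolution are Harrison cochains with values in `X`, and balanced tensor
products with it are Harrison chains; the comparison theorem passes to an arbitrary resolution.

Two points need work. The first is that the Eulerian idempotent commutes with the differential
(`permOp_bgs_hdiff`). The element `s_n + 2` is the signed sum of the sorting permutations of all
words of length `n` in two letters. For this sum, commutation is a cancellation argument
(`permOp_hdiff`): inner faces at unequal neighbours cancel by commutativity, equal neighbours merge,
and two of the four outer terms cancel. Word sums over alphabets of sizes `k` and `l` multiply to
the word sum over `kl` letters (radix sort), and their coefficients are binomial polynomials in the
size. Hence a polynomial in `s_n` depends only on its values at `2^m - 2`, `1 ≤ m ≤ n`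
(`aeval_shuffleElt_congr`). This gives idempotence, and it lets one polynomial define the idempotent
in two consecutive degrees.

The second point is that `X` need not be unit-linked when `B` is unital. Then `gen` acts on `X` as a
projection, not as the identity, and the identification of complexes holds only up to homotopy. On
the complement `B` acts by zero, and inserting the unit in front contracts the complex
(`comp_sub_mem_harrCoboundaries`, `coefMap_sub_mem_harrBoundaries`). -/

noncomputable section

namespace BanachHarrison

/-! ### Stable sorting of words and its behaviour under deleting, swapping and merging letters. -/

section Rank

variable {n : ℕ} {L : Type*} [LinearOrder L]

/-- The stable ranking of the entries of a tuple: the inverse of the sorting permutation. -/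
def rank (f : Fin n → L) : Equiv.Perm (Fin n) := (Tuple.sort f)⁻¹

/-- Ties keep their order, which is why `≤` appears for `i < j`. Together with `eq_rank` this
characterises the ranking. -/
lemma rank_lt_rank (f : Fin n → L) {i j : Fin n} (h : i < j) :
    rank f i < rank f j ↔ f i ≤ f j := by
  obtain ⟨h1, h2⟩ := (Tuple.eq_sort_iff (f := f) (σ := Tuple.sort f)).1 rfl
  have hi : Tuple.sort f (rank f i) = i := by simp [rank]
  have hj : Tuple.sort f (rank f j) = j := by simp [rank]
  constructor
  · intro hlt
    have := h1 hlt.le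
    simpa [hi, hj] using this
  · intro hle
    by_contra hlt
    have hne : rank f i ≠ rank f j := fun e => h.ne ((rank f).injective e)
    have hgt : rank f j < rank f i := lt_of_le_of_ne (not_lt.1 hlt) hne.symm
    have h3 := h1 hgt.le
    simp only [Function.comp_apply, hi, hj] at h3
    have h4 := h2 _ _ hgt (by rw [hi, hj]; exact le_antisymm h3 hle)
    rw [hi, hj] at h4
    exact lt_asymm h h4

/-- A permutation is determined by its inversions: `τ ∘ ρ⁻¹` is strictly monotone, and `Fin n` has
only one order automorphism. -/
lemma perm_eq_of_lt {ρ τ : Equiv.Perm (Fin n)}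
    (h : ∀ i j, i < j → (ρ i < ρ j ↔ τ i < τ j)) : ρ = τ := by
  have h' : ∀ i j, ρ i < ρ j → τ i < τ j := by
    intro i j hij
    rcases lt_trichotomy i j with h1 | rfl | h1
    · exact (h i j h1).1 hij
    · exact absurd hij (lt_irrefl _)
    · have h2 : ¬ τ j < τ i := fun h3 => lt_asymm hij ((h j i h1).2 h3)
      exact lt_of_le_of_ne (not_lt.1 h2) fun e => h1.ne' (τ.injective e)
  have hm : StrictMono (ρ.symm.trans τ) := fun i j hij => by
    apply h'
    simpa using hij
  have := Subsingleton.elim (hm.orderIsoOfSurjective _ (Equiv.surjective _)) (OrderIso.refl _)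
  ext1 x
  have h1 : τ (ρ.symm (ρ x)) = ρ x := DFunLike.congr_fun this (ρ x)
  rwa [Equiv.symm_apply_apply, eq_comm] at h1

lemma eq_rank {f : Fin n → L} {ρ : Equiv.Perm (Fin n)}
    (h : ∀ i j, i < j → (ρ i < ρ j ↔ f i ≤ f j)) : ρ = rank f :=
  perm_eq_of_lt fun i j hij => by rw [h i j hij, rank_lt_rank f hij]

/-- This deletes a row and a column of a permutation matrix. Cycles move `i` and `ρ i` to `0`, where
`decomposeFin` splits off a fixed point; their signs give the Laplace expansion sign. -/
lemma exists_removal (ρ : Equiv.Perm (Fin (n + 1))) (i : Fin (n + 1)) :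
    ∃ τ : Equiv.Perm (Fin n), (∀ k, ρ (i.succAbove k) = (ρ i).succAbove (τ k)) ∧
      (Equiv.Perm.sign ρ : ℤ) = (-1) ^ ((i : ℕ) + (ρ i : ℕ)) * (Equiv.Perm.sign τ : ℤ) := by
  set σ : Equiv.Perm (Fin (n + 1)) := (ρ i).cycleRange * ρ * i.cycleRange⁻¹ with hσ
  obtain ⟨⟨p, τ⟩, hp⟩ := Equiv.Perm.decomposeFin.symm.surjective σ
  have hσ0 : σ 0 = 0 := by simp [hσ, Equiv.Perm.inv_def]
  have hp0 : p = 0 := by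
    rw [← hp, Equiv.Perm.decomposeFin_symm_apply_zero] at hσ0
    exact hσ0
  subst hp0
  refine ⟨τ, fun k => ?_, ?_⟩
  · have h1 := Equiv.Perm.decomposeFin_symm_apply_succ τ 0 k
    rw [hp, hσ] at h1
    simp only [Equiv.Perm.coe_mul, Function.comp_apply, Equiv.Perm.inv_def,
      Fin.cycleRange_symm_succ, Equiv.swap_self, Equiv.refl_apply] at h1
    rw [← Fin.cycleRange_symm_succ (ρ i), ← h1, Equiv.symm_apply_apply]
  · have h1 := Equiv.Perm.decomposeFin.symm_sign (0 : Fin (n + 1)) τ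
    rw [hp, hσ] at h1
    simp only [map_mul, Fin.sign_cycleRange, Equiv.Perm.sign_inv, if_true, one_mul] at h1
    rw [← h1]
    push_cast
    rcases neg_one_pow_eq_or ℤ (i : ℕ) with h2 | h2 <;>
      rcases neg_one_pow_eq_or ℤ (ρ i : ℕ) with h3 | h3 <;> simp [pow_add, h2, h3]

/-- Deleting a letter leaves all comparisons between the other letters unchanged. -/
lemma rank_removal (f : Fin (n + 1) → L) (i : Fin (n + 1)) :
    (∀ k, rank f (i.succAbove k) = (rank f i).succAbove (rank (f ∘ i.succAbove) k)) ∧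
      (Equiv.Perm.sign (rank f) : ℤ) =
        (-1) ^ ((i : ℕ) + (rank f i : ℕ)) * (Equiv.Perm.sign (rank (f ∘ i.succAbove)) : ℤ) := by
  obtain ⟨τ, h1, h2⟩ := exists_removal (rank f) i
  have : τ = rank (f ∘ i.succAbove) := by
    refine eq_rank fun a b hab => ?_
    have h3 := rank_lt_rank f ((Fin.strictMono_succAbove i) hab)
    rw [h1, h1, (Fin.strictMono_succAbove _).lt_iff_lt] at h3
    exact h3
  subst this
  exact ⟨h1, h2⟩

/-- Only the comparison of the two neighbours changes. They must be distinct, because a tie would be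
resolved by position and so would not be reversed. -/
lemma rank_comp_swap (f : Fin (n + 1) → L) (j : Fin n) (h : f j.castSucc ≠ f j.succ) :
    rank (f ∘ Equiv.swap j.castSucc j.succ) = rank f * Equiv.swap j.castSucc j.succ := by
  symm
  refine eq_rank fun a b hab => ?_
  set s := Equiv.swap j.castSucc j.succ
  simp only [Equiv.Perm.coe_mul, Function.comp_apply]
  by_cases hc : a = j.castSucc ∧ b = j.succ
  · obtain ⟨rfl, rfl⟩ := hc
    simp only [s, Equiv.swap_apply_left, Equiv.swap_apply_right]
    have h1 := rank_lt_rank f hab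
    have hne : rank f j.castSucc ≠ rank f j.succ := fun e => hab.ne ((rank f).injective e)
    constructor
    · intro h2
      by_contra h3
      exact lt_asymm h2 (h1.2 (not_le.1 h3).le)
    · intro h2
      have h3 : ¬ f j.castSucc ≤ f j.succ := fun h4 => h (le_antisymm h4 h2)
      rw [← h1, not_lt] at h3
      exact lt_of_le_of_ne h3 hne.symm
  · refine rank_lt_rank f ?_
    simp only [s, Equiv.swap_apply_def]
    rw [Fin.lt_def] at hab ⊢
    simp only [Fin.ext_iff, Fin.val_castSucc, Fin.val_succ] at hc ⊢
    split_ifs <;> simp <;> omega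

/-- Two neighbouring entries with equal values have neighbouring ranks. -/
lemma rank_of_eq (f : Fin (n + 1) → L) (j : Fin n) (h : f j.castSucc = f j.succ) :
    rank f j.succ = (rank (f ∘ j.succ.succAbove) j).succ := by
  set m := rank (f ∘ j.succ.succAbove) j with hm
  have h1 := (rank_removal f j.succ).1 j
  rw [Fin.succAbove_succ_self, ← hm] at h1
  have hlt : rank f j.castSucc < rank f j.succ :=
    (rank_lt_rank f (Fin.castSucc_lt_succ (i := j))).2 h.le
  -- A letter ranked between two equal letters would equal both, and stability would then place it
  -- between two adjacent positions.
  have hbetween : ∀ q, rank f j.castSucc < q → ¬ q < rank f j.succ := by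
    intro q hq1 hq2
    obtain ⟨i, rfl⟩ := (rank f).surjective q
    rcases lt_trichotomy i j.castSucc with h3 | h3 | h3
    · have h4 : ¬ f i ≤ f j.castSucc := by
        rw [← rank_lt_rank f h3]; exact hq1.not_gt
      have h5 := (rank_lt_rank f (h3.trans (Fin.castSucc_lt_succ (i := j)))).1 hq2
      exact h4 (h5.trans h.ge)
    · subst h3; exact lt_irrefl _ hq1
    · have h3' : i = j.succ ∨ j.succ < i := by
        rw [Fin.lt_def, Fin.ext_iff] at *
        simp at *
        omega
      rcases h3' with rfl | h3'
      · exact lt_irrefl _ hq2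
      · have h4 : ¬ f j.succ ≤ f i := by
          rw [← rank_lt_rank f h3']; exact hq2.not_gt
        have h5 := (rank_lt_rank f h3).1 hq1
        exact h4 (h.ge.trans h5)
  have h2 : (rank f j.castSucc) = m.castSucc := by
    rw [h1]
    refine Fin.succAbove_of_castSucc_lt _ _ ?_
    by_contra h3
    rw [Fin.succAbove_of_le_castSucc _ _ (not_lt.1 h3)] at h1
    rw [h1, Fin.lt_def] at hlt
    rw [Fin.lt_def] at h3
    simp at hlt h3
    omega
  have h3 := hbetween m.succ (by rw [h2]; exact Fin.castSucc_lt_succ)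
  rw [h2] at hlt
  rw [Fin.lt_def] at hlt h3
  rw [Fin.ext_iff]
  simp at hlt h3 ⊢
  omega

/-- Merging is a product at position `j` together with the deletion of position `j + 1`; in this
form it matches `rank_removal`. -/
lemma merge_apply {A : Type*} [NonUnitalNormedCommRing A] (j : Fin n) (b : Fin (n + 1) → A)
    (k : Fin n) :
    merge j b k = if k = j then b j.castSucc * b j.succ else b (j.succ.succAbove k) := by
  rcases lt_trichotomy k j with h | rfl | h
  · rw [merge, if_pos h, if_neg h.ne, Fin.succAbove_of_castSucc_lt]
    rw [Fin.lt_def] at *; simp; omega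
  · simp [merge]
  · rw [merge, if_neg h.not_gt, if_neg h.ne', if_neg h.ne', Fin.succAbove_of_le_castSucc]
    rw [Fin.lt_def] at h; rw [Fin.le_def]; simp; omega

/-- Equal neighbouring letters have neighbouring ranks, so the two arguments that get multiplied
were already neighbours in `a`, in the same order. -/
lemma merge_rank {A : Type*} [NonUnitalNormedCommRing A] (f : Fin (n + 1) → L) (j : Fin n)
    (h : f j.castSucc = f j.succ) (a : Fin (n + 1) → A) :
    merge j (a ∘ rank f) = merge (rank (f ∘ j.succ.succAbove) j) a ∘
      rank (f ∘ j.succ.succAbove) := by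
  have h1 := rank_of_eq f j h
  have h2 := (rank_removal f j.succ).1
  ext k
  rw [Function.comp_apply (g := rank (f ∘ j.succ.succAbove)), merge_apply, merge_apply]
  simp only [Equiv.apply_eq_iff_eq]
  split_ifs with hk
  · have h3 := h2 j
    rw [Fin.succAbove_succ_self, h1, Fin.succAbove_succ_self] at h3
    simp only [Function.comp_apply, h1, h3]
  · rw [Function.comp_apply, h2 k, h1]

lemma merge_swap {A : Type*} [NonUnitalNormedCommRing A] (j : Fin n) (a : Fin (n + 1) → A) :
    merge j (a ∘ Equiv.swap j.castSucc j.succ) = merge j a := by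
  ext k
  rw [merge_apply, merge_apply]
  split_ifs with hk
  · simp [mul_comm]
  · have h1 : j.succ.succAbove k ≠ j.castSucc := by
      rw [← Fin.succAbove_succ_self j]
      exact fun e => hk (Fin.succAbove_right_injective e)
    rw [Function.comp_apply, Equiv.swap_apply_of_ne_of_ne h1 (Fin.succAbove_ne _ _)]

end Rank

/-! ### The rational group algebra acting on functions of `n` variables. -/

section PermOp

variable {n : ℕ} {A : Type*} {G : Type*} [AddCommGroup G] [Module ℂ G]

/-- The action of the rational group algebra on functions of `n` variables. -/
def permOp (e : MonoidAlgebra ℚ (Equiv.Perm (Fin n))) (φ : (Fin n → A) → G) (a : Fin n → A) : G :=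
  ∑ σ : Equiv.Perm (Fin n), ((e.coeff σ : ℚ) : ℂ) • φ (fun i => a (σ.symm i))

lemma permOp_add (e e' : MonoidAlgebra ℚ (Equiv.Perm (Fin n))) (φ : (Fin n → A) → G) :
    permOp (e + e') φ = permOp e φ + permOp e' φ := by
  ext a
  simp [permOp, add_smul, Finset.sum_add_distrib]

lemma permOp_smul (c : ℚ) (e : MonoidAlgebra ℚ (Equiv.Perm (Fin n))) (φ : (Fin n → A) → G) :
    permOp (c • e) φ = (c : ℂ) • permOp e φ := by
  ext a
  simp [permOp, mul_smul, Finset.smul_sum]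

lemma permOp_zero (φ : (Fin n → A) → G) : permOp 0 φ = 0 := by
  ext a
  simp [permOp]

lemma permOp_sum {ι : Type*} (s : Finset ι) (e : ι → MonoidAlgebra ℚ (Equiv.Perm (Fin n)))
    (φ : (Fin n → A) → G) : permOp (∑ i ∈ s, e i) φ = ∑ i ∈ s, permOp (e i) φ := by
  classical
  induction s using Finset.induction_on with
  | empty => simp [permOp_zero]
  | insert i s hi ih => rw [Finset.sum_insert hi, Finset.sum_insert hi, permOp_add, ih]

lemma permOp_single (σ : Equiv.Perm (Fin n)) (c : ℚ) (φ : (Fin n → A) → G) (a : Fin n → A) :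
    permOp (MonoidAlgebra.single σ c) φ a = (c : ℂ) • φ (fun i => a (σ.symm i)) := by
  classical
  rw [permOp, Finset.sum_eq_single σ]
  · simp
  · intro τ _ h
    simp [MonoidAlgebra.coeff_single, h.symm]
  · simp

lemma permOp_one (φ : (Fin n → A) → G) : permOp 1 φ = φ := by
  ext a
  rw [MonoidAlgebra.one_def, permOp_single, Rat.cast_one, one_smul]
  rfl

lemma permOp_map_add (e : MonoidAlgebra ℚ (Equiv.Perm (Fin n))) (φ ψ : (Fin n → A) → G) :
    permOp e (φ + ψ) = permOp e φ + permOp e ψ := by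
  ext a
  simp [permOp, Finset.sum_add_distrib]

/-- Precomposition reverses the order of composition, so this is a right action. -/
lemma permOp_mul (e e' : MonoidAlgebra ℚ (Equiv.Perm (Fin n))) (φ : (Fin n → A) → G) :
    permOp (e * e') φ = permOp e' (permOp e φ) := by
  induction e using MonoidAlgebra.induction_linear with
  | zero => rw [zero_mul, permOp_zero]; ext a; simp [permOp]
  | add f g hf hg => rw [add_mul, permOp_add, hf, hg, permOp_add, permOp_map_add]
  | single σ c =>
    induction e' using MonoidAlgebra.induction_linear with
    | zero => rw [mul_zero, permOp_zero, permOp_zero]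
    | add f g hf hg => rw [mul_add, permOp_add, hf, hg, permOp_add]
    | single τ d =>
      rw [MonoidAlgebra.single_mul_single]
      ext a
      simp only [permOp_single, Rat.cast_mul, mul_smul]
      rw [smul_comm]
      rfl

end PermOp

/-! ### Two-letter word sums commute with a formal differential that covers chains and cochains at
once. -/

section Differential

variable {n : ℕ} {A : Type*} [NonUnitalNormedCommRing A] {G : Type*} [AddCommGroup G] [Module ℂ G]

/-- The formal Hochschild differential: inner faces multiply neighbouring arguments of `φ`, and the
outer faces are given by `E`. -/
def hdiff (E : A → (Fin n → A) → G) (φ : (Fin n → A) → G) (a : Fin (n + 1) → A) : G :=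
  E (a 0) (fun i => a i.succ) + ∑ j : Fin n, (-1 : ℂ) ^ ((j : ℕ) + 1) • φ (merge j a) +
    (-1 : ℂ) ^ (n + 1) • E (a (Fin.last n)) (fun i => a i.castSucc)

lemma hdiff_add (E E' : A → (Fin n → A) → G) (φ φ' : (Fin n → A) → G) :
    hdiff (E + E') (φ + φ') = hdiff E φ + hdiff E' φ' := by
  ext a
  simp [hdiff, Finset.sum_add_distrib]
  abel

lemma hdiff_smul (c : ℂ) (E : A → (Fin n → A) → G) (φ : (Fin n → A) → G) :
    hdiff (c • E) (c • φ) = c • hdiff E φ := by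
  ext a
  simp [hdiff, Finset.smul_sum, smul_comm c]

/-- The signed sum of all sorting permutations of words of length `n` in the alphabet `L`. -/
def sortElt (n : ℕ) (L : Type*) [LinearOrder L] [Fintype L] :
    MonoidAlgebra ℚ (Equiv.Perm (Fin n)) :=
  ∑ f : Fin n → L, MonoidAlgebra.single (Tuple.sort f) ((Equiv.Perm.sign (Tuple.sort f) : ℤ) : ℚ)

variable {L : Type*} [LinearOrder L] [Fintype L]

lemma permOp_sortElt (φ : (Fin n → A) → G) (a : Fin n → A) :
    permOp (sortElt n L) φ a =
      ∑ f : Fin n → L, ((Equiv.Perm.sign (rank f) : ℤ) : ℂ) • φ (a ∘ rank f) := by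
  rw [sortElt, permOp_sum, Finset.sum_apply]
  refine Finset.sum_congr rfl fun f _ => ?_
  rw [permOp_single, rank, Equiv.Perm.sign_inv]
  push_cast
  rfl

lemma rank_insertNth (i : Fin (n + 1)) (c : L) (g : Fin n → L) (k : Fin n) :
    rank (i.insertNth c g : Fin (n + 1) → L) (i.succAbove k) =
      (rank (i.insertNth c g : Fin (n + 1) → L) i).succAbove (rank g k) := by
  have h : (i.insertNth c g : Fin (n + 1) → L) ∘ i.succAbove = g := by ext; simp
  simpa only [h] using (rank_removal (i.insertNth c g : Fin (n + 1) → L) i).1 k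

lemma sign_rank_insertNth (i : Fin (n + 1)) (c : L) (g : Fin n → L) :
    (Equiv.Perm.sign (rank (i.insertNth c g : Fin (n + 1) → L)) : ℤ) =
      (-1) ^ ((i : ℕ) + (rank (i.insertNth c g : Fin (n + 1) → L) i : ℕ)) *
        (Equiv.Perm.sign (rank g) : ℤ) := by
  have h : (i.insertNth c g : Fin (n + 1) → L) ∘ i.succAbove = g := by ext; simp
  simpa only [h] using (rank_removal (i.insertNth c g : Fin (n + 1) → L) i).2

lemma sum_insertNth {M : Type*} [AddCommMonoid M] (i : Fin (n + 1)) (F : (Fin (n + 1) → L) → M) :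
    ∑ f, F f = ∑ g : Fin n → L, ∑ c : L, F (i.insertNth c g) := by
  rw [← (Fin.insertNthEquiv (fun _ => L) i).sum_comp, Fintype.sum_prod_type_right]
  rfl

/-- Words with distinct letters at `j` and `j + 1` cancel in pairs under the swap, by commutativity
of `A`. The remaining words arise from words of length `n` by doubling the letter at `j`. -/
lemma sum_inner_face (φ : (Fin n → A) → G) (a : Fin (n + 1) → A) (j : Fin n) :
    ∑ f : Fin (n + 1) → L, ((Equiv.Perm.sign (rank f) : ℤ) : ℂ) • φ (merge j (a ∘ rank f)) =
      ∑ g : Fin n → L, ((-1) ^ ((j : ℕ) + (rank g j : ℕ)) * (Equiv.Perm.sign (rank g) : ℤ) : ℂ) •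
        φ (merge (rank g j) a ∘ rank g) := by
  classical
  have h0 : ∑ f : Fin (n + 1) → L with f j.castSucc ≠ f j.succ,
      ((Equiv.Perm.sign (rank f) : ℤ) : ℂ) • φ (merge j (a ∘ rank f)) = 0 := by
    refine Finset.sum_involution (fun f _ => f ∘ Equiv.swap j.castSucc j.succ) ?_ ?_ ?_ ?_
    · intro f hf
      have hf := (Finset.mem_filter.1 hf).2
      rw [rank_comp_swap f j hf, Equiv.Perm.coe_mul, ← Function.comp_assoc, merge_swap,
        Equiv.Perm.sign_mul, Equiv.Perm.sign_swap (Fin.castSucc_lt_succ (i := j)).ne]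
      simp
    · intro f hf _ h
      have hf := (Finset.mem_filter.1 hf).2
      have := congrFun h j.succ
      simp at this
      exact hf this
    · intro f hf
      have hf := (Finset.mem_filter.1 hf).2
      simpa using hf.symm
    · intro f hf
      ext i
      simp
  rw [← Finset.sum_filter_add_sum_filter_not Finset.univ
    (fun f : Fin (n + 1) → L => f j.castSucc ≠ f j.succ), h0, zero_add, Finset.sum_filter,
    sum_insertNth j.succ]
  refine Finset.sum_congr rfl fun g _ => ?_
  have h1 : ∀ c : L, (j.succ.insertNth c g : Fin (n + 1) → L) j.castSucc = g j := by
    intro c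
    rw [← Fin.succAbove_succ_self j, Fin.insertNth_apply_succAbove]
  -- Equality of the two neighbours forces the inserted letter to be `g j`.
  rw [Finset.sum_eq_single (g j)]
  · have h2 : (j.succ.insertNth (g j) g : Fin (n + 1) → L) ∘ j.succ.succAbove = g := by ext; simp
    have h3 : (j.succ.insertNth (g j) g : Fin (n + 1) → L) j.castSucc =
        (j.succ.insertNth (g j) g : Fin (n + 1) → L) j.succ := by
      rw [h1, Fin.insertNth_apply_same]
    rw [if_pos (not_not.2 h3), merge_rank _ j h3, sign_rank_insertNth, rank_of_eq _ j h3, h2]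
    congr 1
    push_cast
    congr 1
    simp only [Fin.val_succ]
    rw [show (j : ℕ) + 1 + ((rank g j : ℕ) + 1) = (j : ℕ) + (rank g j : ℕ) + 2 by ring, pow_add]
    simp
  · intro c _ hc
    rw [if_neg]
    rw [not_not, h1, Fin.insertNth_apply_same]
    exact hc.symm
  · simp

lemma rank_insertNth_zero_false (g : Fin n → Bool) :
    rank ((0 : Fin (n + 1)).insertNth false g : Fin (n + 1) → Bool) 0 = 0 := by
  set f := ((0 : Fin (n + 1)).insertNth false g : Fin (n + 1) → Bool)
  have h : ∀ q, ¬ q < rank f 0 := by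
    intro q hq
    obtain ⟨i, rfl⟩ := (rank f).surjective q
    rcases (Fin.zero_le i).eq_or_lt with rfl | hi
    · exact lt_irrefl _ hq
    · exact lt_asymm hq ((rank_lt_rank f hi).2 (by simp [f]))
  exact le_antisymm (not_lt.1 (h 0)) (Fin.zero_le _)

lemma rank_insertNth_last_true (g : Fin n → Bool) :
    rank ((Fin.last n).insertNth true g : Fin (n + 1) → Bool) (Fin.last n) = Fin.last n := by
  set f := ((Fin.last n).insertNth true g : Fin (n + 1) → Bool)
  have h : ∀ q, ¬ rank f (Fin.last n) < q := by
    intro q hq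
    obtain ⟨i, rfl⟩ := (rank f).surjective q
    rcases (Fin.le_last i).eq_or_lt with rfl | hi
    · exact lt_irrefl _ hq
    · exact lt_asymm hq ((rank_lt_rank f hi).2 (by simp [f, Bool.le_true]))
  exact le_antisymm (Fin.le_last _) (not_lt.1 (h _))

/-- Both ranks equal the number of letters `false` in `g`. The proof rotates one word into the
other. These are the outer terms that cancel in `permOp_hdiff`. -/
lemma rank_insertNth_last_false (g : Fin n → Bool) :
    rank ((Fin.last n).insertNth false g : Fin (n + 1) → Bool) (Fin.last n) =
      rank ((0 : Fin (n + 1)).insertNth true g : Fin (n + 1) → Bool) 0 := by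
  set f := ((0 : Fin (n + 1)).insertNth true g : Fin (n + 1) → Bool) with hf
  suffices H : rank f * finRotate (n + 1) =
      rank ((Fin.last n).insertNth false g : Fin (n + 1) → Bool) by
    rw [← H, Equiv.Perm.coe_mul, Function.comp_apply, finRotate_last]
  refine eq_rank fun i j hij => ?_
  obtain ⟨k, rfl⟩ : ∃ k : Fin n, i = k.castSucc :=
    ⟨i.castPred (hij.trans_le (Fin.le_last j)).ne, by simp⟩
  have hrot : ∀ k : Fin n, finRotate (n + 1) k.castSucc = k.succ := by
    intro k
    rw [finRotate_apply, Fin.coeSucc_eq_succ]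
  have hz : ∀ k : Fin n, f k.succ = g k := by
    intro k
    simp [hf]
  have h0 : f 0 = true := by simp [hf]
  induction j using Fin.lastCases with
  | last =>
    simp only [Equiv.Perm.coe_mul, Function.comp_apply, hrot, finRotate_last]
    have h1 := rank_lt_rank f (Fin.succ_pos k)
    have hne : rank f 0 ≠ rank f k.succ := fun e => (Fin.succ_ne_zero k) ((rank f).injective e).symm
    rw [hz, h0] at h1
    have h2 : (Fin.last n).insertNth (α := fun _ => Bool) false g k.castSucc = g k := by
      rw [← Fin.succAbove_last_apply k, Fin.insertNth_apply_succAbove]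
    rw [h2, Fin.insertNth_apply_same]
    cases hg : g k
    · rw [hg] at h1
      simp only [le_refl, iff_true]
      refine lt_of_le_of_ne (not_lt.1 fun h => ?_) hne.symm
      exact absurd (h1.1 h) (by decide)
    · rw [hg] at h1
      refine iff_of_false (fun h => lt_asymm h (h1.2 le_rfl)) (by decide)
  | cast l =>
    simp only [Equiv.Perm.coe_mul, Function.comp_apply, hrot]
    rw [rank_lt_rank f (Fin.succ_lt_succ_iff.2 (by simpa using hij)), hz, hz]
    have h2 : ∀ k : Fin n, (Fin.last n).insertNth (α := fun _ => Bool) false g k.castSucc = g k := by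
      intro k
      rw [← Fin.succAbove_last_apply k, Fin.insertNth_apply_succAbove]
    rw [h2, h2]

/-- The outer terms are indexed by the end of the word and the letter standing there. A leading
`false` and a final `true` are ranked first and last and give the outer faces; a leading `true` and
a final `false` have equal rank and opposite sign. -/
lemma permOp_hdiff (E : A → (Fin n → A) → G) (φ : (Fin n → A) → G) :
    permOp (sortElt (n + 1) Bool) (hdiff E φ) =
      hdiff (fun c => permOp (sortElt n Bool) (E c)) (permOp (sortElt n Bool) φ) := by
  ext a
  rw [permOp_sortElt]
  simp only [hdiff, smul_add, Finset.sum_add_distrib, Finset.smul_sum]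
  -- The signed term in which `a p` is used by the outer face and the other arguments are permuted
  -- by `g`.
  let F (g : Fin n → Bool) (p : Fin (n + 1)) : G :=
    ((-1) ^ (p : ℕ) * (Equiv.Perm.sign (rank g) : ℤ) : ℂ) • E (a p) (a ∘ p.succAbove ∘ rank g)
  have hfirst : ∑ f : Fin (n + 1) → Bool, ((Equiv.Perm.sign (rank f) : ℤ) : ℂ) •
      E ((a ∘ rank f) 0) (fun i => (a ∘ rank f) i.succ) =
      ∑ g : Fin n → Bool, ∑ c : Bool, F g (rank ((0 : Fin (n + 1)).insertNth c g) 0) := by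
    rw [sum_insertNth 0]
    refine Finset.sum_congr rfl fun g _ => Finset.sum_congr rfl fun c _ => ?_
    rw [sign_rank_insertNth]
    simp only [F, Fin.val_zero, zero_add]
    push_cast
    congr 2
    ext i
    simp only [Function.comp_apply]
    rw [← rank_insertNth, Fin.succAbove_zero]
  have hlast : ∑ f : Fin (n + 1) → Bool, ((Equiv.Perm.sign (rank f) : ℤ) : ℂ) •
      (-1 : ℂ) ^ (n + 1) • E ((a ∘ rank f) (Fin.last n)) (fun i => (a ∘ rank f) i.castSucc) =
      - ∑ g : Fin n → Bool, ∑ c : Bool,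
        F g (rank ((Fin.last n).insertNth c g : Fin (n + 1) → Bool) (Fin.last n)) := by
    rw [sum_insertNth (Fin.last n), ← Finset.sum_neg_distrib]
    refine Finset.sum_congr rfl fun g _ => ?_
    rw [← Finset.sum_neg_distrib]
    refine Finset.sum_congr rfl fun c _ => ?_
    rw [sign_rank_insertNth]
    simp only [F, Fin.val_last, smul_smul, ← neg_smul]
    congr 1
    · push_cast
      rcases neg_one_pow_eq_or ℂ n with h | h <;> simp [pow_add, h]
    · congr 1
      ext i
      simp only [Function.comp_apply]
      rw [← rank_insertNth, Fin.succAbove_last]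
  have hmid : ∑ f : Fin (n + 1) → Bool, ∑ j : Fin n, ((Equiv.Perm.sign (rank f) : ℤ) : ℂ) •
      (-1 : ℂ) ^ ((j : ℕ) + 1) • φ (merge j (a ∘ rank f)) =
      ∑ j : Fin n, (-1 : ℂ) ^ ((j : ℕ) + 1) • permOp (sortElt n Bool) φ (merge j a) := by
    rw [Finset.sum_comm]
    simp only [smul_comm _ ((-1 : ℂ) ^ _) (φ _), ← Finset.smul_sum, sum_inner_face, permOp_sortElt]
    simp only [Finset.smul_sum]
    rw [Finset.sum_comm]
    conv_rhs => rw [Finset.sum_comm]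
    refine Finset.sum_congr rfl fun g _ => ?_
    -- The merge position in `a` is `rank g j`; reindexing by it absorbs the sign `(-1) ^ rank g j`
    -- into the sign of the face.
    conv_rhs => rw [← Equiv.sum_comp (rank g)]
    refine Finset.sum_congr rfl fun j _ => ?_
    rw [smul_smul, smul_smul]
    congr 1
    rcases neg_one_pow_eq_or ℂ (j : ℕ) with h | h <;> simp [pow_add, h]
  rw [hfirst, hlast, hmid]
  simp only [Fintype.sum_bool, rank_insertNth_zero_false, rank_insertNth_last_true,
    rank_insertNth_last_false, Finset.sum_add_distrib]
  have h0 : permOp (sortElt n Bool) (E (a 0)) (fun i => a i.succ) = ∑ g, F g 0 := by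
    rw [permOp_sortElt]
    refine Finset.sum_congr rfl fun g _ => ?_
    simp [F]
    rfl
  have h1 : (-1 : ℂ) ^ (n + 1) • permOp (sortElt n Bool) (E (a (Fin.last n)))
      (fun i => a i.castSucc) = - ∑ g, F g (Fin.last n) := by
    rw [permOp_sortElt, Finset.smul_sum, ← Finset.sum_neg_distrib]
    refine Finset.sum_congr rfl fun g _ => ?_
    simp only [F, smul_smul, ← neg_smul, Fin.val_last, Fin.succAbove_last]
    congr 1
    ring
  rw [h0, h1]
  abel

end Differential

/-! ### Word sums, shuffles and polynomials in the shuffle element. -/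

section Eulerian

variable {n : ℕ} {L : Type*} [LinearOrder L]

lemma sort_eq_of_rank {f : Fin n → L} {σ : Equiv.Perm (Fin n)} (h : σ⁻¹ = rank f) :
    Tuple.sort f = σ := by
  rw [rank, inv_inj] at h
  exact h.symm

lemma sort_strictMono_comp {L' : Type*} [LinearOrder L'] {e : L → L'} (he : StrictMono e)
    (f : Fin n → L) : Tuple.sort (e ∘ f) = Tuple.sort f :=
  sort_eq_of_rank <| eq_rank fun i j hij => by
    rw [Function.comp_apply, Function.comp_apply, he.le_iff_le]
    exact rank_lt_rank f hij

variable (n) in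
/-- The signed sum of the sorting permutations of the surjective words in `j` letters. -/
def surjElt (j : ℕ) : MonoidAlgebra ℚ (Equiv.Perm (Fin n)) :=
  open Classical in ∑ f : Fin n → Fin j with Function.Surjective f,
    MonoidAlgebra.single (Tuple.sort f) ((Equiv.Perm.sign (Tuple.sort f) : ℤ) : ℚ)

lemma surjElt_eq_zero {j : ℕ} (h : n < j) : surjElt n j = 0 := by
  classical
  refine Finset.sum_eq_zero fun f hf => absurd h (not_lt.2 ?_)
  simpa using Fintype.card_le_of_surjective f (Finset.mem_filter.1 hf).2

lemma surjElt_zero (h : 0 < n) : surjElt n 0 = 0 := by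
  classical
  exact Finset.sum_eq_zero fun f hf => (f ⟨0, h⟩).elim0

variable (n) in
/-- The element `sortElt n L` for an alphabet of `k` letters. -/
def wordElt (k : ℕ) : MonoidAlgebra ℚ (Equiv.Perm (Fin n)) :=
  ∑ j ∈ Finset.range (n + 1), (k.choose j : ℚ) • surjElt n j

/-- Words are grouped by the set of letters that occur. A strictly monotone relabelling preserves
the sorting permutation, so each set of size `j` contributes `surjElt n j`, and there are binomially
many such sets. -/
lemma sortElt_eq_wordElt [Fintype L] : sortElt n L = wordElt n (Fintype.card L) := by
  classical
  have h1 : sortElt n L = ∑ I : Finset L, surjElt n I.card := by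
    rw [sortElt, ← Finset.sum_fiberwise Finset.univ (fun f : Fin n → L => Finset.univ.image f)]
    refine Finset.sum_congr rfl fun I _ => ?_
    symm
    refine Finset.sum_bij (fun f _ => I.orderEmbOfFin rfl ∘ f) ?_ ?_ ?_ ?_
    · intro f hf
      have hf := (Finset.mem_filter.1 hf).2
      simp only [Finset.mem_filter, Finset.mem_univ, true_and]
      ext x
      rw [← Finset.mem_coe (s := I), ← Finset.range_orderEmbOfFin I rfl]
      simp only [Finset.mem_image, Finset.mem_univ, true_and, Function.comp_apply, Set.mem_range]
      exact ⟨fun ⟨a, h⟩ => ⟨_, h⟩, fun ⟨a, h⟩ => (hf a).imp fun b hb => by rw [hb, h]⟩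
    · intro f _ g _ h
      exact (I.orderEmbOfFin rfl).injective.comp_left h
    · intro f hf
      have hf := (Finset.mem_filter.1 hf).2
      have hr : ∀ i, ∃ k, I.orderEmbOfFin rfl k = f i := fun i => by
        have : f i ∈ I := hf ▸ Finset.mem_image_of_mem f (Finset.mem_univ i)
        rwa [← Finset.mem_coe, ← Finset.range_orderEmbOfFin I rfl] at this
      choose g hg using hr
      refine ⟨g, ?_, funext hg⟩
      simp only [Finset.mem_filter, Finset.mem_univ, true_and]
      intro k
      have hk : I.orderEmbOfFin rfl k ∈ I := Finset.orderEmbOfFin_mem _ _ _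
      obtain ⟨i, -, hi⟩ := Finset.mem_image.1 (hf.symm ▸ hk :
        I.orderEmbOfFin rfl k ∈ Finset.univ.image f)
      exact ⟨i, (I.orderEmbOfFin rfl).injective (by rw [hg, hi])⟩
    · intro f _
      rw [sort_strictMono_comp (I.orderEmbOfFin rfl).strictMono]
  -- The terms vanish for `j > card L` by the binomial coefficient and for `j > n` by
  -- `surjElt_eq_zero`, so both ranges may be enlarged to a common one.
  have h2 : ∀ N, (∀ j, N ≤ j → ((Fintype.card L).choose j : ℚ) • surjElt n j = 0) →
      ∀ N' ≥ N, ∑ j ∈ Finset.range N', ((Fintype.card L).choose j : ℚ) • surjElt n j =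
        ∑ j ∈ Finset.range N, ((Fintype.card L).choose j : ℚ) • surjElt n j := by
    intro N hN N' hN'
    symm
    refine Finset.sum_subset (Finset.range_mono hN') fun j _ hj => hN j ?_
    simpa using hj
  rw [h1, ← Finset.powerset_univ, Finset.sum_powerset_apply_card (fun j => surjElt n j),
    Finset.card_univ, wordElt]
  simp only [← Nat.cast_smul_eq_nsmul ℚ]
  rw [← h2 (Fintype.card L + 1) (fun j hj => by rw [Nat.choose_eq_zero_of_lt hj]; simp)
    (Fintype.card L + n + 1) (by omega), ← h2 (n + 1)
    (fun j hj => by rw [surjElt_eq_zero hj]; simp) (Fintype.card L + n + 1) (by omega)]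

/-- Radix sort: sorting stably by one key and then by a second key sorts lexicographically, the
second key being the primary one. -/
lemma sortElt_mul {L' : Type*} [LinearOrder L'] [Fintype L] [Fintype L'] :
    sortElt n L * sortElt n L' = sortElt n (L' ×ₗ L) := by
  rw [sortElt, sortElt, Finset.sum_mul_sum, ← Fintype.sum_prod_type', sortElt]
  -- The second word is indexed by positions after the first sort, so it is pulled back along `rank`
  -- before the letters are paired.
  let e : (Fin n → L) × (Fin n → L') ≃ (Fin n → L' ×ₗ L) :=
    { toFun := fun p j => toLex (p.2 (rank p.1 j), p.1 j)
      invFun := fun h => (fun j => (ofLex (h j)).2,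
        fun j => (ofLex (h ((rank fun j => (ofLex (h j)).2).symm j))).1)
      left_inv := fun p => by
        ext j
        · rfl
        · change p.2 (rank p.1 ((rank p.1).symm j)) = _
          rw [Equiv.apply_symm_apply]
      right_inv := fun h => by
        ext j
        change toLex ((ofLex (h ((rank fun j => (ofLex (h j)).2).symm
          ((rank fun j => (ofLex (h j)).2) j)))).1, (ofLex (h j)).2) = h j
        rw [Equiv.symm_apply_apply]
        rfl }
  refine Fintype.sum_equiv e _ _ fun p => ?_
  obtain ⟨f, g⟩ := p
  have key : Tuple.sort (e (f, g)) = Tuple.sort f * Tuple.sort g := by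
    refine sort_eq_of_rank (eq_rank fun i j hij => ?_)
    have hr : ∀ i, (Tuple.sort f * Tuple.sort g)⁻¹ i = rank g (rank f i) := fun i => by
      rw [mul_inv_rev]; rfl
    rw [hr, hr]
    change _ ↔ toLex (g (rank f i), f i) ≤ toLex (g (rank f j), f j)
    rw [Prod.Lex.toLex_le_toLex]
    have h1 := rank_lt_rank f hij
    by_cases h : rank f i < rank f j
    · rw [rank_lt_rank g h, le_iff_lt_or_eq]
      simp [h1.1 h]
    · have hne : rank f i ≠ rank f j := fun e => hij.ne ((rank f).injective e)
      have h' : rank f j < rank f i := lt_of_le_of_ne (not_lt.1 h) hne.symm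
      have h2 := rank_lt_rank g h'
      have hne' : rank g (rank f i) ≠ rank g (rank f j) := fun e => hne ((rank g).injective e)
      have h3 : ¬ f i ≤ f j := fun h4 => h (h1.2 h4)
      simp only [h3, and_false, or_false]
      rw [← not_le (a := g (rank f j)), ← h2, not_lt]
      exact ⟨le_of_lt, fun h5 => lt_of_le_of_ne h5 hne'⟩
  rw [key, MonoidAlgebra.single_mul_single, map_mul]
  push_cast
  rfl

lemma wordElt_mul (k l : ℕ) : wordElt n k * wordElt n l = wordElt n (k * l) := by
  have h := sortElt_mul (n := n) (L := Fin k) (L' := Fin l)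
  rw [sortElt_eq_wordElt, sortElt_eq_wordElt, sortElt_eq_wordElt, Fintype.card_lex,
    Fintype.card_prod, Fintype.card_fin, Fintype.card_fin] at h
  rw [h, mul_comm]

lemma wordElt_one : wordElt n 1 = 1 := by
  have h := sortElt_eq_wordElt (n := n) (L := Fin 1)
  rw [Fintype.card_fin] at h
  rw [← h, sortElt, Fintype.sum_unique]
  have : Tuple.sort (default : Fin n → Fin 1) = 1 :=
    Tuple.sort_eq_refl_iff_monotone.2 fun i j _ => le_of_eq (Subsingleton.elim _ _)
  rw [this]
  simp [MonoidAlgebra.one_def]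

lemma wordElt_two_pow (i : ℕ) : wordElt n 2 ^ i = wordElt n (2 ^ i) := by
  induction i with
  | zero => rw [pow_zero, pow_zero, wordElt_one]
  | succ i ih => rw [pow_succ, ih, wordElt_mul, pow_succ]

/-- The binomial coefficient as a polynomial. -/
def choosePoly (j : ℕ) : Polynomial ℚ := Polynomial.C ((j.factorial : ℚ)⁻¹) * descPochhammer ℚ j

lemma choosePoly_eval (j k : ℕ) : (choosePoly j).eval (k : ℚ) = k.choose j := by
  rw [choosePoly, Polynomial.eval_mul, Polynomial.eval_C, descPochhammer_eval_eq_descFactorial,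
    Nat.descFactorial_eq_factorial_mul_choose]
  push_cast
  rw [inv_mul_cancel_left₀ (by exact_mod_cast j.factorial_ne_zero)]

lemma choosePoly_natDegree (j : ℕ) : (choosePoly j).natDegree ≤ j :=
  (Polynomial.natDegree_C_mul_le _ _).trans (descPochhammer_natDegree ℚ j).le

lemma choosePoly_coeff_zero {j : ℕ} (hj : 0 < j) : (choosePoly j).coeff 0 = 0 := by
  rw [Polynomial.coeff_zero_eq_eval_zero]
  have := choosePoly_eval j 0
  rwa [Nat.cast_zero, Nat.choose_eq_zero_of_lt hj, Nat.cast_zero] at this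

/-- The power `wordElt n 2 ^ i` has coefficients `choose (2 ^ i) j`, which are polynomials in `2 ^
i`. Expanding them in powers `2 ^ (i m)` and exchanging the sums leaves `P` only through its values
at `2 ^ m`. -/
lemma aeval_wordElt_two (P : Polynomial ℚ) :
    Polynomial.aeval (wordElt n 2) P = ∑ j ∈ Finset.range (n + 1),
      (∑ m ∈ Finset.range (n + 1), (choosePoly j).coeff m * P.eval (2 ^ m)) • surjElt n j := by
  induction P using Polynomial.induction_on' with
  | add P Q hP hQ =>
    rw [map_add, hP, hQ, ← Finset.sum_add_distrib]
    refine Finset.sum_congr rfl fun j _ => ?_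
    rw [← add_smul, ← Finset.sum_add_distrib]
    simp only [Polynomial.eval_add, mul_add]
  | monomial i c =>
    rw [Polynomial.aeval_monomial, wordElt_two_pow, wordElt, ← Algebra.smul_def, Finset.smul_sum]
    refine Finset.sum_congr rfl fun j hj => ?_
    have hj : j < n + 1 := Finset.mem_range.1 hj
    rw [smul_smul]
    congr 1
    rw [← choosePoly_eval, Polynomial.eval_eq_sum_range' (lt_of_le_of_lt (choosePoly_natDegree j) hj),
      Finset.mul_sum]
    refine Finset.sum_congr rfl fun m _ => ?_
    rw [Polynomial.eval_monomial]
    push_cast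
    rw [← pow_mul, ← pow_mul, mul_comm i m]
    ring

/-- A two-letter word is the same as the number `p` of letters `false` together with a `(p, n -
p)`-shuffle, namely its sorting permutation. The excluded values `p = 0` and `p = n` contribute one
identity each. -/
lemma shuffleElt_eq (hn : 0 < n) : shuffleElt n = wordElt n 2 - 2 := by
  classical
  let F (σ : Equiv.Perm (Fin n)) : MonoidAlgebra ℚ (Equiv.Perm (Fin n)) :=
    MonoidAlgebra.single σ ((Equiv.Perm.sign σ : ℤ) : ℚ)
  have h1 : ∑ p ∈ Finset.range (n + 1), ∑ σ : Equiv.Perm (Fin n) with IsShuffle p σ, F σ =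
      wordElt n 2 := by
    have h := sortElt_eq_wordElt (n := n) (L := Bool)
    rw [Fintype.card_bool] at h
    rw [← h, Finset.sum_sigma', sortElt]
    have key : ∀ p σ, IsShuffle p σ →
        Tuple.sort (fun j : Fin n => decide (p ≤ (σ⁻¹ j : ℕ))) = σ := by
      intro p σ hσ
      symm
      rw [Tuple.eq_sort_iff]
      refine ⟨fun i j hij => ?_, fun i j hij h => ?_⟩
      · simp only [Function.comp_apply, Equiv.Perm.coe_inv, Equiv.symm_apply_apply]
        rw [Fin.le_def] at hij
        by_cases h : p ≤ (i : ℕ)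
        · simp [h, h.trans hij]
        · simp [h]
      · simp only [Equiv.Perm.coe_inv, Equiv.symm_apply_apply, decide_eq_decide] at h
        have hij' := hij
        rw [Fin.lt_def] at hij'
        exact hσ i j hij (by omega)
    refine Finset.sum_bij (fun x _ j => decide (x.1 ≤ (x.2⁻¹ j : ℕ))) (fun _ _ => Finset.mem_univ _)
      ?_ ?_ ?_
    · rintro ⟨p, σ⟩ hx ⟨p', σ'⟩ hx' he
      simp only [Finset.mem_sigma, Finset.mem_range, Finset.mem_filter, Finset.mem_univ,
        true_and] at hx hx' he
      have hσ : σ = σ' := by rw [← key p σ hx.2, ← key p' σ' hx'.2, he]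
      subst hσ
      have hp : p = p' := by
        have h2 : ∀ i : Fin n, p ≤ (i : ℕ) ↔ p' ≤ (i : ℕ) := fun i => by
          have := congrFun he (σ i)
          simpa using this
        by_contra hne
        rcases lt_or_gt_of_ne hne with h3 | h3
        · have := h2 ⟨p, by omega⟩
          simp at this; omega
        · have := h2 ⟨p', by omega⟩
          simp at this; omega
      subst hp
      rfl
    · intro f _
      obtain ⟨hm, hs⟩ := (Tuple.eq_sort_iff (f := f) (σ := Tuple.sort f)).1 rfl
      -- `p` is the first index at which the sorted word is `true`, or `n` if there is none.
      obtain ⟨p, hp, hp'⟩ : ∃ p ≤ n, ∀ i : Fin n, f (Tuple.sort f i) = decide (p ≤ (i : ℕ)) := by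
        by_cases hex : ∃ i : ℕ, ∃ h : i < n, f (Tuple.sort f ⟨i, h⟩) = true
        · obtain ⟨h0, h1⟩ := Nat.find_spec hex
          refine ⟨Nat.find hex, h0.le, fun i => ?_⟩
          by_cases hi : Nat.find hex ≤ (i : ℕ)
          · have := hm (show (⟨Nat.find hex, h0⟩ : Fin n) ≤ i from hi)
            simp only [Function.comp_apply, h1] at this
            simpa [hi, Bool.eq_true_of_true_le] using Bool.eq_true_of_true_le this
          · have := Nat.find_min hex (not_le.1 hi)
            simp only [Fin.eta, not_exists] at this
            simpa [hi] using this i.2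
        · refine ⟨n, le_rfl, fun i => ?_⟩
          simp only [not_exists] at hex
          have := hex i i.2
          have hi : ¬ n ≤ (i : ℕ) := not_le.2 i.2
          simpa [hi] using this
      refine ⟨⟨p, Tuple.sort f⟩, ?_, ?_⟩
      · simp only [Finset.mem_sigma, Finset.mem_range, Finset.mem_filter, Finset.mem_univ,
          true_and]
        refine ⟨by omega, fun i j hij h => hs i j hij ?_⟩
        rw [hp', hp', decide_eq_decide]
        rw [Fin.lt_def] at hij
        omega
      · ext j
        rw [← hp', Equiv.Perm.coe_inv, Equiv.apply_symm_apply]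
    · rintro ⟨p, σ⟩ hx
      simp only [Finset.mem_sigma, Finset.mem_filter, Finset.mem_univ, true_and] at hx
      rw [key p σ hx.2]
  have h2 : ∀ p, (p = 0 ∨ p = n) → ∑ σ : Equiv.Perm (Fin n) with IsShuffle p σ, F σ = 1 := by
    intro p hp
    have : ∀ σ : Equiv.Perm (Fin n), IsShuffle p σ ↔ σ = 1 := by
      intro σ
      constructor
      · intro h
        refine perm_eq_of_lt fun i j hij => ?_
        simp only [Equiv.Perm.coe_one, id_eq, hij, iff_true]
        exact h i j hij (by rcases hp with rfl | rfl <;> simp)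
      · rintro rfl i j hij _
        exact hij
    simp only [this, Finset.filter_eq', Finset.mem_univ, if_true, Finset.sum_singleton, F]
    simp [MonoidAlgebra.one_def]
  have h3 : Finset.range (n + 1) = insert 0 (insert n (Finset.Ioo 0 n)) := by
    ext x
    simp
    omega
  rw [h3, Finset.sum_insert (by simp; omega), Finset.sum_insert (by simp), h2 0 (Or.inl rfl),
    h2 n (Or.inr rfl)] at h1
  rw [← h1, shuffleElt, show (2 : MonoidAlgebra ℚ (Equiv.Perm (Fin n))) = 1 + 1 by norm_num]
  abel

lemma aeval_shuffleElt (hn : 0 < n) (P : Polynomial ℚ) : Polynomial.aeval (shuffleElt n) P =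
    Polynomial.aeval (wordElt n 2) (P.comp (Polynomial.X - Polynomial.C 2)) := by
  rw [Polynomial.aeval_comp, shuffleElt_eq hn, map_sub, Polynomial.aeval_X, Polynomial.aeval_C,
    map_ofNat]

/-- A polynomial in the shuffle element depends only on its values at `2 ^ m - 2`, `1 ≤ m ≤ n`. -/
lemma aeval_shuffleElt_congr (hn : 0 < n) {P Q : Polynomial ℚ}
    (h : ∀ m ∈ Finset.Icc 1 n, P.eval (2 ^ m - 2) = Q.eval (2 ^ m - 2)) :
    Polynomial.aeval (shuffleElt n) P = Polynomial.aeval (shuffleElt n) Q := by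
  rw [aeval_shuffleElt hn, aeval_shuffleElt hn, aeval_wordElt_two, aeval_wordElt_two]
  refine Finset.sum_congr rfl fun j _ => ?_
  rcases Nat.eq_zero_or_pos j with rfl | hj
  -- The value at `m = 0` plays no role: there is no surjective word in zero letters, and for `j >
  -- 0` the binomial polynomial has no constant term.
  · rw [surjElt_zero hn, smul_zero, smul_zero]
  congr 1
  refine Finset.sum_congr rfl fun m hm => ?_
  rcases Nat.eq_zero_or_pos m with rfl | hm'
  · rw [choosePoly_coeff_zero hj, zero_mul, zero_mul]
  · congr 1
    simp only [Polynomial.eval_comp, Polynomial.eval_sub, Polynomial.eval_X, Polynomial.eval_C]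
    exact h m (Finset.mem_Icc.2 ⟨hm', by have := Finset.mem_range.1 hm; omega⟩)

/-- The interpolation polynomial that defines the first idempotent. -/
def bgsPoly (n : ℕ) : Polynomial ℚ :=
  Lagrange.basis (Finset.Icc 1 n) (fun j => (2 : ℚ) ^ j - 2) 1

lemma bgsPoly_eval {m : ℕ} (hm : m ∈ Finset.Icc 1 n) :
    (bgsPoly n).eval ((2 : ℚ) ^ m - 2) = if m = 1 then 1 else 0 := by
  split_ifs with h
  · subst h
    refine Lagrange.eval_basis_self (v := fun j => (2 : ℚ) ^ j - 2) (fun a _ b _ hab => ?_) hm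
    exact pow_right_injective₀ (by norm_num : (0 : ℚ) < 2) (by norm_num) (sub_left_injective hab)
  · exact Lagrange.eval_basis_of_ne (v := fun j => (2 : ℚ) ^ j - 2) (Ne.symm h) hm

lemma bgs_eq_aeval (n : ℕ) : bgs n 1 = Polynomial.aeval (shuffleElt n) (bgsPoly n) := rfl

/-- The polynomial of degree index `n + 1` takes the prescribed values at all nodes for `n`, so
consecutive idempotents come from one polynomial. -/
lemma aeval_bgsPoly_succ (hn : 0 < n) :
    Polynomial.aeval (shuffleElt n) (bgsPoly (n + 1)) = bgs n 1 := by
  rw [bgs_eq_aeval]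
  refine aeval_shuffleElt_congr hn fun m hm => ?_
  rw [bgsPoly_eval hm, bgsPoly_eval]
  rw [Finset.mem_Icc] at *
  omega

/-- The interpolation polynomial takes only the values `0` and `1` at the nodes, so it agrees there
with its square. -/
lemma bgs_mul_self (hn : 0 < n) : bgs n 1 * bgs n 1 = bgs n 1 := by
  rw [bgs_eq_aeval, ← map_mul]
  refine aeval_shuffleElt_congr hn fun m hm => ?_
  rw [Polynomial.eval_mul, bgsPoly_eval hm]
  split_ifs <;> simp

lemma bgs_one : bgs 1 1 = 1 := by
  simp [bgs, Lagrange.basis]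

end Eulerian

/-! ### The Eulerian idempotent commutes with the formal differential. -/

section Compatibility

variable {n : ℕ} {A : Type*} [NonUnitalNormedCommRing A] {G : Type*} [AddCommGroup G] [Module ℂ G]

lemma permOp_wordElt_hdiff (E : A → (Fin n → A) → G) (φ : (Fin n → A) → G) :
    permOp (wordElt (n + 1) 2) (hdiff E φ) =
      hdiff (fun c => permOp (wordElt n 2) (E c)) (permOp (wordElt n 2) φ) := by
  have h1 := sortElt_eq_wordElt (n := n) (L := Bool)
  have h2 := sortElt_eq_wordElt (n := n + 1) (L := Bool)
  rw [Fintype.card_bool] at h1 h2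
  rw [← h1, ← h2, permOp_hdiff]

lemma permOp_aeval_wordElt_hdiff (P : Polynomial ℚ) (E : A → (Fin n → A) → G)
    (φ : (Fin n → A) → G) :
    permOp (Polynomial.aeval (wordElt (n + 1) 2) P) (hdiff E φ) =
      hdiff (fun c => permOp (Polynomial.aeval (wordElt n 2) P) (E c))
        (permOp (Polynomial.aeval (wordElt n 2) P) φ) := by
  induction P using Polynomial.induction_on' generalizing E φ with
  | add P Q hP hQ =>
    simp only [map_add, permOp_add, hP, hQ]
    rw [← hdiff_add]
    rfl
  | monomial i c =>
    simp only [Polynomial.aeval_monomial, ← Algebra.smul_def, permOp_smul]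
    have h : ∀ i, permOp (wordElt (n + 1) 2 ^ i) (hdiff E φ) =
        hdiff (fun c => permOp (wordElt n 2 ^ i) (E c)) (permOp (wordElt n 2 ^ i) φ) := by
      intro i
      induction i with
      | zero => simp only [pow_zero, permOp_one]
      | succ i ih => simp only [pow_succ, permOp_mul, ih, permOp_wordElt_hdiff]
    rw [h, ← hdiff_smul]
    rfl

/-- The first Eulerian idempotent commutes with the formal Hochschild differential. -/
lemma permOp_bgs_hdiff (hn : 0 < n) (E : A → (Fin n → A) → G) (φ : (Fin n → A) → G) :
    permOp (bgs (n + 1) 1) (hdiff E φ) =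
      hdiff (fun c => permOp (bgs n 1) (E c)) (permOp (bgs n 1) φ) := by
  rw [bgs_eq_aeval, aeval_shuffleElt (Nat.succ_pos n), permOp_aeval_wordElt_hdiff,
    ← aeval_shuffleElt hn, aeval_bgsPoly_succ hn]

end Compatibility

/-! ### Simplicial identities for faces with commutative action. -/

section Faces

variable {A : Type*} [NonUnitalNormedCommRing A] {M : Type*} {n : ℕ}

/-- The faces of the cyclic word `(x, a₀, …, aₙ)`, for a commutative action. -/
def wordFace (act : A → M → M) (i : ℕ) (p : M × (Fin (n + 1) → A)) : M × (Fin n → A) :=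
  (if i = 0 then act (p.2 0) p.1 else if i = n + 1 then act (p.2 (Fin.last n)) p.1 else p.1,
    fun k => if (k : ℕ) + 1 < i then p.2 k.castSucc else
      if (k : ℕ) + 1 = i then p.2 k.castSucc * p.2 k.succ else p.2 k.succ)

lemma wordFace_wordFace {act : A → M → M} (hact : ∀ a b x, act (a * b) x = act a (act b x))
    {i j : ℕ} (hij : i ≤ j) (hj : j ≤ n + 1) (p : M × (Fin (n + 2) → A)) :
    wordFace act i (wordFace act (j + 1) p) = wordFace act j (wordFace act i p) := by
  obtain ⟨x, a⟩ := p
  have hcomm : ∀ a b x, act a (act b x) = act b (act a x) := fun a b x => by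
    rw [← hact, ← hact, mul_comm]
  refine Prod.ext ?_ (funext fun k => ?_)
  · simp only [wordFace]
    rcases Nat.eq_zero_or_pos i with rfl | hi <;> rcases Nat.eq_zero_or_pos j with rfl | hj0
    · simp [← hact, mul_comm]
    · by_cases h : j = n + 1
      · subst h
        have : (n : ℕ) + 1 ≠ 0 := by omega
        simp [hcomm]
      · simp [h, hj0.ne', hj0]
    · omega
    · by_cases h : j = n + 1
      · subst h
        by_cases h' : i = n + 1
        · subst h'
          simp [← hact]
        · have h3 : i ≠ n + 1 + 1 := by omega
          have h4 : ¬ n + 1 < i := by omega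
          simp [hi.ne', h', h3, h4, Ne.symm h']
      · have h1 : i ≠ n + 1 := by omega
        have h2 : i ≠ n + 1 + 1 := by omega
        simp [hi.ne', h, h1, h2, hj0.ne']
  · simp only [wordFace, Fin.val_castSucc, Fin.val_succ, ← Fin.succ_castSucc]
    split_ifs <;> first | rfl | omega | exact mul_assoc _ _ _ | exact (mul_assoc _ _ _).symm

lemma sum_wordFace_wordFace {act : A → M → M} (hact : ∀ a b x, act (a * b) x = act a (act b x))
    {G : Type*} [AddCommGroup G] [Module ℂ G] (φ : M × (Fin n → A) → G)
    (p : M × (Fin (n + 2) → A)) :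
    ∑ i ∈ Finset.range (n + 3), ∑ j ∈ Finset.range (n + 2),
      (-1 : ℂ) ^ (i + j) • φ (wordFace act j (wordFace act i p)) = 0 := by
  rw [← Finset.sum_product']
  -- The simplicial identity pairs `(i, j)`, `j < i`, with `(j, i - 1)`; the two signs are opposite.
  refine Finset.sum_involution
    (fun x _ => if x.2 < x.1 then (x.2, x.1 - 1) else (x.2 + 1, x.1)) ?_ ?_ ?_ ?_
  · rintro ⟨i, j⟩ h
    simp only [Finset.mem_product, Finset.mem_range] at h
    by_cases hij : j < i
    · obtain ⟨i, rfl⟩ : ∃ k, i = k + 1 := ⟨i - 1, by omega⟩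
      simp only [hij, if_true, Nat.add_sub_cancel]
      rw [wordFace_wordFace hact (by omega) (by omega), ← add_smul]
      rw [show i + 1 + j = j + i + 1 by ring, pow_succ]
      simp
    · simp only [hij, if_false]
      rw [← wordFace_wordFace hact (by omega) (by omega), ← add_smul]
      rw [show j + 1 + i = i + j + 1 by ring, pow_succ]
      simp
  · rintro ⟨i, j⟩ h _
    dsimp only
    split_ifs with hij <;> simp <;> omega
  · rintro ⟨i, j⟩ h
    simp only [Finset.mem_product, Finset.mem_range] at h ⊢
    split_ifs with hij <;> simp <;> omega
  · rintro ⟨i, j⟩ h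
    dsimp only
    split_ifs <;> simp at * <;> omega

end Faces

/-! ### The idempotent on Hochschild chains and cochains. -/

section Chains

variable {A : Type u} [NonUnitalNormedCommRing A] [NormedSpace ℂ A]
  [IsScalarTower ℂ A A] [SMulCommClass ℂ A A]
variable {M : Type v} [NormedAddCommGroup M] [NormedSpace ℂ M]
variable {M' : Type w} [NormedAddCommGroup M'] [NormedSpace ℂ M']

lemma groupAlgChain_elem {n : ℕ} (e : MonoidAlgebra ℚ (Equiv.Perm (Fin n))) (x : M)
    (a : Fin n → A) :
    groupAlgChain A M e (elem A M n x a) = permOp e (fun b => elem A M n x b) a := by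
  simp [groupAlgChain, permOp, permChain_elem]

lemma groupAlgCochain_eq {n : ℕ} (e : MonoidAlgebra ℚ (Equiv.Perm (Fin n)))
    (ψ : Cochain A M n) (a : Fin n → A) :
    groupAlgCochain A M e ψ a = permOp e (fun b => ψ b) a := groupAlgCochain_apply A M e ψ a

lemma clm_permOp {n : ℕ} {G H : Type*} [AddCommGroup G] [Module ℂ G] [AddCommGroup H] [Module ℂ H]
    {X : Type*} (F : G →ₗ[ℂ] H) (e : MonoidAlgebra ℚ (Equiv.Perm (Fin n))) (φ : (Fin n → X) → G)
    (a : Fin n → X) : F (permOp e φ a) = permOp e (fun b => F (φ b)) a := by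
  simp [permOp]

lemma groupAlgChain_one {n : ℕ} : groupAlgChain A M (n := n) 1 = ContinuousLinearMap.id ℂ _ :=
  chain_ext fun x a => by rw [groupAlgChain_elem, permOp_one]; rfl

lemma groupAlgChain_mul {n : ℕ} (e e' : MonoidAlgebra ℚ (Equiv.Perm (Fin n)))
    (z : Chain A M n) :
    groupAlgChain A M e (groupAlgChain A M e' z) = groupAlgChain A M (e * e') z := by
  suffices H : groupAlgChain A M e ∘L groupAlgChain A M e' = groupAlgChain A M (e * e') from
    DFunLike.congr_fun H z
  refine chain_ext fun x a => ?_
  rw [ContinuousLinearMap.comp_apply, groupAlgChain_elem, groupAlgChain_elem, permOp_mul]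
  rw [← ContinuousLinearMap.coe_coe, clm_permOp]
  simp only [ContinuousLinearMap.coe_coe, groupAlgChain_elem]

lemma groupAlgCochain_mul {n : ℕ} (e e' : MonoidAlgebra ℚ (Equiv.Perm (Fin n)))
    (ψ : Cochain A M n) :
    groupAlgCochain A M e' (groupAlgCochain A M e ψ) = groupAlgCochain A M (e * e') ψ := by
  ext a
  simp only [groupAlgCochain_eq, permOp_mul]

lemma bgsChain_idem {n : ℕ} (hn : 0 < n) (z : Chain A M n) :
    groupAlgChain A M (bgs n 1) (groupAlgChain A M (bgs n 1) z) =
      groupAlgChain A M (bgs n 1) z := by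
  rw [groupAlgChain_mul, bgs_mul_self hn]

lemma bgsCochain_idem {n : ℕ} (hn : 0 < n) (ψ : Cochain A M n) :
    groupAlgCochain A M (bgs n 1) (groupAlgCochain A M (bgs n 1) ψ) =
      groupAlgCochain A M (bgs n 1) ψ := by
  rw [groupAlgCochain_mul, bgs_mul_self hn]

lemma mem_harrChain {n : ℕ} (hn : 0 < n) {z : Chain A M n} :
    z ∈ harrChain A M n ↔ groupAlgChain A M (bgs n 1) z = z :=
  ⟨by rintro ⟨y, rfl⟩; exact bgsChain_idem hn y, fun h => ⟨z, h⟩⟩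

lemma mem_harrCochain {n : ℕ} (hn : 0 < n) {ψ : Cochain A M n} :
    ψ ∈ harrCochain A M n ↔ groupAlgCochain A M (bgs n 1) ψ = ψ :=
  ⟨by rintro ⟨y, rfl⟩; exact bgsCochain_idem hn y, fun h => ⟨ψ, h⟩⟩

lemma harrChain_one : harrChain A M 1 = ⊤ := by
  rw [eq_top_iff]
  intro z _
  rw [mem_harrChain one_pos, bgs_one, groupAlgChain_one]
  rfl

/-- The summand is the fixed space of a bounded idempotent. Closedness makes it a Banach space. -/
lemma isClosed_harrChain {n : ℕ} (hn : 0 < n) : IsClosed (harrChain A M n : Set (Chain A M n)) := by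
  have : (harrChain A M n : Set (Chain A M n)) = {z | groupAlgChain A M (bgs n 1) z = z} :=
    Set.ext fun z => mem_harrChain hn
  rw [this]
  exact isClosed_eq (ContinuousLinearMap.continuous _) continuous_id

variable [BiBMod A M]

lemma bd_elem (hM : IsSymmBMod A M) {n : ℕ} (x : M) (a : Fin (n + 1) → A) :
    bd A M n (elem A M (n + 1) x a) =
      hdiff (fun c b => elem A M n (LeftBMod.lact c x) b) (fun b => elem A M n x b) a := by
  simp [bd, hdiff, faceFirst_elem, faceMid_elem, faceLast_elem, hM (a 0) x]

/-- `x a - a x = 0` in a symmetric bimodule, so every 1-chain is a cycle and `H_1` is a cokernel. -/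
lemma bd_zero (hM : IsSymmBMod A M) (z : Chain A M 1) : bd A M 0 z = 0 := by
  suffices H : bd A M 0 = 0 from DFunLike.congr_fun H z
  refine chain_ext fun x a => ?_
  rw [bd_elem hM, hdiff]
  have : (fun i : Fin 0 => a i.succ) = fun i => a i.castSucc := funext fun i => i.elim0
  simp [this]

lemma cobd_eq_hdiff (hM : IsSymmBMod A M) {n : ℕ} (ψ : Cochain A M n) (a : Fin (n + 1) → A) :
    cobd A M n ψ a = hdiff (fun c b => LeftBMod.lact c (ψ b)) (fun b => ψ b) a := by
  simp [cobd_apply, hdiff, hM (a (Fin.last n))]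

/-- This is `permOp_bgs_hdiff` for the universal multilinear map `a ↦ x ⊗ a`, whose outer faces are
`c, b ↦ c x ⊗ b`. -/
lemma bd_bgs (hM : IsSymmBMod A M) {n : ℕ} (hn : 0 < n) (z : Chain A M (n + 1)) :
    bd A M n (groupAlgChain A M (bgs (n + 1) 1) z) = groupAlgChain A M (bgs n 1) (bd A M n z) := by
  suffices H : bd A M n ∘L groupAlgChain A M (bgs (n + 1) 1) =
      groupAlgChain A M (bgs n 1) ∘L bd A M n from DFunLike.congr_fun H z
  refine chain_ext fun x a => ?_
  rw [ContinuousLinearMap.comp_apply, ContinuousLinearMap.comp_apply, groupAlgChain_elem,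
    ← ContinuousLinearMap.coe_coe (bd A M n), clm_permOp]
  simp only [ContinuousLinearMap.coe_coe, bd_elem hM]
  rw [show (fun b => hdiff (fun c b => elem A M n (LeftBMod.lact c x) b)
    (fun b => elem A M n x b) b) = hdiff (fun c b => elem A M n (LeftBMod.lact c x) b)
    (fun b => elem A M n x b) from rfl, permOp_bgs_hdiff hn]
  simp only [hdiff, map_add, map_sum, map_smul, groupAlgChain_elem]

lemma cobd_bgs (hM : IsSymmBMod A M) {n : ℕ} (hn : 0 < n) (ψ : Cochain A M n) :
    cobd A M n (groupAlgCochain A M (bgs n 1) ψ) =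
      groupAlgCochain A M (bgs (n + 1) 1) (cobd A M n ψ) := by
  ext a
  rw [groupAlgCochain_eq, cobd_eq_hdiff hM]
  simp only [cobd_eq_hdiff hM]
  rw [show (fun b => hdiff (fun c b => LeftBMod.lact c (ψ b)) (fun b => ψ b) b) =
    hdiff (fun c b => LeftBMod.lact c (ψ b)) (fun b => ψ b) from rfl, permOp_bgs_hdiff hn]
  simp only [groupAlgCochain_eq]
  congr 1
  ext c b
  rw [← ContinuousLinearMap.coe_coe (LeftBMod.lact c), clm_permOp]

lemma bd_mem_harrChain (hM : IsSymmBMod A M) {n : ℕ} (hn : 0 < n) {z : Chain A M (n + 1)}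
    (hz : z ∈ harrChain A M (n + 1)) : bd A M n z ∈ harrChain A M n := by
  rw [mem_harrChain (Nat.succ_pos n)] at hz
  rw [mem_harrChain hn, ← bd_bgs hM hn, hz]

lemma bd_elem_eq_sum (hM : IsSymmBMod A M) {n : ℕ} (p : M × (Fin (n + 1) → A)) :
    bd A M n (elem A M (n + 1) p.1 p.2) = ∑ i ∈ Finset.range (n + 2), (-1 : ℂ) ^ i •
      elem A M n (wordFace (fun c x => LeftBMod.lact c x) i p).1
        (wordFace (fun c x => LeftBMod.lact c x) i p).2 := by
  rw [bd_elem hM, hdiff, Finset.sum_range_succ', Finset.sum_range_succ, Finset.sum_range]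
  have hmid : ∀ j : Fin n, (-1 : ℂ) ^ ((j : ℕ) + 1) • elem A M n p.1 (merge j p.2) =
      (-1 : ℂ) ^ ((j : ℕ) + 1) •
        elem A M n (wordFace (fun c x => LeftBMod.lact c x) ((j : ℕ) + 1) p).1
        (wordFace (fun c x => LeftBMod.lact c x) ((j : ℕ) + 1) p).2 := by
    intro j
    have h1 : (j : ℕ) ≠ n := j.2.ne
    simp only [wordFace, Nat.add_eq_zero_iff, one_ne_zero, and_false, if_false,
      Nat.add_right_cancel_iff, h1]
    congr 2
    ext k
    simp only [merge, Fin.lt_def, Fin.ext_iff, Nat.add_lt_add_iff_right]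
    split_ifs with h2 h3 <;> first | rfl | (have : k = j := Fin.ext h3; subst this; rfl)
  rw [Finset.sum_congr rfl fun j _ => hmid j]
  have hlast : (wordFace (fun c x => LeftBMod.lact c x) (n + 1) p) =
      (LeftBMod.lact (p.2 (Fin.last n)) p.1, fun i => p.2 i.castSucc) := by
    simp [wordFace]
  have hfirst : (wordFace (fun c x => LeftBMod.lact c x) 0 p) =
      (LeftBMod.lact (p.2 0) p.1, fun i => p.2 i.succ) := by
    simp [wordFace]
  rw [hlast, hfirst, pow_zero, one_smul]
  abel

lemma bd_bd (hM : IsSymmBMod A M) {n : ℕ} (z : Chain A M (n + 2)) :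
    bd A M n (bd A M (n + 1) z) = 0 := by
  suffices H : bd A M n ∘L bd A M (n + 1) = 0 from DFunLike.congr_fun H z
  refine chain_ext fun x a => ?_
  rw [ContinuousLinearMap.comp_apply, bd_elem_eq_sum hM (x, a), map_sum]
  simp only [map_smul, bd_elem_eq_sum hM, Finset.smul_sum, smul_smul, ← pow_add]
  exact sum_wordFace_wordFace (fun a b x => LeftBMod.lact_mul a b x)
    (fun p => elem A M n p.1 p.2) (x, a)

end Chains

/-! ### Homotopy equivalences and seminormed homology. -/

section SubQuot

variable {V : Type u} [SeminormedAddCommGroup V] [NormedSpace ℂ V]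
  {W : Type v} [SeminormedAddCommGroup W] [NormedSpace ℂ W]

/-- The map induced on subquotients by a continuous linear map. -/
def subQuotMap {Z Y : Submodule ℂ V} {Z' Y' : Submodule ℂ W} (f : V →ₗ[ℂ] W) (hf : Continuous f)
    (hZ : ∀ z ∈ Z, f z ∈ Z') (hY : ∀ z ∈ Z, z ∈ Y → f z ∈ Y') : SubQuot Z Y →L[ℂ] SubQuot Z' Y' :=
  (Y.submoduleOf Z).liftQL
    ((Y'.submoduleOf Z').mkQL ∘L ⟨f.restrict hZ, (hf.comp continuous_subtype_val).subtype_mk _⟩)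
    (fun z hz => (Submodule.Quotient.mk_eq_zero _).2 (hY z.1 z.2 hz))

/-- Maps of complexes that are mutually inverse up to homotopy induce an isomorphism of the
seminormed homology spaces. -/
def subQuotEquiv {Z Y : Submodule ℂ V} {Z' Y' : Submodule ℂ W} (f : V →ₗ[ℂ] W) (g : W →ₗ[ℂ] V)
    (hf : Continuous f) (hg : Continuous g) (hfZ : ∀ z ∈ Z, f z ∈ Z') (hgZ : ∀ z ∈ Z', g z ∈ Z)
    (hfY : ∀ z ∈ Z, z ∈ Y → f z ∈ Y') (hgY : ∀ z ∈ Z', z ∈ Y' → g z ∈ Y)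
    (hgf : ∀ z ∈ Z, g (f z) - z ∈ Y) (hfg : ∀ z ∈ Z', f (g z) - z ∈ Y') :
    SubQuot Z Y ≃L[ℂ] SubQuot Z' Y' :=
  ContinuousLinearEquiv.equivOfInverse (subQuotMap f hf hfZ hfY) (subQuotMap g hg hgZ hgY)
    (fun q => by
      obtain ⟨z, rfl⟩ := Submodule.Quotient.mk_surjective _ q
      exact (Submodule.Quotient.eq _).2 (hgf z.1 z.2))
    (fun q => by
      obtain ⟨z, rfl⟩ := Submodule.Quotient.mk_surjective _ q
      exact (Submodule.Quotient.eq _).2 (hfg z.1 z.2))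

end SubQuot

/-! ### Invariant subspaces and module maps. -/

section Submodules

variable {B : Type u} [NonUnitalNormedCommRing B] [NormedSpace ℂ B]
  {E : Type v} [SeminormedAddCommGroup E] [NormedSpace ℂ E] [LeftBMod B E]

/-- The left module structure of an invariant subspace. -/
@[reducible] def subspaceMod (K : Submodule ℂ E) (hK : ∀ b : B, ∀ z ∈ K, LeftBMod.lact b z ∈ K) :
    LeftBMod B K where
  lact := LinearMap.mkContinuous₂
    (LinearMap.mk₂ ℂ (fun (b : B) (z : K) => (⟨LeftBMod.lact b z.1, hK b z.1 z.2⟩ : K))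
      (fun a b z => Subtype.ext (by simp)) (fun c b z => Subtype.ext (by simp))
      (fun b y z => Subtype.ext (by simp)) (fun c b z => Subtype.ext (by simp)))
    ‖LeftBMod.lact (B := B) (E := E)‖
    (fun b z => (LeftBMod.lact (B := B) (E := E)).le_opNorm₂ b z.1)
  lact_mul a b z := Subtype.ext (LeftBMod.lact_mul a b z.1)

variable {F : Type w} [SeminormedAddCommGroup F] [NormedSpace ℂ F] [LeftBMod B F]

lemma IsModMap.comp {G : Type*} [SeminormedAddCommGroup G] [NormedSpace ℂ G] [LeftBMod B G]
    {g : F →L[ℂ] G} {f : E →L[ℂ] F} (hg : IsModMap B g) (hf : IsModMap B f) :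
    IsModMap B (g ∘L f) := fun b x => by simp [hf b x, hg b (f x)]

lemma IsModMap.sub {g f : E →L[ℂ] F} (hg : IsModMap B g) (hf : IsModMap B f) :
    IsModMap B (g - f) := fun b x => by simp [hf b x, hg b x]

lemma IsModMap.add {g f : E →L[ℂ] F} (hg : IsModMap B g) (hf : IsModMap B f) :
    IsModMap B (g + f) := fun b x => by simp [hf b x, hg b x]

lemma IsModMap.id : IsModMap B (ContinuousLinearMap.id ℂ E) := fun _ _ => rfl

end Submodules

/-! ### The comparison theorem for admissible resolutions. -/

section Comparison

variable {B : Type u} [NonUnitalNormedCommRing B] [NormedSpace ℂ B]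

/-- Module maps out of a projective module lift along exact admissible sequences. -/
lemma LeftBanachModule.IsProjective.lift_exact {P : LeftBanachModule.{u} B} (hP : P.IsProjective)
    {Y Z : LeftBanachModule.{u} B} {W : Type u} [SeminormedAddCommGroup W] [NormedSpace ℂ W]
    [LeftBMod B W] [T2Space W] {d : Y.carrier →L[ℂ] Z.carrier} {d' : Z.carrier →L[ℂ] W}
    (hd : IsModMap B d) (hd' : IsModMap B d') (hdd : d' ∘L d = 0) (s : Z.carrier →L[ℂ] Y.carrier)
    (s' : W →L[ℂ] Z.carrier) (hs : s' ∘L d' + d ∘L s = ContinuousLinearMap.id ℂ _)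
    {φ : P.carrier →L[ℂ] Z.carrier} (hφ : IsModMap B φ) (hφd : d' ∘L φ = 0) :
    ∃ ψ : P.carrier →L[ℂ] Y.carrier, IsModMap B ψ ∧ d ∘L ψ = φ := by
  -- On this kernel the homotopy identity reduces to `d ∘ s = id`, so `d` becomes an admissible
  -- surjection onto `K`. `K` is complete because `W` is Hausdorff.
  let K : Submodule ℂ Z.carrier := LinearMap.ker d'.toLinearMap
  have hKc : IsClosed (K : Set Z.carrier) := isClosed_singleton.preimage d'.continuous
  have hK : ∀ b : B, ∀ z ∈ K, LeftBMod.lact b z ∈ K := fun b z hz => by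
    have hz : d' z = 0 := hz
    change d' _ = 0
    rw [hd', hz, map_zero]
  let := subspaceMod K hK
  have : CompleteSpace K := hKc.completeSpace_coe
  let KM : LeftBanachModule.{u} B := ⟨K⟩
  let σ : Y.carrier →L[ℂ] K := d.codRestrict K fun y => DFunLike.congr_fun hdd y
  let φ' : P.carrier →L[ℂ] K := φ.codRestrict K fun y => DFunLike.congr_fun hφd y
  obtain ⟨ψ, hψ, h⟩ := hP Y KM σ (s ∘L K.subtypeL) φ' (fun b y => Subtype.ext (hd b y))
    (by
      ext z
      have hz : d' z.1 = 0 := z.2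
      have := DFunLike.congr_fun hs z.1
      change d (s z.1) = z.1
      simpa [hz] using this) (fun b y => Subtype.ext (hφ b y))
  refine ⟨ψ, hψ, ?_⟩
  ext x
  exact congrArg Subtype.val (DFunLike.congr_fun h x)

variable {N : Type u} [SeminormedAddCommGroup N] [NormedSpace ℂ N] [LeftBMod B N]
  [T2Space N] [CompleteSpace N]

lemma AdmissibleResolution.exists_lift_aug (P Q : AdmissibleResolution B N) :
    ∃ F : (P.obj 0).carrier →L[ℂ] (Q.obj 0).carrier, IsModMap B F ∧ Q.aug ∘L F = P.aug := by
  -- Projectivity only tests Banach modules; the Hausdorff seminormed space `N` is one.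
  let I : NormedAddCommGroup N := NormedAddCommGroup.ofSeparation fun x hx =>
    ((Metric.inseparable_iff.2 (by rw [dist_zero_right]; exact hx) : Inseparable x 0)).eq
  let NM : LeftBanachModule.{u} B := ⟨N⟩
  obtain ⟨s₀, s, h, -⟩ := Q.split
  exact P.projective 0 (Q.obj 0) NM Q.aug s₀ P.aug Q.aug_mod h P.aug_mod

lemma AdmissibleResolution.lift_one (Q : AdmissibleResolution B N)
    {R : LeftBanachModule.{u} B} (hR : R.IsProjective) {φ : R.carrier →L[ℂ] (Q.obj 0).carrier}
    (hφ : IsModMap B φ) (h : Q.aug ∘L φ = 0) :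
    ∃ ψ : R.carrier →L[ℂ] (Q.obj 1).carrier, IsModMap B ψ ∧ Q.d 0 ∘L ψ = φ := by
  obtain ⟨s₀, s, -, h1, -⟩ := Q.split
  exact hR.lift_exact (Q.d_mod 0) Q.aug_mod Q.aug_d (s 0) s₀ h1 hφ h

lemma AdmissibleResolution.lift_succ (Q : AdmissibleResolution B N)
    {R : LeftBanachModule.{u} B} (hR : R.IsProjective) {n : ℕ}
    {φ : R.carrier →L[ℂ] (Q.obj (n + 1)).carrier} (hφ : IsModMap B φ) (h : Q.d n ∘L φ = 0) :
    ∃ ψ : R.carrier →L[ℂ] (Q.obj (n + 2)).carrier, IsModMap B ψ ∧ Q.d (n + 1) ∘L ψ = φ := by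
  obtain ⟨s₀, s, -, -, h1⟩ := Q.split
  exact hR.lift_exact (Q.d_mod (n + 1)) (Q.d_mod n) (Q.d_d n) (s (n + 1)) (s n) (h1 n) hφ h

/-- The comparison theorem: the identity of `N` lifts to a map of resolutions. -/
lemma AdmissibleResolution.exists_map (P Q : AdmissibleResolution B N) :
    ∃ F : ∀ n, (P.obj n).carrier →L[ℂ] (Q.obj n).carrier, (∀ n, IsModMap B (F n)) ∧
      Q.aug ∘L F 0 = P.aug ∧ ∀ n, Q.d n ∘L F (n + 1) = F n ∘L P.d n := by
  obtain ⟨F0, hF0, hF0a⟩ := P.exists_lift_aug Q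
  obtain ⟨F1, hF1, hF1d⟩ := Q.lift_one (P.projective 1) (hF0.comp (P.d_mod 0)) (by
    rw [← ContinuousLinearMap.comp_assoc, hF0a, P.aug_d])
  -- Two consecutive components are carried along, because the next lift exists only by virtue of
  -- their commuting square.
  let S (n : ℕ) : Type u := {p : ((P.obj n).carrier →L[ℂ] (Q.obj n).carrier) ×
    ((P.obj (n + 1)).carrier →L[ℂ] (Q.obj (n + 1)).carrier) //
      IsModMap B p.1 ∧ IsModMap B p.2 ∧ Q.d n ∘L p.2 = p.1 ∘L P.d n}
  have step : ∀ n (x : S n), ∃ y : S (n + 1), y.1.1 = x.1.2 := by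
    rintro n ⟨⟨f, g⟩, hf, hg, h⟩
    obtain ⟨k, hk, hkd⟩ := Q.lift_succ (P.projective (n + 2)) (hg.comp (P.d_mod (n + 1))) (by
      rw [← ContinuousLinearMap.comp_assoc, h, ContinuousLinearMap.comp_assoc, P.d_d,
        ContinuousLinearMap.comp_zero])
    exact ⟨⟨(g, k), hg, hk, hkd⟩, rfl⟩
  choose next hnext using step
  let T (n : ℕ) : S n := Nat.rec ⟨(F0, F1), hF0, hF1, hF1d⟩ (fun n x => next n x) n
  refine ⟨fun n => (T n).1.1, fun n => (T n).2.1, hF0a, fun n => ?_⟩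
  have h : (T (n + 1)).1.1 = (T n).1.2 := hnext n (T n)
  exact (congrArg (Q.d n ∘L ·) h).trans (T n).2.2.2

lemma AdmissibleResolution.exists_homotopy (P Q : AdmissibleResolution B N)
    (F : ∀ n, (P.obj n).carrier →L[ℂ] (Q.obj n).carrier) (hF : ∀ n, IsModMap B (F n))
    (hFa : Q.aug ∘L F 0 = 0) (hFd : ∀ n, Q.d n ∘L F (n + 1) = F n ∘L P.d n) :
    ∃ h : ∀ n, (P.obj n).carrier →L[ℂ] (Q.obj (n + 1)).carrier, (∀ n, IsModMap B (h n)) ∧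
      Q.d 0 ∘L h 0 = F 0 ∧ ∀ n, Q.d (n + 1) ∘L h (n + 1) + h n ∘L P.d n = F (n + 1) := by
  obtain ⟨h0, hh0, hh0d⟩ := Q.lift_one (P.projective 0) (hF 0) hFa
  -- The recorded identity says that `F (n + 1) - h n ∘ d` lands in the kernel of the differential,
  -- as the next lift requires.
  let S (n : ℕ) : Type u := {p : (P.obj n).carrier →L[ℂ] (Q.obj (n + 1)).carrier //
      IsModMap B p ∧ Q.d n ∘L p ∘L P.d n = F n ∘L P.d n}
  have step : ∀ n (x : S n), ∃ y : S (n + 1), Q.d (n + 1) ∘L y.1 + x.1 ∘L P.d n = F (n + 1) := by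
    rintro n ⟨f, hf, h⟩
    obtain ⟨k, hk, hkd⟩ := Q.lift_succ (P.projective (n + 1))
      ((hF (n + 1)).sub (hf.comp (P.d_mod n))) (by
      rw [ContinuousLinearMap.comp_sub, h, hFd, sub_self])
    refine ⟨⟨k, hk, ?_⟩, ?_⟩
    · rw [← ContinuousLinearMap.comp_assoc, hkd, ContinuousLinearMap.sub_comp,
        ContinuousLinearMap.comp_assoc, P.d_d, ContinuousLinearMap.comp_zero, sub_zero]
    · rw [hkd, sub_add_cancel]
  choose next hnext using step
  let T (n : ℕ) : S n := Nat.rec ⟨h0, hh0, by rw [← ContinuousLinearMap.comp_assoc, hh0d]⟩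
    (fun n x => next n x) n
  exact ⟨fun n => (T n).1, fun n => (T n).2.1, hh0d, fun n => hnext n (T n)⟩

/-- Any two endomorphisms of a resolution over the identity, one of them the identity, are
homotopic. -/
lemma AdmissibleResolution.exists_homotopy_id (P Q : AdmissibleResolution B N)
    {F : ∀ n, (P.obj n).carrier →L[ℂ] (Q.obj n).carrier} (hF : ∀ n, IsModMap B (F n))
    (hFa : Q.aug ∘L F 0 = P.aug) (hFd : ∀ n, Q.d n ∘L F (n + 1) = F n ∘L P.d n)
    {G : ∀ n, (Q.obj n).carrier →L[ℂ] (P.obj n).carrier} (hG : ∀ n, IsModMap B (G n))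
    (hGa : P.aug ∘L G 0 = Q.aug) (hGd : ∀ n, P.d n ∘L G (n + 1) = G n ∘L Q.d n) :
    ∃ h : ∀ n, (P.obj n).carrier →L[ℂ] (P.obj (n + 1)).carrier, (∀ n, IsModMap B (h n)) ∧
      P.d 0 ∘L h 0 = G 0 ∘L F 0 - ContinuousLinearMap.id ℂ _ ∧
      ∀ n, P.d (n + 1) ∘L h (n + 1) + h n ∘L P.d n =
        G (n + 1) ∘L F (n + 1) - ContinuousLinearMap.id ℂ _ := by
  refine P.exists_homotopy P (fun n => G n ∘L F n - ContinuousLinearMap.id ℂ _)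
    (fun n => ((hG n).comp (hF n)).sub IsModMap.id) ?_ fun n => ?_
  · rw [ContinuousLinearMap.comp_sub, ← ContinuousLinearMap.comp_assoc, hGa, hFa,
      ContinuousLinearMap.comp_id, sub_self]
  · rw [ContinuousLinearMap.comp_sub, ← ContinuousLinearMap.comp_assoc, hGd,
      ContinuousLinearMap.comp_assoc, hFd, ContinuousLinearMap.sub_comp,
      ContinuousLinearMap.comp_assoc, ContinuousLinearMap.comp_id, ContinuousLinearMap.id_comp]

end Comparison

/-! ### Independence of `Ext` from the resolution. -/

section Ext

variable {B : Type u} [NonUnitalNormedCommRing B] [NormedSpace ℂ B]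
  {N : Type u} [SeminormedAddCommGroup N] [NormedSpace ℂ N] [LeftBMod B N]

lemma precomp_ext (X : Type v) [NormedAddCommGroup X] [NormedSpace ℂ X] [LeftBMod B X]
    {P Q : AdmissibleResolution B N}
    {G : ∀ n, (Q.obj n).carrier →L[ℂ] (P.obj n).carrier} (hG : ∀ n, IsModMap B (G n))
    (hGd : ∀ n, P.d n ∘L G (n + 1) = G n ∘L Q.d n) (n : ℕ) :
    (∀ φ ∈ homMod P X n ⊓ LinearMap.ker (codiff P X n),
      φ ∘L G n ∈ homMod Q X n ⊓ LinearMap.ker (codiff Q X n)) ∧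
    ∀ φ ∈ extCoboundaries P X n, φ ∘L G n ∈ extCoboundaries Q X n := by
  constructor
  · rintro φ ⟨h1, h2⟩
    have h1 : IsModMap B φ := h1
    have h2 : φ ∘L P.d n = 0 := h2
    refine ⟨h1.comp (hG n), ?_⟩
    change (φ ∘L G n) ∘L Q.d n = 0
    rw [ContinuousLinearMap.comp_assoc, ← hGd, ← ContinuousLinearMap.comp_assoc, h2,
      ContinuousLinearMap.zero_comp]
  · intro φ hφ
    cases n with
    | zero =>
      have hφ : φ = 0 := hφ
      rw [hφ, ContinuousLinearMap.zero_comp]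
      exact Submodule.zero_mem _
    | succ n =>
      obtain ⟨ψ, hψ, rfl⟩ := hφ
      have hψ : IsModMap B ψ := hψ
      refine ⟨ψ ∘L G n, hψ.comp (hG n), ?_⟩
      change (ψ ∘L G n) ∘L Q.d n = (ψ ∘L P.d n) ∘L G (n + 1)
      rw [ContinuousLinearMap.comp_assoc, ContinuousLinearMap.comp_assoc, hGd]

lemma homotopy_ext (X : Type v) [NormedAddCommGroup X] [NormedSpace ℂ X] [LeftBMod B X]
    {P : AdmissibleResolution B N}
    {F : ∀ n, (P.obj n).carrier →L[ℂ] (P.obj n).carrier}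
    {h : ∀ n, (P.obj n).carrier →L[ℂ] (P.obj (n + 1)).carrier} (hh : ∀ n, IsModMap B (h n))
    (h0 : P.d 0 ∘L h 0 = F 0 - ContinuousLinearMap.id ℂ _)
    (hs : ∀ n, P.d (n + 1) ∘L h (n + 1) + h n ∘L P.d n = F (n + 1) - ContinuousLinearMap.id ℂ _)
    (n : ℕ) : ∀ φ ∈ homMod P X n ⊓ LinearMap.ker (codiff P X n),
      φ ∘L F n - φ ∈ extCoboundaries P X n := by
  rintro φ ⟨h1, h2⟩
  have h1 : IsModMap B φ := h1
  have h2 : φ ∘L P.d n = 0 := h2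
  cases n with
  | zero =>
    have : φ ∘L F 0 - φ = φ ∘L (F 0 - ContinuousLinearMap.id ℂ _) := by
      rw [ContinuousLinearMap.comp_sub, ContinuousLinearMap.comp_id]
    rw [this, ← h0, ← ContinuousLinearMap.comp_assoc, h2, ContinuousLinearMap.zero_comp]
    exact Submodule.zero_mem _
  | succ n =>
    have : φ ∘L F (n + 1) - φ = φ ∘L (F (n + 1) - ContinuousLinearMap.id ℂ _) := by
      rw [ContinuousLinearMap.comp_sub, ContinuousLinearMap.comp_id]
    rw [this, ← hs, ContinuousLinearMap.comp_add, ← ContinuousLinearMap.comp_assoc, h2,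
      ContinuousLinearMap.zero_comp, zero_add]
    exact ⟨φ ∘L h n, h1.comp (hh n), rfl⟩

variable [T2Space N] [CompleteSpace N]

/-- `Ext` does not depend on the resolution. -/
theorem nonempty_extOf_equiv (P Q : AdmissibleResolution B N) (X : Type v) [NormedAddCommGroup X]
    [NormedSpace ℂ X] [LeftBMod B X] (n : ℕ) : Nonempty (ExtOf P X n ≃L[ℂ] ExtOf Q X n) := by
  obtain ⟨F, hF, hFa, hFd⟩ := P.exists_map Q
  obtain ⟨G, hG, hGa, hGd⟩ := Q.exists_map P
  obtain ⟨h, hh, h0, hs⟩ := P.exists_homotopy_id Q hF hFa hFd hG hGa hGd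
  obtain ⟨k, hk, k0, ks⟩ := Q.exists_homotopy_id P hG hGa hGd hF hFa hFd
  obtain ⟨g1, g2⟩ := precomp_ext X hG hGd n
  obtain ⟨f1, f2⟩ := precomp_ext X hF hFd n
  exact ⟨subQuotEquiv
    ((ContinuousLinearMap.compL ℂ (Q.obj n).carrier (P.obj n).carrier X).flip (G n)).toLinearMap
    ((ContinuousLinearMap.compL ℂ (P.obj n).carrier (Q.obj n).carrier X).flip (F n)).toLinearMap
    (ContinuousLinearMap.continuous _) (ContinuousLinearMap.continuous _) g1 f1
    (fun φ _ => g2 φ) (fun φ _ => f2 φ)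
    (homotopy_ext X (F := fun n => G n ∘L F n) hh h0 hs n)
    (homotopy_ext X (F := fun n => F n ∘L G n) hk k0 ks n)⟩

end Ext

/-! ### Balanced tensor products and independence of `Tor` from the resolution. -/

section Tor

variable {B : Type u} [NonUnitalNormedCommRing B] [NormedSpace ℂ B]
  (X : Type v) [NormedAddCommGroup X] [NormedSpace ℂ X] [RightBMod B X]
  {Y Y' Y'' : Type w} [NormedAddCommGroup Y] [NormedSpace ℂ Y] [LeftBMod B Y]
  [NormedAddCommGroup Y'] [NormedSpace ℂ Y'] [LeftBMod B Y']
  [NormedAddCommGroup Y''] [NormedSpace ℂ Y''] [LeftBMod B Y'']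

/-- The map `id ⊗̂_B f` of balanced tensor products. -/
def balMap (f : Y →L[ℂ] Y') (hf : IsModMap B f) : BalTensor B X Y →L[ℂ] BalTensor B X Y' :=
  (balancing B X Y).liftQL ((balancing B X Y').mkQL ∘L pmapRight X f) (fun _ hz =>
    (Submodule.Quotient.mk_eq_zero _).2 (balancing_le_comap X f hf hz))

/-- The image of `x ⊗ y` in the balanced tensor product. -/
def btmul : X →L[ℂ] Y →L[ℂ] BalTensor B X Y :=
  ContinuousLinearMap.compL ℂ Y _ _ (balancing B X Y).mkQL ∘L ptmul X Y

variable {X}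

lemma btmul_balanced (x : X) (b : B) (y : Y) :
    btmul (B := B) X (RightBMod.ract b x) y = btmul (B := B) X x (LeftBMod.lact b y) :=
  (Submodule.Quotient.eq _).2 (Submodule.le_topologicalClosure _ (Submodule.subset_span
    ⟨x, b, y, rfl⟩))

@[simp] lemma balMap_btmul (f : Y →L[ℂ] Y') (hf : IsModMap B f) (x : X) (y : Y) :
    balMap X f hf (btmul X x y) = btmul X x (f y) := by
  change Submodule.Quotient.mk (pmapRight X f (ptmul X Y x y)) = _
  rw [pmapRight_ptmul]
  rfl

/-- Closedness makes the quotient seminorm a norm, so balanced tensor products can serve as targets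
of the extensionality and lifting lemmas. -/
instance isClosed_balancing : IsClosed (balancing B X Y : Set (ProjTensor X Y)) :=
  Submodule.isClosed_topologicalClosure _

lemma balTensor_ext {G : Type*} [NormedAddCommGroup G] [NormedSpace ℂ G]
    [CompleteSpace G] {f g : BalTensor B X Y →L[ℂ] G}
    (h : ∀ x y, f (btmul X x y) = g (btmul X x y)) : f = g := by
  have : f ∘L (balancing B X Y).mkQL = g ∘L (balancing B X Y).mkQL := ptensor_ext h
  ext q
  obtain ⟨z, rfl⟩ := Submodule.Quotient.mk_surjective _ q
  exact DFunLike.congr_fun this z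

lemma balMap_comp (f : Y →L[ℂ] Y') (hf : IsModMap B f) (g : Y' →L[ℂ] Y'') (hg : IsModMap B g) :
    balMap X g hg ∘L balMap X f hf = balMap X (g ∘L f) (hg.comp hf) :=
  balTensor_ext fun x y => by simp

lemma balMap_add (f g : Y →L[ℂ] Y') (hf : IsModMap B f) (hg : IsModMap B g) :
    balMap X f hf + balMap X g hg = balMap X (f + g) (hf.add hg) :=
  balTensor_ext fun x y => by simp

lemma balMap_sub_id (f : Y →L[ℂ] Y) (hf : IsModMap B f) :
    balMap X f hf - ContinuousLinearMap.id ℂ _ =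
      balMap X (f - ContinuousLinearMap.id ℂ Y) (hf.sub IsModMap.id) :=
  balTensor_ext fun x y => by simp

variable {N : Type u} [SeminormedAddCommGroup N] [NormedSpace ℂ N] [LeftBMod B N]

lemma torDiff_apply (P : AdmissibleResolution B N) (n : ℕ)
    (z : BalTensor B X (P.obj (n + 1)).carrier) :
    torDiff P X n z = balMap X (P.d n) (P.d_mod n) z := by
  obtain ⟨z, rfl⟩ := Submodule.Quotient.mk_surjective _ z
  rfl

lemma balMap_congr {f g : Y →L[ℂ] Y'} (h : f = g) (hf : IsModMap B f) (hg : IsModMap B g)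
    (z : BalTensor B X Y) : balMap X f hf z = balMap X g hg z := by
  subst h
  rfl

lemma map_tor {P Q : AdmissibleResolution B N}
    {G : ∀ n, (P.obj n).carrier →L[ℂ] (Q.obj n).carrier} (hG : ∀ n, IsModMap B (G n))
    (hGd : ∀ n, Q.d n ∘L G (n + 1) = G n ∘L P.d n) (n : ℕ) :
    (∀ z ∈ torCycles P X n, balMap X (G n) (hG n) z ∈ torCycles Q X n) ∧
    ∀ z ∈ LinearMap.range (torDiff P X n),
      balMap X (G n) (hG n) z ∈ LinearMap.range (torDiff Q X n) := by
  have hc : ∀ n z, torDiff Q X n (balMap X (G (n + 1)) (hG (n + 1)) z) =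
      balMap X (G n) (hG n) (torDiff P X n z) := by
    intro n z
    rw [torDiff_apply, torDiff_apply, ← ContinuousLinearMap.comp_apply, balMap_comp,
      ← ContinuousLinearMap.comp_apply, balMap_comp]
    exact balMap_congr (hGd n) _ _ z
  constructor
  · intro z hz
    cases n with
    | zero => trivial
    | succ n =>
      have hz : torDiff P X n z = 0 := hz
      change torDiff Q X n _ = 0
      rw [hc, hz, map_zero]
  · rintro _ ⟨z, rfl⟩
    exact ⟨balMap X (G (n + 1)) (hG (n + 1)) z, hc n z⟩

lemma homotopy_tor {P : AdmissibleResolution B N}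
    {F : ∀ n, (P.obj n).carrier →L[ℂ] (P.obj n).carrier} (hF : ∀ n, IsModMap B (F n))
    {h : ∀ n, (P.obj n).carrier →L[ℂ] (P.obj (n + 1)).carrier} (hh : ∀ n, IsModMap B (h n))
    (h0 : P.d 0 ∘L h 0 = F 0 - ContinuousLinearMap.id ℂ _)
    (hs : ∀ n, P.d (n + 1) ∘L h (n + 1) + h n ∘L P.d n = F (n + 1) - ContinuousLinearMap.id ℂ _)
    (n : ℕ) : ∀ z ∈ torCycles P X n,
      balMap X (F n) (hF n) z - z ∈ LinearMap.range (torDiff P X n) := by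
  intro z hz
  refine ⟨balMap X (h n) (hh n) z, ?_⟩
  have h1 : balMap X (F n) (hF n) z - z = balMap X _ ((hF n).sub IsModMap.id) z :=
    DFunLike.congr_fun (balMap_sub_id (F n) (hF n)) z
  rw [h1, torDiff_apply, ← ContinuousLinearMap.comp_apply, balMap_comp]
  cases n with
  | zero => exact balMap_congr h0 _ _ z
  | succ n =>
    have hz : torDiff P X n z = 0 := hz
    rw [torDiff_apply] at hz
    rw [← balMap_congr (hs n) (((P.d_mod (n + 1)).comp (hh (n + 1))).add
      ((hh n).comp (P.d_mod n))), ← balMap_add _ _ ((P.d_mod (n + 1)).comp (hh (n + 1)))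
      ((hh n).comp (P.d_mod n)), _root_.add_apply, ← balMap_comp _ (P.d_mod n) _ (hh n),
      ContinuousLinearMap.comp_apply (balMap X (h n) (hh n)), hz, map_zero, add_zero]

variable [T2Space N] [CompleteSpace N]

variable (X) in
/-- `Tor` does not depend on the resolution. -/
theorem nonempty_torOf_equiv (P Q : AdmissibleResolution B N) (n : ℕ) :
    Nonempty (TorOf P X n ≃L[ℂ] TorOf Q X n) := by
  obtain ⟨F, hF, hFa, hFd⟩ := P.exists_map Q
  obtain ⟨G, hG, hGa, hGd⟩ := Q.exists_map P
  obtain ⟨h, hh, h0, hs⟩ := P.exists_homotopy_id Q hF hFa hFd hG hGa hGd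
  obtain ⟨k, hk, k0, ks⟩ := Q.exists_homotopy_id P hG hGa hGd hF hFa hFd
  obtain ⟨g1, g2⟩ := map_tor (X := X) hG hGd n
  obtain ⟨f1, f2⟩ := map_tor (X := X) hF hFd n
  refine ⟨subQuotEquiv (balMap X (F n) (hF n)).toLinearMap (balMap X (G n) (hG n)).toLinearMap
    (ContinuousLinearMap.continuous _) (ContinuousLinearMap.continuous _) f1 g1
    (fun z _ => f2 z) (fun z _ => g2 z) (fun z hz => ?_) (fun z hz => ?_)⟩
  · have := homotopy_tor (F := fun n => G n ∘L F n) (fun n => (hG n).comp (hF n)) hh h0 hs n z hz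
    rwa [← balMap_comp _ (hF n) _ (hG n)] at this
  · have := homotopy_tor (F := fun n => F n ∘L G n) (fun n => (hF n).comp (hG n)) hk k0 ks n z hz
    rwa [← balMap_comp _ (hG n) _ (hF n)] at this

end Tor

/-! ### Modules acted on by the conditional unitization. -/

section Unit

variable {B : Type u} [NonUnitalNormedCommRing B] [NormedSpace ℂ B]

variable (B) in
/-- A symmetric bimodule that behaves like the conditional unitization: its elements act on every
module as the sum of a scalar and an element of `B`, and it is generated by one element `gen`. -/
class IsCondUnital (U : Type u) [NormedAddCommGroup U] [NormedSpace ℂ U] [BiBMod B U] where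
  isSymm : IsSymmBMod B U
  scalarPart : U →L[ℂ] ℂ
  algPart : U →L[ℂ] B
  gen : U
  scalarPart_lact : ∀ (b : B) (u : U), scalarPart (LeftBMod.lact b u) = 0
  algPart_lact : ∀ (b : B) (u : U),
    algPart (LeftBMod.lact b u) = scalarPart u • b + b * algPart u
  expand : ∀ u : U, scalarPart u • gen + LeftBMod.lact (algPart u) gen = u
  act_unit : ∀ b : B, scalarPart gen • b + b * algPart gen = b
  cases : (scalarPart gen = 1 ∧ algPart gen = 0) ∨ ∃ e : B, ∀ b : B, e * b = b

open IsCondUnital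

variable {U : Type u} [NormedAddCommGroup U] [NormedSpace ℂ U] [BiBMod B U] [IsCondUnital B U]

variable (B U) in
/-- The action of the conditional unitization on a left module. -/
def unitAct (Y : Type v) [SeminormedAddCommGroup Y] [NormedSpace ℂ Y] [LeftBMod B Y] :
    U →L[ℂ] Y →L[ℂ] Y :=
  (scalarPart B).smulRight (ContinuousLinearMap.id ℂ Y) + LeftBMod.lact (B := B) (E := Y) ∘L algPart

variable {Y : Type v} [SeminormedAddCommGroup Y] [NormedSpace ℂ Y] [LeftBMod B Y]
  {Z : Type w} [SeminormedAddCommGroup Z] [NormedSpace ℂ Z] [LeftBMod B Z]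

lemma unitAct_apply (u : U) (y : Y) :
    unitAct B U Y u y = scalarPart B u • y + LeftBMod.lact (algPart u : B) y := by
  simp [unitAct]

lemma lact_comm (a b : B) (y : Y) :
    LeftBMod.lact a (LeftBMod.lact b y) = LeftBMod.lact b (LeftBMod.lact a y) := by
  rw [← LeftBMod.lact_mul, ← LeftBMod.lact_mul, mul_comm]

lemma unitAct_lact (b : B) (u : U) (y : Y) :
    unitAct B U Y (LeftBMod.lact b u) y = LeftBMod.lact b (unitAct B U Y u y) := by
  rw [unitAct_apply, unitAct_apply, scalarPart_lact, algPart_lact, zero_smul, zero_add]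
  simp [LeftBMod.lact_mul]

/-- On a module that is not unit-linked `gen` need not act as the identity, but the difference is
annihilated by `B`. -/
lemma lact_unitAct_gen (b : B) (y : Y) :
    LeftBMod.lact b (unitAct B U Y (gen B) y) = LeftBMod.lact b y := by
  rw [← unitAct_lact, unitAct_apply, scalarPart_lact, algPart_lact, act_unit, zero_smul,
    zero_add]

lemma IsModMap.unitAct {f : Y →L[ℂ] Z} (hf : IsModMap B f) (u : U) (y : Y) :
    f (BanachHarrison.unitAct B U Y u y) = BanachHarrison.unitAct B U Z u (f y) := by
  simp [unitAct_apply, hf (algPart u : B) y]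

lemma unitAct_isModMap (u : U) : IsModMap B (unitAct B U Y u) := fun b y => by
  simp [unitAct_apply, lact_comm b]

lemma unitAct_self (u : U) :
    unitAct B U U u (gen B) = u := by
  rw [unitAct_apply, expand]

end Unit

/-! ### Chains with coefficients in the unitization as relatively free modules. -/

section Free

open IsCondUnital

variable {B : Type u} [NonUnitalNormedCommRing B] [NormedSpace ℂ B]
  [IsScalarTower ℂ B B] [SMulCommClass ℂ B B]
variable {U : Type u} [NormedAddCommGroup U] [NormedSpace ℂ U] [BiBMod B U] [IsCondUnital B U]
variable {Y : Type v} [NormedAddCommGroup Y] [NormedSpace ℂ Y] [LeftBMod B Y] [CompleteSpace Y]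
  {Z : Type w} [NormedAddCommGroup Z] [NormedSpace ℂ Z] [LeftBMod B Z] [CompleteSpace Z]

variable (B U Y) in
/-- Chains with coefficients in the conditional unitization form a free module: the extension of
a cochain to a module map. -/
def freeLift (n : ℕ) : Cochain B Y n →L[ℂ] Chain B U n →L[ℂ] Y :=
  pliftL U (⨂[ℂ] _ : Fin n, B) Y ∘L
    ContinuousLinearMap.compL ℂ U (Cochain B Y n) ((⨂[ℂ] _ : Fin n, B) →L[ℂ] Y)
      (PiTensorProduct.liftIsometry ℂ (fun _ : Fin n => B)
        Y).toContinuousLinearEquiv.toContinuousLinearMap ∘L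
    (ContinuousLinearMap.compL ℂ U (Y →L[ℂ] Y) (Cochain B Y n)).flip
      (unitAct B U Y) ∘L
    (ContinuousLinearMap.compContinuousMultilinearMapL ℂ (fun _ : Fin n => B) Y Y).flip

lemma freeLift_elem {n : ℕ} (g : Cochain B Y n) (u : U) (a : Fin n → B) :
    freeLift B U Y n g (elem B U n u a) = unitAct B U Y u (g a) := by
  simp [freeLift, elem_apply]

lemma freeLift_isModMap {n : ℕ} (g : Cochain B Y n) : IsModMap B (freeLift B U Y n g) := by
  intro b z
  suffices H : freeLift B U Y n g ∘L LeftBMod.lact b = LeftBMod.lact b ∘L freeLift B U Y n g from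
    DFunLike.congr_fun H z
  refine chain_ext fun u a => ?_
  simp only [ContinuousLinearMap.comp_apply, lact_elem, freeLift_elem, unitAct_lact]

/-- The values of a module map on the free generators. -/
def restrictGen {n : ℕ} (φ : Chain B U n →L[ℂ] Y) : Cochain B Y n :=
  φ.compContinuousMultilinearMap (elem B U n (gen B))

lemma restrictGen_apply {n : ℕ} (φ : Chain B U n →L[ℂ] Y) (a : Fin n → B) :
    restrictGen φ a = φ (elem B U n (gen B) a) := rfl

/-- Every `u` is its own action on `gen`, so the generators determine a module map. The opposite
composite is only postcomposition with the action of `gen`. -/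
lemma freeLift_restrictGen {n : ℕ} {φ : Chain B U n →L[ℂ] Y}
    (hφ : IsModMap B φ) : freeLift B U Y n (restrictGen φ) = φ := by
  refine chain_ext fun u a => ?_
  rw [freeLift_elem, restrictGen_apply, ← hφ.unitAct]
  congr 1
  conv_rhs => rw [← expand (B := B) u]
  simp [unitAct_apply, lact_elem]

lemma comp_freeLift {n : ℕ} {σ : Y →L[ℂ] Z} (hσ : IsModMap B σ) (g : Cochain B Y n) :
    σ ∘L freeLift B U Y n g = freeLift B U Z n (σ.compContinuousMultilinearMap g) := by
  refine chain_ext fun u a => ?_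
  simp only [ContinuousLinearMap.comp_apply, freeLift_elem, hσ.unitAct]
  rfl

end Free

/-! ### Naturality in the coefficients and the Harrison projection. -/

section Natural

variable {A : Type u} [NonUnitalNormedCommRing A] [NormedSpace ℂ A]
  [IsScalarTower ℂ A A] [SMulCommClass ℂ A A]
variable {M : Type v} [NormedAddCommGroup M] [NormedSpace ℂ M]
variable {M' : Type w} [NormedAddCommGroup M'] [NormedSpace ℂ M']

/-- Maps of chains that act on the coefficients only commute with permutations of the other
tensor factors. -/
lemma groupAlgChain_natural {n : ℕ} {F : Chain A M n →L[ℂ] Chain A M' n} {f : M → M'}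
    (hF : ∀ x a, F (elem A M n x a) = elem A M' n (f x) a)
    (e : MonoidAlgebra ℚ (Equiv.Perm (Fin n))) (z : Chain A M n) :
    F (groupAlgChain A M e z) = groupAlgChain A M' e (F z) := by
  suffices H : F ∘L groupAlgChain A M e = groupAlgChain A M' e ∘L F from DFunLike.congr_fun H z
  refine chain_ext fun x a => ?_
  rw [ContinuousLinearMap.comp_apply, ContinuousLinearMap.comp_apply, groupAlgChain_elem, hF,
    groupAlgChain_elem, ← ContinuousLinearMap.coe_coe F, clm_permOp]
  simp only [ContinuousLinearMap.coe_coe, hF]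

lemma lact_groupAlgChain [BiBMod A M] {n : ℕ} (c : A) (e : MonoidAlgebra ℚ (Equiv.Perm (Fin n)))
    (z : Chain A M n) :
    LeftBMod.lact c (groupAlgChain A M e z) = groupAlgChain A M e (LeftBMod.lact c z) :=
  groupAlgChain_natural (F := LeftBMod.lact c) (lact_elem c) e z

lemma lact_mem_harrChain [BiBMod A M] {n : ℕ} (c : A) {z : Chain A M n}
    (hz : z ∈ harrChain A M n) : LeftBMod.lact c z ∈ harrChain A M n := by
  obtain ⟨y, rfl⟩ := hz
  exact ⟨LeftBMod.lact c y, (lact_groupAlgChain c _ y).symm⟩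

variable (A M) in
/-- The projection of the chains on the Harrison summand. -/
def harrProj (n : ℕ) : Chain A M n →L[ℂ] harrChain A M n :=
  (groupAlgChain A M (bgs n 1)).codRestrict _ fun z => ⟨z, rfl⟩

lemma harrProj_coe {n : ℕ} (z : Chain A M n) :
    (harrProj A M n z : Chain A M n) = groupAlgChain A M (bgs n 1) z := rfl

lemma harrProj_mem {n : ℕ} (hn : 0 < n) (z : harrChain A M n) : harrProj A M n z = z :=
  Subtype.ext ((mem_harrChain hn).1 z.2)

end Natural

/-! ### The Harrison resolution of `H_1`. -/

section Resolution

open IsCondUnital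

variable (B : Type u) [NonUnitalNormedCommRing B] [NormedSpace ℂ B]
  [IsScalarTower ℂ B B] [SMulCommClass ℂ B B]
variable (U : Type u) [NormedAddCommGroup U] [NormedSpace ℂ U] [BiBMod B U] [IsCondUnital B U]

instance (n : ℕ) : LeftBMod B (harrChain B U n) :=
  subspaceMod _ fun b _ hz => lact_mem_harrChain b hz

instance (n : ℕ) : CompleteSpace (harrChain B U (n + 1)) :=
  (isClosed_harrChain (Nat.succ_pos n)).completeSpace_coe

/-- The Harrison chains with coefficients in the conditional unitization as a Banach module. -/
@[reducible] def harrModule (n : ℕ) : LeftBanachModule.{u} B := ⟨harrChain B U (n + 1)⟩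

lemma harrProj_isModMap (n : ℕ) : IsModMap B (harrProj B U n) := fun b z =>
  Subtype.ext (lact_groupAlgChain b _ z).symm

/-- A module direct summand of a relatively free module is projective: extend `φ` by the projection,
lift its values on generators with the linear section `ρ`, extend freely and restrict. -/
lemma harrModule_isProjective (n : ℕ) : (harrModule B U n).IsProjective := by
  intro Y Z σ ρ φ hσ hρ hφ
  let φ' : Chain B U (n + 1) →L[ℂ] Z.carrier :=
    φ ∘L harrProj B U (n + 1)
  have hφ' : IsModMap B φ' := hφ.comp (harrProj_isModMap B U (n + 1))
  refine ⟨freeLift B U Y.carrier (n + 1) (ρ.compContinuousMultilinearMap (restrictGen φ')) ∘L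
    (harrChain B U (n + 1)).subtypeL, fun b z => freeLift_isModMap _ b z.1, ?_⟩
  rw [← ContinuousLinearMap.comp_assoc, comp_freeLift hσ]
  have h1 : σ.compContinuousMultilinearMap (ρ.compContinuousMultilinearMap (restrictGen φ')) =
      restrictGen φ' := by
    ext a
    exact DFunLike.congr_fun hρ _
  rw [h1, freeLift_restrictGen hφ']
  ext z
  exact congrArg φ (harrProj_mem (Nat.succ_pos n) z)

/-- The boundary operator on Harrison chains. -/
def harrBd (n : ℕ) : harrChain B U (n + 2) →L[ℂ]
    harrChain B U (n + 1) :=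
  (bd B U (n + 1) ∘L
    (harrChain B U (n + 2)).subtypeL).codRestrict _
      fun z => bd_mem_harrChain (isSymm (B := B) (U := U)) (Nat.succ_pos n) z.2

/-- The augmentation of the Harrison resolution. -/
def harrAug : harrChain B U 1 →L[ℂ]
    HochschildHomology B U 1 :=
  ((boundaries B U 1).submoduleOf (cycles B U 1)).mkQL ∘L
    (harrChain B U 1).subtypeL.codRestrict (cycles B U 1)
      fun z => bd_zero (isSymm (B := B) (U := U)) z.1

variable {B U}

/-- Since `e_1 = 1`, projecting a 2-chain onto the Harrison summand does not change its boundary. -/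
lemma mem_boundaries_one {z : Chain B U 1}
    (hz : z ∈ boundaries B U 1) :
    ∃ x : harrChain B U 2, bd B U 1 x = z := by
  obtain ⟨w, rfl⟩ := hz
  refine ⟨harrProj B U 2 w, ?_⟩
  rw [harrProj_coe, bd_bgs (isSymm (B := B) (U := U)) one_pos, bgs_one, groupAlgChain_one]
  rfl

/-- A bounded right inverse of the augmentation, from a splitting of the Harrison complex. -/
lemma exists_section_harrAug (s : ∀ n : ℕ, harrChain B U (n + 1) →L[ℂ]
      harrChain B U (n + 2))
    (hs : ∀ (n : ℕ) (x : harrChain B U (n + 2))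
      (y : harrChain B U (n + 1)),
      (y : Chain B U (n + 1)) = bd B U (n + 1) x →
        (s n y : Chain B U (n + 2)) +
          bd B U (n + 2) (s (n + 1) x) = x) :
    ∃ s₀ : HochschildHomology B U 1 →L[ℂ] harrChain B U 1,
      harrAug B U ∘L s₀ = ContinuousLinearMap.id ℂ _ ∧
      s₀ ∘L harrAug B U + harrBd B U 0 ∘L s 0 = ContinuousLinearMap.id ℂ _ := by
  let j : cycles B U 1 →L[ℂ] harrChain B U 1 :=
    (cycles B U 1).subtypeL.codRestrict _ fun z => by
      rw [harrChain_one]; trivial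
  -- `1 - d_1 s_1`, in the numbering of degrees, kills boundaries: applying `d_1` to `s_1 d_1 x +
  -- d_2 s_2 x = x` gives `d_1 s_1 d_1 x = d_1 x`. It therefore descends to `H_1`.
  let p : cycles B U 1 →L[ℂ] harrChain B U 1 :=
    j - harrBd B U 0 ∘L s 0 ∘L j
  have hp : (boundaries B U 1).submoduleOf (cycles B U 1) ≤
      LinearMap.ker p.toLinearMap := by
    intro z hz
    obtain ⟨x, hx⟩ := mem_boundaries_one hz
    have h1 := hs 0 x (j z) hx.symm
    have h2 := congrArg (bd B U 1) h1
    rw [map_add, bd_bd (isSymm (B := B) (U := U)), add_zero] at h2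
    refine Subtype.ext ?_
    change z.1 - bd B U 1 (s 0 (j z)) = 0
    rw [h2, hx]
    exact sub_self _
  refine ⟨Submodule.liftQL _ p hp, ?_, ?_⟩
  · ext q
    obtain ⟨z, rfl⟩ := Submodule.Quotient.mk_surjective _ q
    refine (Submodule.Quotient.eq _).2 ?_
    change (z.1 - bd B U 1 (s 0 (j z))) - z.1 ∈
      boundaries B U 1
    rw [sub_sub_cancel_left]
    exact Submodule.neg_mem _ ⟨_, rfl⟩
  · ext z
    change (z.1 - bd B U 1 (s 0 _)) + bd B U 1 (s 0 z) = z.1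
    exact sub_add_cancel _ _

lemma hochschildHomology_one_completeSpace :
    CompleteSpace (HochschildHomology B U 1) := by
  have h : IsClosed (cycles B U 1 : Set (Chain B U 1)) :=
    isClosed_singleton.preimage (bd B U 0).continuous
  have := h.completeSpace_coe
  infer_instance

/-- The section of the augmentation is a continuous injection into a normed space. -/
lemma hochschildHomology_one_t2Space (hB : HarrisonSplitExact B U) :
    T2Space (HochschildHomology B U 1) := by
  obtain ⟨s, hs⟩ := hB
  obtain ⟨s₀, h1, h2⟩ := exists_section_harrAug s hs
  refine T2Space.of_injective_continuous (f := s₀) (fun x y hxy => ?_) s₀.continuous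
  have := congrArg (harrAug B U) hxy
  rwa [← ContinuousLinearMap.comp_apply, ← ContinuousLinearMap.comp_apply, h1] at this

/-- The admissible projective resolution of `H₁` given by a splitting of the Harrison complex. -/
@[reducible] def harrResolution (hB : HarrisonSplitExact B U) :
    AdmissibleResolution B (HochschildHomology B U 1) where
  obj := harrModule B U
  projective := harrModule_isProjective B U
  d := harrBd B U
  aug := harrAug B U
  d_mod := fun n b z => Subtype.ext (bd_lact b z.1)
  aug_mod := fun b z => rfl
  d_d := fun n => by
    ext z
    exact bd_bd (isSymm (B := B) (U := U)) z.1
  aug_d := by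
    ext z
    exact (Submodule.Quotient.mk_eq_zero _).2 ⟨z.1, rfl⟩
  split := by
    obtain ⟨s, hs⟩ := hB
    obtain ⟨s₀, h1, h2⟩ := exists_section_harrAug s hs
    refine ⟨s₀, s, h1, h2, fun n => ?_⟩
    ext z
    exact hs n z (harrBd B U n z) rfl

end Resolution

/-! ### Chain maps induced by maps of coefficients. -/

section CoefMap

variable {A : Type u} [NonUnitalNormedCommRing A] [NormedSpace ℂ A]
  [IsScalarTower ℂ A A] [SMulCommClass ℂ A A]
variable {M : Type v} [NormedAddCommGroup M] [NormedSpace ℂ M]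
variable {M' : Type w} [NormedAddCommGroup M'] [NormedSpace ℂ M']

variable (A M M') in
/-- The map of chains induced by a map of coefficients. -/
def coefMap (n : ℕ) : (M →L[ℂ] M') →L[ℂ] Chain A M n →L[ℂ] Chain A M' n :=
  pliftL M (⨂[ℂ] _ : Fin n, A) (Chain A M' n) ∘L
    ContinuousLinearMap.compL ℂ M M' _ (ptmul M' (⨂[ℂ] _ : Fin n, A))

lemma coefMap_elem {n : ℕ} (f : M →L[ℂ] M') (x : M) (a : Fin n → A) :
    coefMap A M M' n f (elem A M n x a) = elem A M' n (f x) a := by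
  simp [coefMap, elem_apply]

lemma bd_coefMap [BiBMod A M] [BiBMod A M'] (hM : IsSymmBMod A M) (hM' : IsSymmBMod A M') {n : ℕ}
    {f : M →L[ℂ] M'} (hf : IsModMap A f) (z : Chain A M (n + 1)) :
    bd A M' n (coefMap A M M' (n + 1) f z) = coefMap A M M' n f (bd A M n z) := by
  suffices H : bd A M' n ∘L coefMap A M M' (n + 1) f = coefMap A M M' n f ∘L bd A M n from
    DFunLike.congr_fun H z
  refine chain_ext fun x a => ?_
  simp only [ContinuousLinearMap.comp_apply, coefMap_elem, bd_elem hM, bd_elem hM', hdiff, map_add,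
    map_sum, map_smul, hf _ x]

lemma groupAlgChain_coefMap {n : ℕ} (f : M →L[ℂ] M')
    (e : MonoidAlgebra ℚ (Equiv.Perm (Fin n))) (z : Chain A M n) :
    coefMap A M M' n f (groupAlgChain A M e z) = groupAlgChain A M' e (coefMap A M M' n f z) :=
  groupAlgChain_natural (coefMap_elem f) e z

end CoefMap

/-! ### Over a unital algebra, the part of the coefficients with zero action contributes nothing. -/

section Contraction

variable {A : Type u} [NonUnitalNormedCommRing A] [NormedSpace ℂ A]
  [IsScalarTower ℂ A A] [SMulCommClass ℂ A A]
variable {M : Type v} [NormedAddCommGroup M] [NormedSpace ℂ M] [BiBMod A M]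

lemma merge_zero_cons {n : ℕ} {e : A} (he : ∀ b : A, e * b = b) (a : Fin (n + 1) → A) :
    merge (0 : Fin (n + 1)) (Fin.cons e a : Fin (n + 2) → A) = a := by
  ext k
  rw [merge]
  refine Fin.cases ?_ (fun k => ?_) k
  · simp [he]
  · simp

lemma merge_succ_cons {n : ℕ} (e : A) (j : Fin n) (a : Fin (n + 1) → A) :
    merge j.succ (Fin.cons e a : Fin (n + 2) → A) = Fin.cons e (merge j a) := by
  ext k
  refine Fin.cases ?_ (fun k => ?_) k
  · simp [merge]
  · simp only [merge, Fin.cons_succ, Fin.succ_lt_succ_iff, Fin.succ_inj, ← Fin.succ_castSucc]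

/-- With zero outer faces, inserting the unit is a contracting homotopy: the first inner face gives
back `a`, and the others are the faces of `a` with shifted sign. -/
lemma hdiff_cons {n : ℕ} {G : Type*} [AddCommGroup G] [Module ℂ G] {e : A}
    (he : ∀ b : A, e * b = b) (φ : (Fin (n + 1) → A) → G) (a : Fin (n + 1) → A) :
    hdiff (fun _ _ => 0) φ (Fin.cons e a) =
      - φ a - hdiff (fun _ _ => 0) (fun b => φ (Fin.cons e b)) a := by
  simp only [hdiff, Fin.sum_univ_succ, merge_zero_cons he, merge_succ_cons, Fin.val_zero,
    Fin.val_succ, zero_add, smul_zero, add_zero, pow_one, neg_smul, one_smul, sub_eq_add_neg,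
    ← Finset.sum_neg_distrib]
  congr 1
  refine Finset.sum_congr rfl fun j _ => ?_
  rw [pow_succ, mul_neg_one, neg_smul]

lemma groupAlgCochain_comp {n : ℕ} (π : M →L[ℂ] M) (e : MonoidAlgebra ℚ (Equiv.Perm (Fin n)))
    (ψ : Cochain A M n) : groupAlgCochain A M e (π.compContinuousMultilinearMap ψ) =
      π.compContinuousMultilinearMap (groupAlgCochain A M e ψ) := by
  ext a
  have h := clm_permOp π.toLinearMap e (fun b => ψ b) a
  rw [groupAlgCochain_eq]
  refine Eq.trans h.symm ?_
  rw [← groupAlgCochain_eq]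
  rfl

/-- If the algebra is unital, then Harrison cocycles with values in a complement of the unital part
of the coefficients are coboundaries. -/
lemma comp_sub_mem_harrCoboundaries (hM : IsSymmBMod A M) {e : A} (he : ∀ b : A, e * b = b)
    {π : M →L[ℂ] M} (hπ : IsModMap A π) (hπ' : ∀ (b : A) x, LeftBMod.lact b (π x) = LeftBMod.lact b x)
    {n : ℕ} {ψ : Cochain A M (n + 1)} (hψ : ψ ∈ harrCochain A M (n + 1))
    (hδ : cobd A M (n + 1) ψ = 0) :
    π.compContinuousMultilinearMap ψ - ψ ∈ harrCoboundaries A M (n + 1) := by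
  -- `A` acts by zero on the image of `ρ`, so the outer faces disappear after applying it.
  let ρ : M →L[ℂ] M := ContinuousLinearMap.id ℂ M - π
  have hρ1 : ∀ (b : A) x, LeftBMod.lact b (ρ x) = 0 := fun b x => by simp [ρ, hπ']
  have hρ2 : ∀ (b : A) x, ρ (LeftBMod.lact b x) = 0 := fun b x => by simp [ρ, hπ b, hπ']
  have hρ3 : ∀ a, (π.compContinuousMultilinearMap ψ - ψ) a = - ρ (ψ a) := fun a => by simp [ρ]
  have key : ∀ a, - ρ (ψ a) = hdiff (fun _ _ => (0 : M)) (fun b => ρ (ψ (Fin.cons e b))) a := by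
    intro a
    have h1 : hdiff (fun _ _ => 0) (fun b => ρ (ψ b)) (Fin.cons e a) = 0 := by
      have h1 := congrArg ρ (DFunLike.congr_fun hδ (Fin.cons e a))
      rw [cobd_eq_hdiff hM] at h1
      simp only [hdiff, map_add, map_sum, map_smul, hρ2] at h1
      exact h1.trans (map_zero ρ)
    rw [hdiff_cons he (fun b => ρ (ψ b)) a] at h1
    exact sub_eq_zero.1 h1
  cases n with
  | zero =>
    -- In degree one there are no coboundaries, but the homotopy term is an empty sum, so the
    -- difference itself vanishes.
    have : π.compContinuousMultilinearMap ψ - ψ = 0 := by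
      ext a
      rw [hρ3, key]
      simp [hdiff]
    rw [this]
    exact Submodule.zero_mem _
  | succ n =>
    let χ : Cochain A M (n + 1) := (ρ.compContinuousMultilinearMap ψ).curryLeft e
    have hχ : cobd A M (n + 1) χ = π.compContinuousMultilinearMap ψ - ψ := by
      ext a
      rw [hρ3, key, cobd_eq_hdiff hM]
      have : ∀ b, χ b = ρ (ψ (Fin.cons e b)) := fun b => rfl
      simp only [hdiff, this, hρ1]
    have hmem : groupAlgCochain A M (bgs (n + 2) 1) (π.compContinuousMultilinearMap ψ - ψ) =
        π.compContinuousMultilinearMap ψ - ψ := by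
      have h1 := (mem_harrCochain (Nat.succ_pos _)).1 hψ
      rw [map_sub, h1]
      rw [groupAlgCochain_comp, h1]
    -- Inserting `e` need not preserve the Harrison summand, so the primitive is projected; its
    -- coboundary already lies in the summand and is unchanged.
    refine ⟨groupAlgCochain A M (bgs (n + 1) 1) χ, ⟨χ, rfl⟩, ?_⟩
    rw [cobd_bgs hM (Nat.succ_pos n), hχ, hmem]

variable (A M) in
/-- Insertion of an element of the algebra in front of a chain, followed by a map of
coefficients. -/
def insertChain (n : ℕ) (e : A) (ρ : M →L[ℂ] M) : Chain A M n →L[ℂ] Chain A M (n + 1) :=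
  clift (ContinuousLinearMap.apply ℂ _ e ∘L
    (continuousMultilinearCurryLeftEquiv ℂ (fun _ : Fin (n + 1) => A)
      (Chain A M (n + 1))).toContinuousLinearEquiv.toContinuousLinearMap ∘L
    elem A M (n + 1) ∘L ρ)

lemma insertChain_elem {n : ℕ} (e : A) (ρ : M →L[ℂ] M) (x : M) (a : Fin n → A) :
    insertChain A M n e ρ (elem A M n x a) = elem A M (n + 1) (ρ x) (Fin.cons e a) := by
  simp [insertChain]

/-- If the algebra is unital, then Harrison cycles with values in a complement of the unital part
of the coefficients are boundaries. -/
lemma coefMap_sub_mem_harrBoundaries (hM : IsSymmBMod A M) {e : A} (he : ∀ b : A, e * b = b)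
    {π : M →L[ℂ] M} (hπ : IsModMap A π) (hπ' : ∀ (b : A) x, LeftBMod.lact b (π x) = LeftBMod.lact b x)
    {n : ℕ} {z : Chain A M (n + 1)} (hz : z ∈ harrChain A M (n + 1)) (hbd : bd A M n z = 0) :
    coefMap A M M (n + 1) π z - z ∈
      (harrChain A M (n + 2)).map (bd A M (n + 1)).toLinearMap := by
  let ρ : M →L[ℂ] M := ContinuousLinearMap.id ℂ M - π
  have hρ1 : ∀ (b : A) x, LeftBMod.lact b (ρ x) = 0 := fun b x => by simp [ρ, hπ']
  have hρ2 : ∀ (b : A) x, ρ (LeftBMod.lact b x) = 0 := fun b x => by simp [ρ, hπ b, hπ']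
  have key : bd A M (n + 1) ∘L insertChain A M (n + 1) e ρ + insertChain A M n e ρ ∘L bd A M n =
      coefMap A M M (n + 1) π - ContinuousLinearMap.id ℂ _ := by
    refine chain_ext fun x a => ?_
    have h1 := hdiff_cons he (fun b => elem A M (n + 1) (ρ x) b) a
    have h2 : elem A M (n + 1) (π x) a - elem A M (n + 1) x a = - elem A M (n + 1) (ρ x) a := by
      simp [ρ]
    simp only [_root_.add_apply, _root_.sub_apply, ContinuousLinearMap.comp_apply, coefMap_elem,
      insertChain_elem, bd_elem hM, ContinuousLinearMap.id_apply, h2]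
    have h3 : hdiff (fun c b => elem A M (n + 1) (LeftBMod.lact c (ρ x)) b)
        (fun b => elem A M (n + 1) (ρ x) b) (Fin.cons e a) =
        hdiff (fun _ _ => 0) (fun b => elem A M (n + 1) (ρ x) b) (Fin.cons e a) := by
      simp [hdiff, hρ1]
    have h4 : insertChain A M n e ρ (hdiff (fun c b => elem A M n (LeftBMod.lact c x) b)
        (fun b => elem A M n x b) a) =
        hdiff (fun _ _ => 0) (fun b => elem A M (n + 1) (ρ x) (Fin.cons e b)) a := by
      simp [hdiff, insertChain_elem, hρ2]
    rw [h3, h4, h1]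
    exact sub_add_cancel _ _
  have h1 : bd A M (n + 1) (insertChain A M (n + 1) e ρ z) = coefMap A M M (n + 1) π z - z := by
    have := DFunLike.congr_fun key z
    simpa [hbd] using this
  -- As for cochains, the primitive is projected onto the Harrison summand without changing its
  -- boundary.
  refine ⟨groupAlgChain A M (bgs (n + 2) 1) (insertChain A M (n + 1) e ρ z), ⟨_, rfl⟩, ?_⟩
  change bd A M (n + 1) _ = _
  rw [bd_bgs hM (Nat.succ_pos n), h1, map_sub, ← groupAlgChain_coefMap,
    (mem_harrChain (Nat.succ_pos n)).1 hz]

end Contraction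

/-! ### Harrison cochains as module maps on the Harrison resolution. -/

section Identification

open IsCondUnital

variable {B : Type u} [NonUnitalNormedCommRing B] [NormedSpace ℂ B]
  [IsScalarTower ℂ B B] [SMulCommClass ℂ B B]
variable {U : Type u} [NormedAddCommGroup U] [NormedSpace ℂ U] [BiBMod B U] [IsCondUnital B U]
variable {X : Type v} [NormedAddCommGroup X] [NormedSpace ℂ X] [CompleteSpace X]

section Cochains

variable [BiBMod B X]

lemma groupAlgCochain_restrictGen {n : ℕ} (e : MonoidAlgebra ℚ (Equiv.Perm (Fin n)))
    (φ : Chain B U n →L[ℂ] X) :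
    groupAlgCochain B X e (restrictGen φ) = restrictGen (φ ∘L groupAlgChain B U e) := by
  ext a
  rw [groupAlgCochain_eq, restrictGen_apply, ContinuousLinearMap.comp_apply, groupAlgChain_elem,
    ← ContinuousLinearMap.coe_coe φ, clm_permOp]
  rfl

lemma cobd_restrictGen (hX : IsSymmBMod B X) {n : ℕ} {φ : Chain B U n →L[ℂ] X}
    (hφ : IsModMap B φ) : cobd B X n (restrictGen φ) = restrictGen (φ ∘L bd B U n) := by
  ext a
  rw [cobd_eq_hdiff hX, restrictGen_apply, ContinuousLinearMap.comp_apply,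
    bd_elem (isSymm (B := B) (U := U))]
  simp only [hdiff, map_add, map_sum, map_smul, restrictGen_apply, ← lact_elem, hφ _ _]

lemma freeLift_comp_bd (hX : IsSymmBMod B X) {n : ℕ} (ψ : Cochain B X n) :
    freeLift B U X n ψ ∘L bd B U n = freeLift B U X (n + 1) (cobd B X n ψ) := by
  refine chain_ext fun u a => ?_
  rw [ContinuousLinearMap.comp_apply, bd_elem (isSymm (B := B) (U := U)), freeLift_elem,
    cobd_eq_hdiff hX]
  simp only [hdiff, map_add, map_sum, map_smul, freeLift_elem, unitAct_lact,
    unitAct_isModMap u _ _]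

variable (B U) in
lemma harrProj_comp_bd (n : ℕ) : harrProj B U (n + 1) ∘L bd B U (n + 1) =
    harrBd B U n ∘L harrProj B U (n + 2) := by
  ext z
  exact (bd_bgs (isSymm (B := B) (U := U)) (Nat.succ_pos n) z).symm

variable (B U X) in
/-- The cochain given by the values of a module map on the generators of the Harrison chains. -/
def homToCochain (n : ℕ) : (harrChain B U (n + 1) →L[ℂ] X) →L[ℂ] Cochain B X (n + 1) :=
  (ContinuousLinearMap.compContinuousMultilinearMapL ℂ (fun _ : Fin (n + 1) => B)
    (Chain B U (n + 1)) X).flip (elem B U (n + 1) (gen B)) ∘L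
    ContinuousLinearMap.precomp X (harrProj B U (n + 1))

lemma homToCochain_eq {n : ℕ} (φ : harrChain B U (n + 1) →L[ℂ] X) :
    homToCochain B U X n φ = restrictGen (φ ∘L harrProj B U (n + 1)) := rfl

variable (B U X) in
/-- The module map on Harrison chains given by a cochain. -/
def cochainToHom (n : ℕ) : Cochain B X (n + 1) →L[ℂ] harrChain B U (n + 1) →L[ℂ] X :=
  ContinuousLinearMap.precomp X (harrChain B U (n + 1)).subtypeL ∘L freeLift B U X (n + 1)

lemma cochainToHom_apply {n : ℕ} (ψ : Cochain B X (n + 1)) (z : harrChain B U (n + 1)) :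
    cochainToHom B U X n ψ z = freeLift B U X (n + 1) ψ z := rfl

lemma cochainToHom_isModMap {n : ℕ} (ψ : Cochain B X (n + 1)) :
    IsModMap B (cochainToHom B U X n ψ) := fun b z => freeLift_isModMap ψ b z.1

lemma homToCochain_mem {n : ℕ} (φ : harrChain B U (n + 1) →L[ℂ] X) :
    homToCochain B U X n φ ∈ harrCochain B X (n + 1) := by
  rw [mem_harrCochain (Nat.succ_pos n), homToCochain_eq, groupAlgCochain_restrictGen]
  congr 1
  ext z
  exact congrArg φ (Subtype.ext (bgsChain_idem (Nat.succ_pos n) z))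

lemma cobd_homToCochain (hX : IsSymmBMod B X) {n : ℕ} {φ : harrChain B U (n + 1) →L[ℂ] X}
    (hφ : IsModMap B φ) :
    cobd B X (n + 1) (homToCochain B U X n φ) = homToCochain B U X (n + 1) (φ ∘L harrBd B U n) := by
  rw [homToCochain_eq, cobd_restrictGen hX (hφ.comp (harrProj_isModMap B U (n + 1))),
    homToCochain_eq, ContinuousLinearMap.comp_assoc, harrProj_comp_bd]
  rfl

lemma cochainToHom_cobd (hX : IsSymmBMod B X) {n : ℕ} (ψ : Cochain B X (n + 1)) :
    cochainToHom B U X (n + 1) (cobd B X (n + 1) ψ) = cochainToHom B U X n ψ ∘L harrBd B U n := by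
  ext z
  rw [cochainToHom_apply, ← freeLift_comp_bd hX]
  rfl

lemma cochainToHom_homToCochain {n : ℕ} {φ : harrChain B U (n + 1) →L[ℂ] X}
    (hφ : IsModMap B φ) : cochainToHom B U X n (homToCochain B U X n φ) = φ := by
  ext z
  rw [cochainToHom_apply, homToCochain_eq,
    freeLift_restrictGen (hφ.comp (harrProj_isModMap B U (n + 1)))]
  exact congrArg φ (harrProj_mem (Nat.succ_pos n) z)

/-- This composite is the identity only where `gen` acts trivially; on cohomology the discrepancy is
removed by `comp_sub_mem_harrCoboundaries`. -/
lemma homToCochain_cochainToHom {n : ℕ} {ψ : Cochain B X (n + 1)}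
    (hψ : ψ ∈ harrCochain B X (n + 1)) : homToCochain B U X n (cochainToHom B U X n ψ) =
      (unitAct B U X (gen B)).compContinuousMultilinearMap ψ := by
  have h1 : homToCochain B U X n (cochainToHom B U X n ψ) =
      groupAlgCochain B X (bgs (n + 1) 1) (restrictGen (freeLift B U X (n + 1) ψ)) := by
    rw [groupAlgCochain_restrictGen]
    rfl
  rw [h1]
  have h2 : restrictGen (freeLift B U X (n + 1) ψ) =
      (unitAct B U X (gen B)).compContinuousMultilinearMap ψ := by
    ext a
    rw [restrictGen_apply, freeLift_elem]
    rfl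
  rw [h2, groupAlgCochain_comp, (mem_harrCochain (Nat.succ_pos n)).1 hψ]

lemma unitAct_gen_eq_id (h : scalarPart B (gen B : U) = 1 ∧ (algPart (gen B : U) : B) = 0) :
    unitAct B U X (gen B) = ContinuousLinearMap.id ℂ X := by
  ext x
  simp [unitAct_apply, h.1, h.2]

set_option maxHeartbeats 1000000 in
/-- Harrison cohomology is computed by module maps out of the Harrison resolution. -/
theorem nonempty_harrisonCohomology_equiv (hB : HarrisonSplitExact B U) (hX : IsSymmBMod B X)
    (n : ℕ) : Nonempty (HarrisonCohomology B X (n + 1) ≃L[ℂ] ExtOf (harrResolution hB) X n) := by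
  refine ⟨subQuotEquiv (cochainToHom B U X n).toLinearMap (homToCochain B U X n).toLinearMap
    (ContinuousLinearMap.continuous _) (ContinuousLinearMap.continuous _) ?_ ?_ ?_ ?_ ?_ ?_⟩
  · rintro ψ ⟨h1, h2⟩
    have h2 : cobd B X (n + 1) ψ = 0 := h2
    refine ⟨cochainToHom_isModMap ψ, ?_⟩
    change cochainToHom B U X n ψ ∘L harrBd B U n = 0
    rw [← cochainToHom_cobd hX, h2, map_zero]
  · rintro φ ⟨h1, h2⟩
    have h2 : φ ∘L harrBd B U n = 0 := h2
    refine ⟨homToCochain_mem φ, ?_⟩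
    change cobd B X (n + 1) (homToCochain B U X n φ) = 0
    rw [cobd_homToCochain hX h1, h2, map_zero]
  · rintro ψ - hψ
    cases n with
    | zero =>
      have hψ : ψ = 0 := hψ
      rw [hψ, map_zero]
      exact Submodule.zero_mem _
    | succ n =>
      obtain ⟨χ, hχ, rfl⟩ := hψ
      exact ⟨cochainToHom B U X n χ, cochainToHom_isModMap χ, (cochainToHom_cobd hX χ).symm⟩
  · rintro φ - hφ
    cases n with
    | zero =>
      have hφ : φ = 0 := hφ
      rw [hφ, map_zero]
      exact Submodule.zero_mem _
    | succ n =>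
      obtain ⟨χ, hχ, rfl⟩ := hφ
      exact ⟨homToCochain B U X n χ, homToCochain_mem χ, cobd_homToCochain hX hχ⟩
  · rintro ψ ⟨h1, h2⟩
    change homToCochain B U X n (cochainToHom B U X n ψ) - ψ ∈ _
    rw [homToCochain_cochainToHom h1]
    -- Either `gen` acts as the identity, or `B` has a unit and the contraction by it applies.
    rcases IsCondUnital.cases (B := B) (U := U) with h | ⟨e, he⟩
    · rw [unitAct_gen_eq_id h]
      have : (ContinuousLinearMap.id ℂ X).compContinuousMultilinearMap ψ - ψ = 0 := by
        ext a
        simp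
      rw [this]
      exact Submodule.zero_mem _
    · have hπ : IsModMap B (unitAct B U X (gen B)) := unitAct_isModMap _
      have hπ' : ∀ (b : B) x, LeftBMod.lact b (unitAct B U X (gen B) x) = LeftBMod.lact b x :=
        fun b x => lact_unitAct_gen b x
      exact comp_sub_mem_harrCoboundaries hX he hπ hπ' h1 h2
  · rintro φ ⟨h1, h2⟩
    have h3 : cochainToHom B U X n (homToCochain B U X n φ) = φ :=
      cochainToHom_homToCochain (φ := φ) h1
    have h4 : cochainToHom B U X n (homToCochain B U X n φ) - φ = 0 := sub_eq_zero.2 h3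
    exact h4.symm ▸ Submodule.zero_mem _

end Cochains

end Identification

/-! ### Universal property of balanced tensor products. -/

section Lifts

variable {B : Type u} [NonUnitalNormedCommRing B] [NormedSpace ℂ B]
  {X : Type v} [NormedAddCommGroup X] [NormedSpace ℂ X] [RightBMod B X]
  {Y : Type w} [NormedAddCommGroup Y] [NormedSpace ℂ Y] [LeftBMod B Y]

/-- The universal property of the balanced tensor product. -/
def balLift {G : Type*} [NormedAddCommGroup G] [NormedSpace ℂ G] [CompleteSpace G]
    (f : X →L[ℂ] Y →L[ℂ] G)
    (hf : ∀ x (b : B) y, f (RightBMod.ract b x) y = f x (LeftBMod.lact b y)) :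
    BalTensor B X Y →L[ℂ] G :=
  (balancing B X Y).liftQL (plift f)
    (Submodule.topologicalClosure_minimal _ (Submodule.span_le.2 (by
      rintro _ ⟨x, b, y, rfl⟩
      change plift f (_ - _) = 0
      rw [map_sub, plift_ptmul, plift_ptmul, hf, sub_self]))
      (ContinuousLinearMap.isClosed_ker _))

lemma balLift_btmul {G : Type*} [NormedAddCommGroup G] [NormedSpace ℂ G] [CompleteSpace G]
    (f : X →L[ℂ] Y →L[ℂ] G)
    (hf : ∀ x (b : B) y, f (RightBMod.ract b x) y = f x (LeftBMod.lact b y)) (x : X) (y : Y) :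
    balLift f hf (btmul X x y) = f x y :=
  plift_ptmul f x y

variable [IsScalarTower ℂ B B] [SMulCommClass ℂ B B]

/-- Composition of a multilinear map with a bilinear map in its second argument. -/
def compMulti {G : Type*} [NormedAddCommGroup G] [NormedSpace ℂ G] {n : ℕ}
    (f : X →L[ℂ] Y →L[ℂ] G) (g : Cochain B Y n) : X →L[ℂ] Cochain B G n :=
  (ContinuousLinearMap.compContinuousMultilinearMapL ℂ (fun _ : Fin n => B) Y G).flip g ∘L f

variable (X) in
/-- The map from chains to a balanced tensor product given by a cochain. -/
def btmulChain {n : ℕ} (g : Cochain B Y n) : Chain B X n →L[ℂ] BalTensor B X Y :=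
  clift (compMulti (btmul X) g)

lemma btmulChain_elem {n : ℕ} (g : Cochain B Y n) (x : X) (a : Fin n → B) :
    btmulChain X g (elem B X n x a) = btmul X x (g a) := by
  rw [btmulChain, clift_elem]
  rfl

end Lifts

/-! ### Harrison chains as balanced tensor products with the resolution. -/

section Chains

open IsCondUnital

variable {B : Type u} [NonUnitalNormedCommRing B] [NormedSpace ℂ B]
  [IsScalarTower ℂ B B] [SMulCommClass ℂ B B]
variable {U : Type u} [NormedAddCommGroup U] [NormedSpace ℂ U] [BiBMod B U] [IsCondUnital B U]
variable {X : Type v} [NormedAddCommGroup X] [NormedSpace ℂ X] [BiBMod B X]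

variable (B U) in
/-- The orbit map `u ↦ u · x` of an element of a module. -/
def orbit : X →L[ℂ] U →L[ℂ] X := (unitAct B U X).flip

lemma orbit_apply (x : X) (u : U) : orbit B U x u = unitAct B U X u x := rfl

lemma orbit_isModMap (x : X) : IsModMap B (orbit B U x) := fun b u => unitAct_lact b u x

lemma orbit_lact (b : B) (x : X) :
    orbit B U (LeftBMod.lact b x) = orbit B U x ∘L LeftBMod.lact b := by
  ext u
  rw [orbit_apply, unitAct_isModMap u b x, ← unitAct_lact]
  rfl

lemma coefMap_comp_lact {n : ℕ} (f : U →L[ℂ] X) (b : B) (z : Chain B U n) :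
    coefMap B U X n (f ∘L LeftBMod.lact b) z = coefMap B U X n f (LeftBMod.lact b z) := by
  suffices H : coefMap B U X n (f ∘L LeftBMod.lact b) = coefMap B U X n f ∘L LeftBMod.lact b from
    DFunLike.congr_fun H z
  refine chain_ext fun u a => ?_
  simp only [ContinuousLinearMap.comp_apply, lact_elem, coefMap_elem]

lemma btmul_unitAct (hX : IsSymmBMod B X) {Y : Type w} [NormedAddCommGroup Y] [NormedSpace ℂ Y]
    [LeftBMod B Y] (u : U) (x : X) (y : Y) :
    btmul (B := B) X (unitAct B U X u x) y = btmul (B := B) X x (unitAct B U Y u y) := by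
  simp [unitAct_apply, hX _ x, btmul_balanced]

lemma unitAct_elem {n : ℕ} (u v : U) (a : Fin n → B) :
    unitAct B U (Chain B U n) u (elem B U n v a) = elem B U n (unitAct B U U u v) a := by
  simp [unitAct_apply, lact_elem]

section Retract

variable {n : ℕ} {Y : Type w} [NormedAddCommGroup Y] [NormedSpace ℂ Y] [LeftBMod B Y]
  {Y' : Type w} [NormedAddCommGroup Y'] [NormedSpace ℂ Y'] [LeftBMod B Y']

/-- The map from a balanced tensor product to chains that is induced by a module map to the chains
with coefficients in the unitization. -/
def balToChain (hX : IsSymmBMod B X) (i : Y →L[ℂ] Chain B U n) (hi : IsModMap B i) :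
    BalTensor B X Y →L[ℂ] Chain B X n :=
  balLift (ContinuousLinearMap.precomp (Chain B X n) i ∘L coefMap B U X n ∘L orbit B U)
    fun x b y => by
      change coefMap B U X n (orbit B U (RightBMod.ract b x)) (i y) =
        coefMap B U X n (orbit B U x) (i (LeftBMod.lact b y))
      rw [← hX, orbit_lact, coefMap_comp_lact, hi]

lemma balToChain_btmul (hX : IsSymmBMod B X) {i : Y →L[ℂ] Chain B U n} (hi : IsModMap B i) (x : X)
    (y : Y) : balToChain hX i hi (btmul X x y) = coefMap B U X n (orbit B U x) (i y) :=
  balLift_btmul _ _ x y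

variable (X) in
/-- The map from chains to a balanced tensor product that is induced by a map on the chains with
coefficients in the unitization. -/
def chainToBal (p : Chain B U n →L[ℂ] Y) : Chain B X n →L[ℂ] BalTensor B X Y :=
  btmulChain X (p.compContinuousMultilinearMap (elem B U n (gen B)))

lemma chainToBal_elem (p : Chain B U n →L[ℂ] Y) (x : X) (a : Fin n → B) :
    chainToBal X p (elem B X n x a) = btmul X x (p (elem B U n (gen B) a)) :=
  btmulChain_elem _ x a

/-- On `u ⊗ a` the action of `u` is moved across the balanced tensor product, where it turns `gen`
back into `u`. -/
lemma chainToBal_coefMap (hX : IsSymmBMod B X) {p : Chain B U n →L[ℂ] Y} (hp : IsModMap B p)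
    (x : X) (z : Chain B U n) :
    chainToBal X p (coefMap B U X n (orbit B U x) z) = btmul X x (p z) := by
  suffices H : chainToBal X p ∘L coefMap B U X n (orbit B U x) = btmul X x ∘L p from
    DFunLike.congr_fun H z
  refine chain_ext fun u a => ?_
  rw [ContinuousLinearMap.comp_apply, ContinuousLinearMap.comp_apply, coefMap_elem,
    chainToBal_elem, orbit_apply, btmul_unitAct hX, ← hp.unitAct, unitAct_elem, unitAct_self]

variable {i : Y →L[ℂ] Chain B U n} (hi : IsModMap B i) {i' : Y' →L[ℂ] Chain B U (n + 1)}
  (hi' : IsModMap B i') {p : Chain B U n →L[ℂ] Y}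
  {p' : Chain B U (n + 1) →L[ℂ] Y'} {d : Y' →L[ℂ] Y} (hd : IsModMap B d)

lemma chainToBal_balToChain (hp : IsModMap B p) (hX : IsSymmBMod B X) (hpi : ∀ y, p (i y) = y)
    (w : BalTensor B X Y) : chainToBal X p (balToChain hX i hi w) = w := by
  suffices H : chainToBal X p ∘L balToChain hX i hi = ContinuousLinearMap.id ℂ _ from
    DFunLike.congr_fun H w
  refine balTensor_ext fun x y => ?_
  rw [ContinuousLinearMap.comp_apply, balToChain_btmul, chainToBal_coefMap hX hp, hpi]
  rfl

/-- As for cochains, the action of `gen` remains on the coefficients; `coefMap_unitAct_gen_sub_mem`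
shows that it is invisible in homology. -/
lemma balToChain_chainToBal (hX : IsSymmBMod B X) {e : MonoidAlgebra ℚ (Equiv.Perm (Fin n))}
    (hip : ∀ z, i (p z) = groupAlgChain B U e z) (z : Chain B X n) :
    balToChain hX i hi (chainToBal X p z) =
      coefMap B X X n (unitAct B U X (gen B)) (groupAlgChain B X e z) := by
  rw [groupAlgChain_coefMap]
  suffices H : balToChain hX i hi ∘L chainToBal X p =
      groupAlgChain B X e ∘L coefMap B X X n (unitAct B U X (gen B)) from
    DFunLike.congr_fun H z
  refine chain_ext fun x a => ?_
  rw [ContinuousLinearMap.comp_apply, ContinuousLinearMap.comp_apply, coefMap_elem,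
    chainToBal_elem, balToChain_btmul, hip, groupAlgChain_coefMap, coefMap_elem, orbit_apply]

lemma groupAlgChain_balToChain (hX : IsSymmBMod B X) {e : MonoidAlgebra ℚ (Equiv.Perm (Fin n))}
    (hi1 : ∀ y, groupAlgChain B U e (i y) = i y) (w : BalTensor B X Y) :
    groupAlgChain B X e (balToChain hX i hi w) = balToChain hX i hi w := by
  suffices H : groupAlgChain B X e ∘L balToChain hX i hi = balToChain hX i hi from
    DFunLike.congr_fun H w
  refine balTensor_ext fun x y => ?_
  rw [ContinuousLinearMap.comp_apply, balToChain_btmul, ← groupAlgChain_coefMap, hi1]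

lemma bd_balToChain (hX : IsSymmBMod B X) (hid : ∀ y, bd B U n (i' y) = i (d y))
    (w : BalTensor B X Y') :
    bd B X n (balToChain hX i' hi' w) = balToChain hX i hi (balMap X d hd w) := by
  suffices H : bd B X n ∘L balToChain hX i' hi' = balToChain hX i hi ∘L balMap X d hd from
    DFunLike.congr_fun H w
  refine balTensor_ext fun x y => ?_
  rw [ContinuousLinearMap.comp_apply, ContinuousLinearMap.comp_apply, balToChain_btmul,
    balMap_btmul, balToChain_btmul, bd_coefMap (isSymm (B := B) (U := U)) hX (orbit_isModMap x),
    hid]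

lemma chainToBal_bd (hp : IsModMap B p) (hX : IsSymmBMod B X) (hpd : ∀ z, p (bd B U n z) = d (p' z))
    (z : Chain B X (n + 1)) :
    chainToBal X p (bd B X n z) = balMap X d hd (chainToBal X p' z) := by
  suffices H : chainToBal X p ∘L bd B X n = balMap X d hd ∘L chainToBal X p' from
    DFunLike.congr_fun H z
  refine chain_ext fun x a => ?_
  rw [ContinuousLinearMap.comp_apply, ContinuousLinearMap.comp_apply, bd_elem hX, chainToBal_elem,
    balMap_btmul, ← hpd, bd_elem (isSymm (B := B) (U := U))]
  simp only [hdiff, map_add, map_sum, map_smul, chainToBal_elem, hX _ x, btmul_balanced,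
    ← hp _ _, lact_elem]

end Retract

section Homology

variable [CompleteSpace X]

lemma coefMap_unitAct_gen_sub_mem (hX : IsSymmBMod B X) {n : ℕ} {z : Chain B X (n + 1)}
    (hz : z ∈ harrChain B X (n + 1)) (hbd : bd B X n z = 0) :
    coefMap B X X (n + 1) (unitAct B U X (gen B)) z - z ∈
      (harrChain B X (n + 2)).map (bd B X (n + 1)).toLinearMap := by
  rcases IsCondUnital.cases (B := B) (U := U) with h | ⟨e, he⟩
  · have h4 : coefMap B X X (n + 1) (unitAct B U X (gen B)) = ContinuousLinearMap.id ℂ _ := by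
      rw [unitAct_gen_eq_id h]
      exact chain_ext fun x a => coefMap_elem _ x a
    rw [h4, ContinuousLinearMap.id_apply, sub_self]
    exact Submodule.zero_mem _
  · exact coefMap_sub_mem_harrBoundaries hX he (unitAct_isModMap _)
      (fun b x => lact_unitAct_gen b x) hz hbd

variable {N : Type u} [SeminormedAddCommGroup N] [NormedSpace ℂ N] [LeftBMod B N]

/-- If the modules of a resolution are the Harrison summands of the chains with coefficients in the
unitization, then tensor products with the resolution compute Harrison homology. -/
theorem nonempty_harrisonHomology_equiv_of_retract (hX : IsSymmBMod B X)
    (P : AdmissibleResolution B N) {i : ∀ n, (P.obj n).carrier →L[ℂ] Chain B U (n + 1)}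
    (hi : ∀ n, IsModMap B (i n)) {p : ∀ n, Chain B U (n + 1) →L[ℂ] (P.obj n).carrier}
    (hp : ∀ n, IsModMap B (p n)) (hpi : ∀ n y, p n (i n y) = y)
    (hip : ∀ n z, i n (p n z) = groupAlgChain B U (bgs (n + 1) 1) z)
    (hid : ∀ n y, bd B U (n + 1) (i (n + 1) y) = i n (P.d n y))
    (hpd : ∀ n z, p n (bd B U (n + 1) z) = P.d n (p (n + 1) z)) (n : ℕ) :
    Nonempty (HarrisonHomology B X (n + 1) ≃L[ℂ] TorOf P X n) := by
  have hf (m : ℕ) (z : Chain B X (m + 2)) : torDiff P X m (chainToBal X (p (m + 1)) z) =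
      chainToBal X (p m) (bd B X (m + 1) z) :=
    (torDiff_apply P m _).trans (chainToBal_bd (P.d_mod m) (hp m) hX (hpd m) z).symm
  have hg (m : ℕ) (w : BalTensor B X (P.obj (m + 1)).carrier) :
      bd B X (m + 1) (balToChain hX (i (m + 1)) (hi (m + 1)) w) =
        balToChain hX (i m) (hi m) (torDiff P X m w) := by
    rw [torDiff_apply]
    exact bd_balToChain (hi m) (hi (m + 1)) (P.d_mod m) hX (hid m) w
  have hmem (m : ℕ) (w : BalTensor B X (P.obj m).carrier) :
      balToChain hX (i m) (hi m) w ∈ harrChain B X (m + 1) :=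
    (mem_harrChain (Nat.succ_pos m)).2 (groupAlgChain_balToChain (hi m) hX
      (fun y => by rw [← hip, hpi]) w)
  refine ⟨subQuotEquiv (chainToBal X (p n)).toLinearMap (balToChain hX (i n) (hi n)).toLinearMap
    (ContinuousLinearMap.continuous _) (ContinuousLinearMap.continuous _) ?_ ?_ ?_ ?_ ?_ ?_⟩
  · rintro z ⟨-, hz⟩
    cases n with
    | zero => trivial
    | succ n =>
      have hz : bd B X (n + 1) z = 0 := hz
      exact (hf n z).trans ((congrArg _ hz).trans (map_zero _))
  · intro w hw
    refine ⟨hmem n w, ?_⟩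
    cases n with
    | zero => exact bd_zero hX _
    | succ n =>
      have hw : torDiff P X n w = 0 := hw
      exact (hg n w).trans ((congrArg _ hw).trans (map_zero _))
  · rintro _ - ⟨z, -, rfl⟩
    exact ⟨chainToBal X (p (n + 1)) z, hf n z⟩
  · rintro _ - ⟨w, rfl⟩
    exact ⟨balToChain hX (i (n + 1)) (hi (n + 1)) w, hmem (n + 1) w, hg n w⟩
  · rintro z ⟨hz, hbd⟩
    have h := balToChain_chainToBal (hi n) hX (hip n) z
    rw [(mem_harrChain (Nat.succ_pos n)).1 hz] at h
    have h' := coefMap_unitAct_gen_sub_mem (U := U) hX hz hbd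
    rw [← h] at h'
    exact h'
  · intro w _
    have h := sub_eq_zero.2 (chainToBal_balToChain (hi n) (hp n) hX (hpi n) w)
    exact h.symm ▸ Submodule.zero_mem _

/-- Harrison homology is computed by tensor products with the Harrison resolution. -/
theorem nonempty_harrisonHomology_equiv (hB : HarrisonSplitExact B U) (hX : IsSymmBMod B X)
    (n : ℕ) : Nonempty (HarrisonHomology B X (n + 1) ≃L[ℂ] TorOf (harrResolution hB) X n) :=
  nonempty_harrisonHomology_equiv_of_retract hX (harrResolution hB)
    (i := fun n => (harrChain B U (n + 1)).subtypeL) (fun _ _ _ => rfl)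
    (p := fun n => harrProj B U (n + 1)) (fun n => harrProj_isModMap B U (n + 1))
    (fun n => harrProj_mem (Nat.succ_pos n)) (fun _ => harrProj_coe) (fun _ _ => rfl)
    (fun n z => DFunLike.congr_fun (harrProj_comp_bd B U n) z) n

end Homology

end Chains

/-! ### The unit acts as the identity on homology. -/

section UnitLinked

variable {A : Type u} [NonUnitalNormedCommRing A] [NormedSpace ℂ A]
  [IsScalarTower ℂ A A] [SMulCommClass ℂ A A]
  {M : Type v} [NormedAddCommGroup M] [NormedSpace ℂ M] [BiBMod A M]

lemma lact_hochschildHomology {e : A} (he : ∀ x : M, LeftBMod.lact e x = x) {n : ℕ}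
    (h : HochschildHomology A M n) : LeftBMod.lact e h = h := by
  have hC : ∀ z : Chain A M n, LeftBMod.lact e z = z := by
    intro z
    suffices H : LeftBMod.lact e = ContinuousLinearMap.id ℂ (Chain A M n) from
      DFunLike.congr_fun H z
    refine chain_ext fun x a => ?_
    rw [lact_elem, he]
    rfl
  obtain ⟨z, rfl⟩ := Submodule.Quotient.mk_surjective _ h
  exact congrArg Submodule.Quotient.mk (Subtype.ext (hC z.1))

end UnitLinked

/-- If the Harrison complex with coefficients in the conditional unitization is split exact, then it
is a projective resolution that computes Harrison cohomology and homology. -/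
theorem harrison_resolution (B : Type u) [NonUnitalNormedCommRing B] [NormedSpace ℂ B]
    [IsScalarTower ℂ B B] [SMulCommClass ℂ B B]
    (U : Type u) [NormedAddCommGroup U] [NormedSpace ℂ U] [BiBMod B U] [IsCondUnital B U]
    (hU : ∀ e : B, (∀ b : B, e * b = b) → ∀ u : U, LeftBMod.lact e u = u)
    (hB : HarrisonSplitExact B U) :
    (T2Space (HochschildHomology B U 1) ∧
      CompleteSpace (HochschildHomology B U 1)) ∧
    (∀ e : B, (∀ b : B, e * b = b) →
      ∀ h : HochschildHomology B U 1, LeftBMod.lact e h = h) ∧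
    Nonempty (AdmissibleResolution B (HochschildHomology B U 1)) ∧
    ∀ (P : AdmissibleResolution B (HochschildHomology B U 1))
      (n : ℕ) (X : Type v) [NormedAddCommGroup X] [NormedSpace ℂ X] [CompleteSpace X]
      [BiBMod B X], IsSymmBMod B X →
      Nonempty (HarrisonCohomology B X (n + 1) ≃L[ℂ] ExtOf P X n) ∧
      Nonempty (HarrisonHomology B X (n + 1) ≃L[ℂ] TorOf P X n) := by
  have h1 := hochschildHomology_one_t2Space hB
  have h2 := hochschildHomology_one_completeSpace (B := B) (U := U)
  refine ⟨⟨h1, h2⟩, fun e he h => lact_hochschildHomology (hU e he) h, ⟨harrResolution hB⟩, ?_⟩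
  intro P n X _ _ _ _ hX
  -- The Harrison resolution computes both theories, and independence of the resolution transfers
  -- the result to `P`.
  exact ⟨(nonempty_harrisonCohomology_equiv hB hX n).map2 ContinuousLinearEquiv.trans
    (nonempty_extOf_equiv (harrResolution hB) P X n),
    (nonempty_harrisonHomology_equiv hB hX n).map2 ContinuousLinearEquiv.trans
    (nonempty_torOf_equiv X (harrResolution hB) P n)⟩

/-! ### The conditional unitization satisfies the abstract axioms. -/

section Unit

variable {B : Type u} [NonUnitalNormedCommRing B] [NormedSpace ℂ B]

/-- The scalar part of an element of the conditional unitization. -/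
def cuScalar : condUnitization B →L[ℂ] ℂ :=
  LinearMap.mkContinuous
    { toFun := fun u => u.1.ofLp.fst
      map_add' := fun _ _ => rfl
      map_smul' := fun _ _ => rfl } 1
    (fun u => by
      rw [one_mul, Submodule.coe_norm, WithLp.unitization_norm_def]
      exact le_add_of_nonneg_right (norm_nonneg _))

/-- The component in `B` of an element of the conditional unitization. -/
def cuAlg : condUnitization B →L[ℂ] B :=
  LinearMap.mkContinuous
    { toFun := fun u => u.1.ofLp.snd
      map_add' := fun _ _ => rfl
      map_smul' := fun _ _ => rfl } 1
    (fun u => by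
      rw [one_mul, Submodule.coe_norm, WithLp.unitization_norm_def]
      exact le_add_of_nonneg_left (norm_nonneg _))

lemma condUnitization_ext {u v : condUnitization B} (h1 : cuScalar u = cuScalar v)
    (h2 : cuAlg u = cuAlg v) : u = v :=
  Subtype.ext (WithLp.ofLp_injective 1 (Unitization.ext h1 h2))

variable [IsScalarTower ℂ B B] [SMulCommClass ℂ B B]

lemma cuScalar_lact (b : B) (u : condUnitization B) : cuScalar (LeftBMod.lact b u) = 0 := by
  change (inU B b * u.1).ofLp.fst = 0
  rw [WithLp.unitization_mul]
  exact zero_mul _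

lemma cuAlg_lact (b : B) (u : condUnitization B) :
    cuAlg (LeftBMod.lact b u) = cuScalar u • b + b * cuAlg u := by
  change (inU B b * u.1).ofLp.snd = _
  rw [WithLp.unitization_mul, Unitization.snd_mul]
  have h : (inU B b).ofLp.fst = 0 := rfl
  rw [h, zero_smul, zero_add]
  rfl

lemma isSymmBMod_condUnitization : IsSymmBMod B (condUnitization B) := fun _ _ => rfl

variable (B) in
-- The generator is the embedded unit of `B` if there is one, and the adjoined unit `(1, 0)`
-- otherwise.
lemma exists_unitElt : ∃ o : condUnitization B,
    (∀ u, cuScalar u • o + LeftBMod.lact (cuAlg u) o = u) ∧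
    (∀ b : B, cuScalar o • b + b * cuAlg o = b) ∧
    ((cuScalar o = 1 ∧ cuAlg o = 0) ∨ ∃ e : B, ∀ b : B, e * b = b) := by
  by_cases h : ∃ e : B, ∀ b : B, e * b = b
  · have hU : condUnitization B = LinearMap.range (inU B) := if_pos h
    obtain ⟨e, he⟩ := h
    have hs : ∀ u : condUnitization B, cuScalar u = 0 := by
      rintro ⟨u, hu⟩
      rw [hU] at hu
      obtain ⟨b, rfl⟩ := hu
      rfl
    refine ⟨⟨inU B e, hU ▸ ⟨e, rfl⟩⟩, fun u => ?_, fun b => ?_, Or.inr ⟨e, he⟩⟩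
    · rw [hs, zero_smul, zero_add]
      refine condUnitization_ext ?_ ?_
      · rw [cuScalar_lact, hs]
      · rw [cuAlg_lact, hs, zero_smul, zero_add, mul_comm]
        exact he _
    · rw [hs, zero_smul, zero_add, mul_comm]
      exact he b
  · have hU : condUnitization B = ⊤ := if_neg h
    refine ⟨⟨WithLp.toLp 1 1, hU ▸ trivial⟩, fun u => ?_, fun b => ?_, Or.inl ⟨rfl, rfl⟩⟩
    · refine condUnitization_ext ?_ ?_
      · rw [map_add, map_smul, cuScalar_lact, add_zero]
        exact mul_one _
      · rw [map_add, map_smul, cuAlg_lact]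
        change cuScalar u • (0 : B) + ((1 : ℂ) • cuAlg u + cuAlg u * (0 : B)) = _
        simp
    · change (1 : ℂ) • b + b * (0 : B) = b
      simp

variable (B) in
instance : IsCondUnital B (condUnitization B) where
  isSymm := isSymmBMod_condUnitization
  scalarPart := cuScalar
  algPart := cuAlg
  gen := (exists_unitElt B).choose
  scalarPart_lact := cuScalar_lact
  algPart_lact := cuAlg_lact
  expand := (exists_unitElt B).choose_spec.1
  act_unit := (exists_unitElt B).choose_spec.2.1
  cases := (exists_unitElt B).choose_spec.2.2

lemma lact_condUnitization {e : B} (he : ∀ b : B, e * b = b) (u : condUnitization B) :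
    LeftBMod.lact e u = u := by
  have hU : condUnitization B = LinearMap.range (inU B) := if_pos ⟨e, he⟩
  obtain ⟨u, hu⟩ := u
  refine Subtype.ext ?_
  change inU B e * u = u
  rw [hU] at hu
  obtain ⟨b, rfl⟩ := hu
  rw [← inU_mul, he]

end Unit

end BanachHarrison

end

open BanachHarrison
theorem proposition4p2 {B : Type u} [NonUnitalNormedCommRing B] [NormedSpace ℂ B]
    [IsScalarTower ℂ B B] [SMulCommClass ℂ B B] [CompleteSpace B]
    (hB : HarrisonSplitExact B (condUnitization B)) :
    (T2Space (HochschildHomology B (condUnitization B) 1) ∧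
      CompleteSpace (HochschildHomology B (condUnitization B) 1)) ∧
    (∀ e : B, (∀ b : B, e * b = b) →
      ∀ h : HochschildHomology B (condUnitization B) 1, LeftBMod.lact e h = h) ∧
    Nonempty (AdmissibleResolution B (HochschildHomology B (condUnitization B) 1)) ∧
    ∀ (P : AdmissibleResolution B (HochschildHomology B (condUnitization B) 1))
      (n : ℕ) (X : Type v) [NormedAddCommGroup X] [NormedSpace ℂ X] [CompleteSpace X]
      [BiBMod B X], IsSymmBMod B X →
      Nonempty (HarrisonCohomology B X (n + 1) ≃L[ℂ] ExtOf P X n) ∧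
      Nonempty (HarrisonHomology B X (n + 1) ≃L[ℂ] TorOf P X n) := by
  exact harrison_resolution B (condUnitization B) (fun e he u => lact_condUnitization he u) hB
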